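/- Let $\Gamma$ be a finite group and $n\ge 0$. All groups are profinite, subgroups are closed, homomorphisms and cocycles are continuous. Let $F_n=F_n(\Gamma)$ be the free profinite group on $\{x_{i,\gamma}\mid 1\le i\le n,\ \gamma\in\Gamma\}$ with $\Gamma$ acting by $\sigma(x_{i,\gamma})=x_{i,\sigma\gamma}$. Let $G$ be a profinite $\Gamma$-group, let $\varphi:F_n\to G$ be a $\Gamma$-equivariant surjection with kernel $N$, and let $\pi:F_n\rtimes\Gamma\to G\rtimes\Gamma$ be the induced homomorphism (a $\Gamma$-presentation of $G$). Multiplicities: for a $\Gamma$-equivariant surjection $\omega:F\to H$ of $\Gamma$-groups with kernel $K$, let $M$ be the intersection of all maximal proper $F\rtimes\Gamma$-normal subgroups of $K$. When $K/M$ is a direct product of finite irreducible $F\rtimes\Gamma$-groups and $A$ is a finite simple $H\rtimes\Gamma$-module, $m(\omega,\Gamma,H,A)\in\{0,1,\dots,\infty\}$ denotes the number of factors isomorphic to $A$ as $F\rtimes\Gamma$-groups. For a finite simple $G\rtimes\Gamma$-module $A$, let $\ell$ be its (prime) exponent, $h_{G\rtimes\Gamma}(A)=\dim_{\mathbb F_\ell}\operatorname{Hom}_{G\rtimes\Gamma}(A,A)$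 and $\xi(A)=\dim_{\mathbb F_\ell}A^{\Gamma}/A^{G\rtimes\Gamma}$; all dimensions below are over $\mathbb F_\ell$, and those of $H^2$ may be infinite (then so are the expressions containing them). (1) $N/M$ is a direct product of finite irreducible $F_n\rtimes\Gamma$-groups. If $A$ is a finite simple $G\rtimes\Gamma$-module with $\gcd(|A|,|\Gamma|)=1$, then $m(\pi,\Gamma,G,A)$ does not depend on the decomposition, $H^1(G\rtimes\Gamma,A)$ is finite, and $$m(\pi,\Gamma,G,A)=\frac{n\dim A-\xi(A)+\dim H^2(G\rtimes\Gamma,A)-\dim H^1(G\rtimes\Gamma,A)}{h_{G\rtimes\Gamma}(A)}.$$ Let $F_n'$, $G'$ be the pro-$|\Gamma|'$ completions (maximal quotients all of whose finite quotients have order prime to $|\Gamma|$) of $F_n$, $G$, let $\varphi':F_n'\to G'$ be induced by $\varphi$, with kernel $N'$, let $\pi':F_n'\rtimes\Gamma\to G'\rtimes\Gamma$ be the induced homomorphism, and let $W=\ker(G\to G')$. (2) The corresponding quotient $N'/M'$ is a direct product of finite irreducible $F_n'\rtimes\Gamma$-groups, and for every finite simple $G'\rtimes\Gamma$-module $A$,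 of exponent $\ell$, the multiplicity $m(\pi',\Gamma,G',A)$ does not depend on the decomposition. If $\ell\mid|\Gamma|$, then $m(\pi',\Gamma,G',A)=0$. If $\ell\nmid|\Gamma|$, then $H^1(G'\rtimes\Gamma,A)$ and $H^1(G,A)^\Gamma$ are finite and $$m(\pi',\Gamma,G',A)=\frac{n\dim A-\xi(A)+\dim H^2(G'\rtimes\Gamma,A)-\dim H^1(G'\rtimes\Gamma,A)}{h_{G'\rtimes\Gamma}(A)}\le\frac{n\dim A-\xi(A)+\dim H^2(G,A)^\Gamma-\dim H^1(G,A)^\Gamma}{h_{G\rtimes\Gamma}(A)},$$ where on the right $A$ is a $G\rtimes\Gamma$-module via $G\rtimes\Gamma\to G'\rtimes\Gamma$ and $\Gamma$ acts on $H^i(G,A)$ by conjugation; the inequality is an equality if $H^2(W,\mathbb F_\ell)=0$. (3) Let $d\in\{0,1,\dots,\infty\}$ be the minimal number of generators of $N'$ as a closed normal $\Gamma$-subgroup of $F_n'$, and put $$r=n+\sup_{\ell\nmid|\Gamma|}\ \sup_{A}\left\lceil\frac{\dim H^2(G'\rtimes\Gamma,A)-\dim H^1(G'\rtimes\Gamma,A)-\xi(A)}{\dim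 A}\right\rceil,$$ $$r^*=n+\sup_{\ell\nmid|\Gamma|}\ \sup_{A}\left\lceil\frac{\dim H^2(G,A)^\Gamma-\dim H^1(G,A)^\Gamma-\xi(A)}{\dim A}\right\rceil,$$ where $\ell$ runs over primes and $A$ over the finite simple $\mathbb F_\ell[G'\rtimes\Gamma]$-modules. If $N'$ is trivial, or the closure of its commutator subgroup is not all of $N'$, then $d=r\le r^*$, and $d=r^*$ if $H^2(W,\mathbb F_\ell)=0$ for all primes $\ell\nmid|\Gamma|$. Whenever $N'\neq1$, $d=\max(r,1)\le\max(r^*,1)$, and $d=\max(r^*,1)$ if $H^2(W,\mathbb F_\ell)=0$ for all primes $\ell\nmid|\Gamma|$. -/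

import Mathlib

universe u v w

/-! ### Groups with operators, semidirect products -/

/-- The semidirect product `G ⋊ Γ` of a group `G` on which `Γ` acts by automorphisms, with
`(g₁, γ₁) (g₂, γ₂) = (g₁ γ₁(g₂), γ₁ γ₂)`. -/
abbrev SemiProd (G : Type v) (Γ : Type u) [Group G] [Group Γ] [MulDistribMulAction Γ G] :=
  SemidirectProduct G Γ (MulDistribMulAction.toMulAut Γ G)

/-- The topology on `G ⋊ Γ` is the product topology of `G × Γ`. -/
instance SemiProd.instTopologicalSpace (G : Type v) (Γ : Type u) [Group G] [Group Γ]
    [MulDistribMulAction Γ G] [TopologicalSpace G] [TopologicalSpace Γ] :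
    TopologicalSpace (SemiProd G Γ) :=
  TopologicalSpace.induced (fun x => (x.left, x.right)) instTopologicalSpaceProd

/-- The homomorphism `G₁ ⋊ Γ → G₂ ⋊ Γ` induced by a `Γ`-equivariant homomorphism `G₁ → G₂`;
it is the identity on `Γ`. -/
def SemiProd.map {G₁ : Type v} {G₂ : Type w} {Γ : Type u} [Group G₁] [Group G₂] [Group Γ]
    [MulDistribMulAction Γ G₁] [MulDistribMulAction Γ G₂]
    (f : G₁ →* G₂) (hf : ∀ (γ : Γ) (x : G₁), f (γ • x) = γ • f x) :
    SemiProd G₁ Γ →* SemiProd G₂ Γ :=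
  SemidirectProduct.map f (MonoidHom.id Γ) (fun γ => by ext x; exact hf γ x)

/-! ### The free profinite `Γ`-group `F_n(Γ)` -/

/-- The endomorphism of the (abstract) free group on the letters `x_{i,γ}` sending
`x_{i,γ}` to `x_{i,σγ}`. -/
def freeTranslate (n : ℕ) {Γ : Type u} [Group Γ] (σ : Γ) :
    FreeGroup (Fin n × Γ) →* FreeGroup (Fin n × Γ) :=
  FreeGroup.map (fun p => (p.1, σ * p.2))

/-- `F_n(Γ)` as a profinite group: the free profinite group on the (finite) set of letters
`x_{i,γ}`, i.e. the profinite completion of the free group on these letters. -/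
noncomputable abbrev freeProfiniteGrp (n : ℕ) (Γ : Type u) [Group Γ] : ProfiniteGrp.{u} :=
  ProfiniteGrp.profiniteCompletion.obj (GrpCat.of (FreeGroup (Fin n × Γ)))

/-- The free profinite `Γ`-group `F_n(Γ)` on `n` generators. -/
def FreeProfinite (n : ℕ) (Γ : Type u) [Group Γ] : Type u := freeProfiniteGrp n Γ

namespace FreeProfinite

variable (n : ℕ) (Γ : Type u) [Group Γ]

noncomputable instance : Group (FreeProfinite n Γ) :=
  inferInstanceAs (Group (freeProfiniteGrp n Γ))

noncomputable instance : TopologicalSpace (FreeProfinite n Γ) :=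
  inferInstanceAs (TopologicalSpace (freeProfiniteGrp n Γ))

instance : IsTopologicalGroup (FreeProfinite n Γ) :=
  inferInstanceAs (IsTopologicalGroup (freeProfiniteGrp n Γ))

instance : CompactSpace (FreeProfinite n Γ) :=
  inferInstanceAs (CompactSpace (freeProfiniteGrp n Γ))

instance : T2Space (FreeProfinite n Γ) :=
  inferInstanceAs (T2Space (freeProfiniteGrp n Γ))

instance : TotallyDisconnectedSpace (FreeProfinite n Γ) :=
  inferInstanceAs (TotallyDisconnectedSpace (freeProfiniteGrp n Γ))

/-- The letter `x_{i,γ}` in `F_n(Γ)`. -/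
noncomputable def letter {n : ℕ} {Γ : Type u} [Group Γ] (i : Fin n) (γ : Γ) :
    FreeProfinite n Γ :=
  ProfiniteGrp.ProfiniteCompletion.etaFn (GrpCat.of (FreeGroup (Fin n × Γ)))
    (FreeGroup.of (i, γ))

/-- The continuous endomorphism of `F_n(Γ)` sending `x_{i,γ}` to `x_{i,σγ}`. -/
noncomputable def translate {n : ℕ} {Γ : Type u} [Group Γ] (σ : Γ) :
    freeProfiniteGrp n Γ ⟶ freeProfiniteGrp n Γ :=
  ProfiniteGrp.profiniteCompletion.map (GrpCat.ofHom (freeTranslate n σ))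

theorem translate_one : translate (n := n) (1 : Γ) = CategoryTheory.CategoryStruct.id _ := by
  have h : freeTranslate n (1 : Γ) = MonoidHom.id _ := by
    ext p; simp [freeTranslate]
  rw [translate, h]
  exact CategoryTheory.Functor.map_id _ _

theorem translate_mul (σ τ : Γ) : translate (n := n) (σ * τ) =
    CategoryTheory.CategoryStruct.comp (translate τ) (translate σ) := by
  have h : freeTranslate n (σ * τ) = (freeTranslate n σ).comp (freeTranslate n τ) := by
    ext p; simp [freeTranslate, mul_assoc]
  rw [translate, h, GrpCat.ofHom_comp]
  exact CategoryTheory.Functor.map_comp _ _ _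

/-- The action of `Γ` on `F_n(Γ)`, given by `σ(x_{i,γ}) = x_{i,σγ}`. -/
noncomputable instance : MulDistribMulAction Γ (FreeProfinite n Γ) where
  smul σ x := (translate σ).hom (show freeProfiniteGrp n Γ from x)
  one_smul x := by
    change (translate (n := n) (1 : Γ)).hom _ = x
    rw [translate_one]; rfl
  mul_smul σ τ x := by
    change (translate (n := n) (σ * τ)).hom _ = _
    rw [translate_mul]; rfl
  smul_mul σ x y := map_mul (translate (n := n) σ).hom _ _
  smul_one σ := map_one (translate (n := n) σ).hom

instance : ContinuousConstSMul Γ (FreeProfinite n Γ) where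
  continuous_const_smul σ := (translate (n := n) σ).hom.continuous_toFun

theorem smul_letter {n : ℕ} {Γ : Type u} [Group Γ] (σ γ : Γ) (i : Fin n) :
    σ • (letter i γ : FreeProfinite n Γ) = letter i (σ * γ) := by
  have h := ProfiniteGrp.ProfiniteCompletion.lift_eta
    (CategoryTheory.CategoryStruct.comp (GrpCat.ofHom (freeTranslate n σ))
      (ProfiniteGrp.ProfiniteCompletion.eta (GrpCat.of (FreeGroup (Fin n × Γ)))))
  exact CategoryTheory.ConcreteCategory.congr_hom h (FreeGroup.of (i, γ))

end FreeProfinite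

/-! ### The maximal pro-`m'` quotient -/

/-- The intersection of all open normal subgroups of `G` whose index is prime to `m`. -/
def proPrimeKernel (m : ℕ) (G : Type v) [Group G] [TopologicalSpace G] : Subgroup G :=
  sInf {V : Subgroup G | V.Normal ∧ IsOpen (V : Set G) ∧ V.index.Coprime m}

instance proPrimeKernel_normal (m : ℕ) (G : Type v) [Group G] [TopologicalSpace G] :
    (proPrimeKernel m G).Normal := by
  refine ⟨fun x hx g => ?_⟩
  simp only [proPrimeKernel, Subgroup.mem_sInf, Set.mem_ofPred_eq] at hx ⊢
  exact fun V hV => hV.1.conj_mem x (hx V hV) g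

theorem proPrimeKernel_map (m : ℕ) {G₁ : Type v} {G₂ : Type w} [Group G₁] [TopologicalSpace G₁]
    [Group G₂] [TopologicalSpace G₂] (f : G₁ →* G₂) (hf : Continuous f) :
    proPrimeKernel m G₁ ≤ (proPrimeKernel m G₂).comap f := by
  intro x hx
  simp only [proPrimeKernel, Subgroup.mem_sInf, Set.mem_ofPred_eq, Subgroup.mem_comap] at hx ⊢
  rintro V ⟨hV, hVo, hVi⟩
  refine hx (V.comap f) ⟨hV.comap f, hVo.preimage hf, ?_⟩
  rw [Subgroup.index_comap]
  exact Nat.Coprime.coprime_dvd_left (Subgroup.relIndex_dvd_index_of_normal V f.range) hVi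

/-- The pro-`m'` completion of a profinite group `G`. It is the inverse limit of all
quotients of `G` by open normal subgroups of index prime to `m`; by compactness this is the
quotient of `G` by the intersection of these subgroups. -/
abbrev ProPrimeCompletion (m : ℕ) (G : Type v) [Group G] [TopologicalSpace G] : Type v :=
  G ⧸ proPrimeKernel m G

namespace ProPrimeCompletion

/-- Functoriality of the pro-`m'` completion. -/
def map (m : ℕ) {G₁ : Type v} {G₂ : Type w} [Group G₁] [TopologicalSpace G₁]
    [Group G₂] [TopologicalSpace G₂] (f : G₁ →ₜ* G₂) :
    ProPrimeCompletion m G₁ →* ProPrimeCompletion m G₂ :=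
  QuotientGroup.map _ _ f.toMonoidHom (proPrimeKernel_map m f.toMonoidHom f.continuous_toFun)

variable {m : ℕ} {G : Type v} [Group G] [TopologicalSpace G]
  {Γ : Type u} [Group Γ] [MulDistribMulAction Γ G] [ContinuousConstSMul Γ G]

/-- The induced action of `Γ` on the completion of a `Γ`-group, `γ • [x] = [γ • x]`. -/
instance instAction : MulDistribMulAction Γ (ProPrimeCompletion m G) where
  smul γ x := QuotientGroup.map _ _ (MulDistribMulAction.toMonoidHom G γ)
    (proPrimeKernel_map m _ (continuous_const_smul γ)) x
  one_smul x := by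
    induction x using QuotientGroup.induction_on with
    | H z => exact congrArg QuotientGroup.mk (one_smul Γ z)
  mul_smul γ δ x := by
    induction x using QuotientGroup.induction_on with
    | H z => exact congrArg QuotientGroup.mk (mul_smul γ δ z)
  smul_mul γ x y := map_mul (QuotientGroup.map _ _ (MulDistribMulAction.toMonoidHom G γ)
    (proPrimeKernel_map m _ (continuous_const_smul γ))) x y
  smul_one γ := map_one (QuotientGroup.map _ _ (MulDistribMulAction.toMonoidHom G γ)
    (proPrimeKernel_map m _ (continuous_const_smul γ)))

theorem mk_smul (γ : Γ) (x : G) :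
    QuotientGroup.mk' (proPrimeKernel m G) (γ • x) =
      γ • QuotientGroup.mk' (proPrimeKernel m G) x := rfl

theorem map_smul {G₂ : Type w} [Group G₂] [TopologicalSpace G₂] [MulDistribMulAction Γ G₂]
    [ContinuousConstSMul Γ G₂] (f : G →ₜ* G₂) (hf : ∀ (γ : Γ) (x : G), f (γ • x) = γ • f x)
    (γ : Γ) (x : ProPrimeCompletion m G) : map m f (γ • x) = γ • map m f x := by
  induction x using QuotientGroup.induction_on with
  | H z => exact congrArg QuotientGroup.mk (hf γ z)

end ProPrimeCompletion

/-! ### Multiplicities -/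

section Multiplicity

/-- An irreducible `H`-group: a nontrivial group with an action of `H` by automorphisms and
without proper nontrivial `H`-stable subgroups. (All groups `B` to which this is applied are
finite.) -/
def IsIrreducibleGroup {H : Type u} [Group H] {B : Type v} [Group B] (σ : H →* MulAut B) : Prop :=
  Nontrivial B ∧ ∀ S : Subgroup B, (∀ (h : H), ∀ b ∈ S, σ h b ∈ S) → S = ⊥ ∨ S = ⊤

/-- Isomorphism of `H`-groups. -/
def IsoGroups {H : Type u} [Group H] {B : Type v} [Group B] {C : Type w} [Group C]
    (σ : H →* MulAut B) (τ : H →* MulAut C) : Prop :=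
  ∃ e : B ≃* C, ∀ (h : H) (b : B), e (σ h b) = τ h (e b)

variable (Γ : Type u) [Group Γ] {F : Type v} [Group F] [TopologicalSpace F]
  [MulDistribMulAction Γ F]

/-- `U` is a closed subgroup of `F` which is normal in `F ⋊ Γ`, i.e. a closed normal
`Γ`-subgroup of `F`. -/
def IsClosedNormal (U : Subgroup F) : Prop :=
  IsClosed (U : Set F) ∧ U.Normal ∧ ∀ (γ : Γ), ∀ x ∈ U, γ • x ∈ U

/-- `U` is a maximal proper `F ⋊ Γ`-normal subgroup of `N`. -/
def IsMaximalProper (N U : Subgroup F) : Prop :=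
  (IsClosedNormal Γ U ∧ U < N) ∧ ∀ V : Subgroup F, IsClosedNormal Γ V → U ≤ V → V < N → V = U

/-- The subgroup `M` of `N`: the intersection of all maximal proper `F ⋊ Γ`-normal subgroups
of `N` (it is `N` itself if there are none). -/
def maximalIntersection (N : Subgroup F) : Subgroup F :=
  N ⊓ sInf {U | IsMaximalProper Γ N U}

/-- A decomposition of `N / M` as a direct product of finite irreducible `F ⋊ Γ`-groups
`B i`: a continuous surjection `N → ∏ i, B i` with kernel `M` (each finite group `B i` being
discrete) that is equivariant for the conjugation action
`(x, γ) (y, 1) (x, γ)⁻¹ = (x γ(y) x⁻¹, 1)` of `F ⋊ Γ` on `N`.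
As `N / M` is compact, this is the same as an isomorphism of profinite `F ⋊ Γ`-groups
from `N / M` onto `∏ i, B i`. -/
structure IrreducibleDecomposition (N : Subgroup F) where
  ι : Type v
  B : ι → Type v
  [group : ∀ i, Group (B i)]
  [finite : ∀ i, Finite (B i)]
  act : ∀ i, SemiProd F Γ →* MulAut (B i)
  irreducible : ∀ i, IsIrreducibleGroup (act i)
  proj : N →* (∀ i, B i)
  continuous_proj : ∀ i, IsLocallyConstant (fun x : N => proj x i)
  surjective_proj : Function.Surjective proj
  ker_proj : ∀ x : N, proj x = 1 ↔ (x : F) ∈ maximalIntersection Γ N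
  equivariant : ∀ (h : SemiProd F Γ) (y z : N),
    (z : F) = h.left * (h.right • (y : F)) * h.left⁻¹ → ∀ i, proj z i = act i h (proj y i)

attribute [instance] IrreducibleDecomposition.group IrreducibleDecomposition.finite

variable {Γ}

/-- The number of factors of a decomposition that are isomorphic to a given `F ⋊ Γ`-group. -/
noncomputable def IrreducibleDecomposition.count {N : Subgroup F}
    (D : IrreducibleDecomposition Γ N) {C : Type w} [Group C]
    (τ : SemiProd F Γ →* MulAut C) : ℕ∞ :=
  Set.encard {i : D.ι | IsoGroups (D.act i) τ}

/-- The multiplicity of the `F ⋊ Γ`-group `C` in `N / M`: the number of factors isomorphic to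
`C` in a decomposition of `N / M` into finite irreducible `F ⋊ Γ`-groups. (The supremum only
serves to choose a decomposition; existence of decompositions and independence of the choice are
asserted separately, together with the value.) -/
noncomputable def groupMultiplicity (N : Subgroup F) {C : Type w} [Group C]
    (τ : SemiProd F Γ →* MulAut C) : ℕ∞ :=
  ⨆ D : IrreducibleDecomposition Γ N, D.count τ

variable (Γ)

/-- The smallest closed normal `Γ`-subgroup of `F` containing `S`. -/
def closedNormalClosure (S : Set F) : Subgroup F :=
  sInf {U | IsClosedNormal Γ U ∧ S ⊆ U}

/-- The minimal number of generators of `N` as a closed normal `Γ`-subgroup of `F`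
(`⊤` if no finite set generates). -/
noncomputable def minGenerators (N : Subgroup F) : ℕ∞ :=
  ⨅ (S : Set F) (_ : closedNormalClosure Γ S = N), S.encard

end Multiplicity

/-! ### Finite simple modules and continuous cohomology in degrees 1 and 2 -/

/-- A finite simple (discrete, continuous) `𝔽_ℓ[H]`-module. -/
structure FinSimpleModule (ℓ : ℕ) [Fact ℓ.Prime] (H : Type v) [Group H] [TopologicalSpace H] where
  V : Type w
  [addCommGroup : AddCommGroup V]
  [module : Module (ZMod ℓ) V]
  [finite : Finite V]
  ρ : Representation (ZMod ℓ) H V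
  continuous : ∀ a : V, IsLocallyConstant (fun h : H => ρ h a)
  irreducible : ρ.IsIrreducible

attribute [instance] FinSimpleModule.addCommGroup FinSimpleModule.module FinSimpleModule.finite

/-- The inclusion of `ℕ∞` in the extended real numbers. -/
noncomputable def toE (x : ℕ∞) : EReal := ((x : ENNReal) : EReal)

/-- The dimension of a vector space, as an extended real number (`⊤` if infinite). -/
noncomputable def eDim (ℓ : ℕ) (V : Type w) [AddCommGroup V] [Module (ZMod ℓ) V] : EReal :=
  toE (Cardinal.toENat (Module.rank (ZMod ℓ) V))

/-- The least integer `≥ x`, as an extended real number (`⊤` if `x = ⊤`). -/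
noncomputable def eCeil (x : EReal) : EReal :=
  sInf {y : EReal | ∃ k : ℤ, y = ((k : ℝ) : EReal) ∧ x ≤ y}

section Cohomology

variable {ℓ : ℕ} {H : Type v} [Group H] {V : Type w} [AddCommGroup V] [Module (ZMod ℓ) V]

/-- The `H`-group (written multiplicatively) underlying a module. -/
def moduleAut (ρ : Representation (ZMod ℓ) H V) : H →* MulAut (Multiplicative V) where
  toFun h :=
    { toFun := fun a => Multiplicative.ofAdd (ρ h a.toAdd)
      invFun := fun a => Multiplicative.ofAdd (ρ h⁻¹ a.toAdd)
      left_inv := fun a => by simp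
      right_inv := fun a => by simp
      map_mul' := fun a b => by simp }
  map_one' := by ext a; simp
  map_mul' g h := by ext a; simp

variable [TopologicalSpace H] (ρ : Representation (ZMod ℓ) H V)

/-- Continuous 1-cocycles: `f(gh) = f(g) + g f(h)`. The coefficients are discrete, so
continuous means locally constant. -/
def Z1 : Submodule (ZMod ℓ) (H → V) where
  carrier := {f | IsLocallyConstant f ∧ ∀ g h, f (g * h) = f g + ρ g (f h)}
  zero_mem' := ⟨IsLocallyConstant.const 0, by simp⟩
  add_mem' := by
    rintro f f' ⟨hf, h1⟩ ⟨hf', h2⟩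
    refine ⟨hf.add hf', fun g h => ?_⟩
    simp only [Pi.add_apply, h1, h2, map_add]; abel
  smul_mem' := by
    rintro c f ⟨hf, h1⟩
    refine ⟨hf.comp (fun a => c • a), fun g h => ?_⟩
    simp only [Pi.smul_apply, h1, map_smul, smul_add]

/-- 1-coboundaries: `f(g) = g a - a`. -/
def B1 : Submodule (ZMod ℓ) (H → V) where
  carrier := {f | ∃ a : V, ∀ g, f g = ρ g a - a}
  zero_mem' := ⟨0, by simp⟩
  add_mem' := by
    rintro f f' ⟨a, ha⟩ ⟨b, hb⟩
    refine ⟨a + b, fun g => ?_⟩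
    simp only [Pi.add_apply, ha, hb, map_add]; abel
  smul_mem' := by
    rintro c f ⟨a, ha⟩
    refine ⟨c • a, fun g => ?_⟩
    simp only [Pi.smul_apply, ha, map_smul, smul_sub]

/-- Continuous 2-cocycles: `g f(h,k) - f(gh,k) + f(g,hk) - f(g,h) = 0`. -/
def Z2 : Submodule (ZMod ℓ) (H × H → V) where
  carrier := {f | IsLocallyConstant f ∧
    ∀ g h k, ρ g (f (h, k)) + f (g, h * k) = f (g * h, k) + f (g, h)}
  zero_mem' := ⟨IsLocallyConstant.const 0, by simp⟩
  add_mem' := by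
    rintro f f' ⟨hf, h1⟩ ⟨hf', h2⟩
    refine ⟨hf.add hf', fun g h k => ?_⟩
    have e1 := h1 g h k
    have e2 := h2 g h k
    simp only [Pi.add_apply, map_add]
    calc _ = (ρ g (f (h, k)) + f (g, h * k)) + (ρ g (f' (h, k)) + f' (g, h * k)) := by abel
      _ = _ := by rw [e1, e2]; abel
  smul_mem' := by
    rintro c f ⟨hf, h1⟩
    refine ⟨hf.comp (fun a => c • a), fun g h k => ?_⟩
    simp only [Pi.smul_apply, map_smul, ← smul_add, h1]

/-- Continuous 2-coboundaries: `f(g,h) = g c(h) - c(gh) + c(g)` with `c` continuous. -/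
def B2 : Submodule (ZMod ℓ) (H × H → V) where
  carrier := {f | ∃ c : H → V, IsLocallyConstant c ∧
    ∀ g h, f (g, h) = ρ g (c h) - c (g * h) + c g}
  zero_mem' := ⟨0, IsLocallyConstant.const 0, by simp⟩
  add_mem' := by
    rintro f f' ⟨c, hc, h1⟩ ⟨c', hc', h2⟩
    refine ⟨c + c', hc.add hc', fun g h => ?_⟩
    simp only [Pi.add_apply, h1, h2, map_add]; abel
  smul_mem' := by
    rintro r f ⟨c, hc, h1⟩
    refine ⟨r • c, hc.comp (fun a => r • a), fun g h => ?_⟩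
    simp only [Pi.smul_apply, h1, map_smul, smul_sub, smul_add]

/-- Continuous cohomology `H¹(H, V)`. -/
abbrev H1 := Z1 ρ ⧸ (B1 ρ).submoduleOf (Z1 ρ)

/-- Continuous cohomology `H²(H, V)`. -/
abbrev H2 := Z2 ρ ⧸ (B2 ρ).submoduleOf (Z2 ρ)

end Cohomology

/-! ### The conjugation action of `Γ` on `Hⁱ(G, V)` for a `G ⋊ Γ`-module `V` -/

section Conjugation

variable {ℓ : ℕ} {G : Type v} {Γ : Type u} [Group G] [Group Γ] [MulDistribMulAction Γ G]
  {V : Type w} [AddCommGroup V] [Module (ZMod ℓ) V]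

/-- Restriction of a `G ⋊ Γ`-module to `G`. -/
abbrev resG (ρ : Representation (ZMod ℓ) (SemiProd G Γ) V) : Representation (ZMod ℓ) G V :=
  ρ.comp SemidirectProduct.inl

/-- Restriction of a `G ⋊ Γ`-module to `Γ`. -/
abbrev resΓ (ρ : Representation (ZMod ℓ) (SemiProd G Γ) V) : Representation (ZMod ℓ) Γ V :=
  ρ.comp SemidirectProduct.inr

/-- `ξ(V) = dim (V^Γ / V^{G ⋊ Γ})`. -/
noncomputable def xi (ρ : Representation (ZMod ℓ) (SemiProd G Γ) V) : EReal :=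
  eDim ℓ ((resΓ ρ).invariants ⧸ ρ.invariants.submoduleOf (resΓ ρ).invariants)

variable (ρ : Representation (ZMod ℓ) (SemiProd G Γ) V)

/-- `(γ f)(g) = γ f(γ⁻¹(g))` on 1-cochains. -/
def conjC1 (γ : Γ) : (G → V) →ₗ[ZMod ℓ] (G → V) where
  toFun f g := resΓ ρ γ (f (γ⁻¹ • g))
  map_add' f f' := by ext g; simp
  map_smul' c f := by ext g; simp

/-- `(γ f)(g, h) = γ f(γ⁻¹(g), γ⁻¹(h))` on 2-cochains. -/
def conjC2 (γ : Γ) : (G × G → V) →ₗ[ZMod ℓ] (G × G → V) where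
  toFun f p := resΓ ρ γ (f (γ⁻¹ • p.1, γ⁻¹ • p.2))
  map_add' f f' := by ext g; simp
  map_smul' c f := by ext g; simp

theorem resΓ_resG (γ : Γ) (g : G) (a : V) :
    resΓ ρ γ (resG ρ (γ⁻¹ • g) a) = resG ρ g (resΓ ρ γ a) := by
  have h : (SemidirectProduct.inr γ : SemiProd G Γ) * SemidirectProduct.inl (γ⁻¹ • g) =
      SemidirectProduct.inl g * SemidirectProduct.inr γ := by
    ext <;> simp
  have := congrArg (fun x => ρ x a) h
  simpa using this

theorem conjB1_mem (γ : Γ) (f : G → V) (hf : f ∈ B1 (resG ρ)) : conjC1 ρ γ f ∈ B1 (resG ρ) := by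
  obtain ⟨a, ha⟩ := hf
  refine ⟨resΓ ρ γ a, fun g => ?_⟩
  simp only [conjC1, LinearMap.coe_mk, AddHom.coe_mk]
  rw [ha, map_sub, resΓ_resG]

variable [TopologicalSpace G] [ContinuousConstSMul Γ G]

theorem conjC1_mem (γ : Γ) (f : G → V) (hf : f ∈ Z1 (resG ρ)) : conjC1 ρ γ f ∈ Z1 (resG ρ) := by
  refine ⟨(hf.1.comp_continuous (continuous_const_smul γ⁻¹)).comp (resΓ ρ γ), fun g h => ?_⟩
  simp only [conjC1, LinearMap.coe_mk, AddHom.coe_mk]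
  rw [smul_mul', hf.2, map_add, resΓ_resG]

theorem conjC2_mem (γ : Γ) (f : G × G → V) (hf : f ∈ Z2 (resG ρ)) :
    conjC2 ρ γ f ∈ Z2 (resG ρ) := by
  have hc : Continuous (fun p : G × G => (γ⁻¹ • p.1, γ⁻¹ • p.2)) :=
    (continuous_fst.const_smul γ⁻¹).prodMk (continuous_snd.const_smul γ⁻¹)
  refine ⟨(hf.1.comp_continuous hc).comp (resΓ ρ γ), fun g h k => ?_⟩
  simp only [conjC2, LinearMap.coe_mk, AddHom.coe_mk]
  rw [smul_mul', smul_mul', ← resΓ_resG, ← map_add, hf.2, map_add]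

theorem conjB2_mem (γ : Γ) (f : G × G → V) (hf : f ∈ B2 (resG ρ)) :
    conjC2 ρ γ f ∈ B2 (resG ρ) := by
  obtain ⟨c, hc, h⟩ := hf
  refine ⟨conjC1 ρ γ c,
    (hc.comp_continuous (continuous_const_smul γ⁻¹)).comp (resΓ ρ γ), fun g k => ?_⟩
  simp only [conjC1, conjC2, LinearMap.coe_mk, AddHom.coe_mk]
  rw [h, map_add, map_sub, resΓ_resG, smul_mul']

/-- The action of `γ` on `H¹(G, V)`. -/
def conjH1 (γ : Γ) : H1 (resG ρ) →ₗ[ZMod ℓ] H1 (resG ρ) :=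
  Submodule.mapQ _ _ ((conjC1 ρ γ).restrict (conjC1_mem ρ γ))
    (fun f hf => conjB1_mem ρ γ f.1 hf)

/-- The action of `γ` on `H²(G, V)`. -/
def conjH2 (γ : Γ) : H2 (resG ρ) →ₗ[ZMod ℓ] H2 (resG ρ) :=
  Submodule.mapQ _ _ ((conjC2 ρ γ).restrict (conjC2_mem ρ γ))
    (fun f hf => conjB2_mem ρ γ f.1 hf)

/-- `H¹(G, V)^Γ`. -/
def H1inv : Submodule (ZMod ℓ) (H1 (resG ρ)) :=
  ⨅ γ : Γ, LinearMap.eqLocus (conjH1 ρ γ) LinearMap.id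

/-- `H²(G, V)^Γ`. -/
def H2inv : Submodule (ZMod ℓ) (H2 (resG ρ)) :=
  ⨅ γ : Γ, LinearMap.eqLocus (conjH2 ρ γ) LinearMap.id

end Conjugation

/-! ### Data attached to a `Γ`-presentation `F_n(Γ) ⋊ Γ → G ⋊ Γ` -/

section Presentation

variable {ℓ : ℕ} {n : ℕ} {Γ : Type u} [Group Γ] {G : Type v} [Group G] [MulDistribMulAction Γ G]
  {V : Type w} [AddCommGroup V] [Module (ZMod ℓ) V]

/-- `dim Hom_H(V, V)`. -/
noncomputable def homDim {H : Type v} [Group H] (ρ : Representation (ZMod ℓ) H V) : EReal :=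
  eDim ℓ (Representation.IntertwiningMap ρ ρ)

/-- For a `Γ`-equivariant homomorphism `φ : F → G` and a `G ⋊ Γ`-module `V`: the
`F ⋊ Γ`-group underlying `V`, where `F ⋊ Γ` acts through `F ⋊ Γ → G ⋊ Γ`. -/
def pullbackAut {F : Type*} [Group F] [MulDistribMulAction Γ F] (φ : F →* G)
    (hφ : ∀ (γ : Γ) (x : F), φ (γ • x) = γ • φ x)
    (ρ : Representation (ZMod ℓ) (SemiProd G Γ) V) : SemiProd F Γ →* MulAut (Multiplicative V) :=
  moduleAut (ρ.comp (SemiProd.map φ hφ))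

/-- `m(π, Γ, G, A)`: the multiplicity of the `G ⋊ Γ`-module `A` in the kernel of the
`Γ`-equivariant homomorphism `φ : F → G`, where `π : F ⋊ Γ → G ⋊ Γ` is induced by `φ`. -/
noncomputable def presMultiplicity {F : Type w} [Group F] [TopologicalSpace F]
    [MulDistribMulAction Γ F] (φ : F →* G) (hφ : ∀ (γ : Γ) (x : F), φ (γ • x) = γ • φ x)
    {V : Type*} [AddCommGroup V] [Module (ZMod ℓ) V]
    (ρ : Representation (ZMod ℓ) (SemiProd G Γ) V) : ℕ∞ :=
  groupMultiplicity φ.ker (pullbackAut φ hφ ρ)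

/-- For the pro-`m'` completion `G'` of `G`, a `G' ⋊ Γ`-module viewed as a `G ⋊ Γ`-module via
`G ⋊ Γ → G' ⋊ Γ`. -/
def inflate {m : ℕ} [TopologicalSpace G] [ContinuousConstSMul Γ G]
    (ρ : Representation (ZMod ℓ) (SemiProd (ProPrimeCompletion m G) Γ) V) :
    Representation (ZMod ℓ) (SemiProd G Γ) V :=
  ρ.comp (SemiProd.map (QuotientGroup.mk' (proPrimeKernel m G)) ProPrimeCompletion.mk_smul)

end Presentation

section Sup

variable (Γ : Type u) [Group Γ] [TopologicalSpace Γ] (G : Type v) [Group G] [TopologicalSpace G]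
  [MulDistribMulAction Γ G] [ContinuousConstSMul Γ G]

/-- With `G'` the pro-`|Γ|'` completion of `G`: the supremum, over all primes `ℓ ∤ |Γ|` and all
finite simple `𝔽_ℓ[G' ⋊ Γ]`-modules `A`, of
`⌈(dim H²(G' ⋊ Γ, A) - dim H¹(G' ⋊ Γ, A) - ξ(A)) / dim A⌉`. -/
noncomputable def relatorSup : EReal :=
  ⨆ (ℓ : ℕ) (_ : Fact ℓ.Prime) (_ : ¬ ℓ ∣ Nat.card Γ)
    (A : FinSimpleModule.{max u v, w} ℓ (SemiProd (ProPrimeCompletion (Nat.card Γ) G) Γ)),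
    eCeil ((eDim ℓ (H2 A.ρ) - eDim ℓ (H1 A.ρ) - xi A.ρ) / eDim ℓ A.V)

/-- The same supremum with `dim H²(G, A)^Γ` and `dim H¹(G, A)^Γ` in place of
`dim H²(G' ⋊ Γ, A)` and `dim H¹(G' ⋊ Γ, A)`. -/
noncomputable def relatorSupInv : EReal :=
  ⨆ (ℓ : ℕ) (_ : Fact ℓ.Prime) (_ : ¬ ℓ ∣ Nat.card Γ)
    (A : FinSimpleModule.{max u v, w} ℓ (SemiProd (ProPrimeCompletion (Nat.card Γ) G) Γ)),
    eCeil ((eDim ℓ (H2inv (inflate A.ρ)) - eDim ℓ (H1inv (inflate A.ρ)) - xi (inflate A.ρ)) /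
      eDim ℓ A.V)

end Sup

/-! Fix a simple module `A` of exponent `ℓ` prime to `|Γ|`. Its multiplicity in `N / M` is read off
from the space of continuous equivariant homomorphisms `N → A`. Such a homomorphism kills `M` and
involves finitely many factors of a decomposition, and by Schur's lemma each component is zero or an
isomorphism. So multiplicity times `dim End A` equals `dim Hom(N, A)` (`count_mul_dimN`), whatever
the decomposition. A decomposition exists by Zorn's lemma for independent families of maximal
subgroups, together with compactness (`nonempty_irreducibleDecomposition`).

The dimension of `Hom(N, A)` comes from the five-term sequence of `N → F_n → G`, written with
`Γ`-equivariant cochains. As `|Γ|` is invertible on `A`, averaging shows that equivariant 2-cocycles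
modulo coboundaries of equivariant cochains compute both `H²(G ⋊ Γ, A)` and `H²(G, A)^Γ`
(`isEquivH2_toH2semi`, `isEquivH2_toH2inv`), and that the equivariant 1-cocycles have dimension `dim
H¹ + ξ` for either version of `H¹`. On `F_n` an equivariant 1-cocycle is given by arbitrary values
at the `n` letters `x_{i,1}`, and every 2-cocycle is a coboundary. Hence `dim Hom(N, A) + dim H¹ + ξ
= n dim A + dim H²` (`dimN_eqHom_add`), stated without subtraction so that infinite dimensions are
allowed.

For the completions, let `P` be the kernel of `F_n → G'`. Homomorphisms `P → A` kill the kernel of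
`F_n → F_n'`, so `Hom(N', A) = Hom(P, A)` (`dimN_eqHom_map`), and the formula for `F_n → G'`
applies. Restriction from `P` to `N` is injective because `W = P / N` has no nonzero homomorphism to
`A`; the obstruction to surjectivity lies in `H²(W, A)`, where `W` acts trivially
(`restrictEqHom_injective`, `restrictEqHom_surjective`).

Elements generate `N'` when no maximal proper normal subgroup contains them all. For noncommutative
factors one nontrivial coordinate suffices; for the factors isomorphic to `A` the coordinates must
be independent over `End A`, which is possible with `k` elements exactly when `dim Hom(N', A) ≤ k
dim A` (`minGenerators_le_iff`). So `d` is the supremum of `⌈dim Hom(N', A) / dim A⌉`, raised to `1`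
if `N' ≠ 1`, and the dimension formula turns this supremum into `r`. -/

/-! ### Dimensions with values in `ℕ∞` -/

section Dimension

/-- The dimension of a vector space with values in `ℕ∞`. -/
noncomputable def dimN (K : Type*) (V : Type*) [Semiring K] [AddCommMonoid V] [Module K V] : ℕ∞ :=
  Cardinal.toENat (Module.rank K V)

variable {K : Type*} [Field K] {V : Type*} [AddCommGroup V] [Module K V]
  {W : Type*} [AddCommGroup W] [Module K W]

theorem dimN_congr (e : V ≃ₗ[K] W) : dimN K V = dimN K W := by
  have h := e.lift_rank_eq
  have := congrArg Cardinal.toENat h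
  simpa [dimN] using this

theorem dimN_quotient_add (p : Submodule K V) : dimN K (V ⧸ p) + dimN K p = dimN K V := by
  have := congrArg Cardinal.toENat (Submodule.rank_quotient_add_rank p)
  simpa [dimN] using this

theorem dimN_range_add_ker (f : V →ₗ[K] W) :
    dimN K (LinearMap.range f) + dimN K (LinearMap.ker f) = dimN K V := by
  rw [← dimN_quotient_add (LinearMap.ker f), dimN_congr f.quotKerEquivRange]

theorem dimN_add_ker_of_surjective (f : V →ₗ[K] W) (hf : Function.Surjective f) :
    dimN K W + dimN K (LinearMap.ker f) = dimN K V := by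
  rw [← dimN_quotient_add (LinearMap.ker f), dimN_congr (f.quotKerEquivOfSurjective hf)]

theorem dimN_le_of_injective (f : V →ₗ[K] W) (hf : Function.Injective f) :
    dimN K V ≤ dimN K W := by
  rw [dimN_congr (LinearEquiv.ofInjective f hf), ← dimN_quotient_add (LinearMap.range f)]
  exact le_add_self

theorem dimN_eq_finrank [Module.Finite K V] : dimN K V = Module.finrank K V := by
  rw [dimN, ← Module.finrank_eq_rank K V]; simp

theorem dimN_ne_top_iff : dimN K V ≠ ⊤ ↔ Module.Finite K V := by
  rw [dimN, Ne, Cardinal.toENat_eq_top, not_le, Module.rank_lt_aleph0_iff]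

theorem dimN_pi (n : ℕ) [Module.Finite K V] : dimN K (Fin n → V) = n * dimN K V := by
  rw [dimN_eq_finrank, dimN_eq_finrank, Module.finrank_pi_fintype]
  simp

theorem dimN_finsupp (ι : Type*) : dimN K (ι →₀ V) = ENat.card ι * dimN K V := by
  rw [dimN, rank_finsupp]
  simp [dimN, ENat.card]

/-- A counting form of the five-term exact sequence. -/
theorem dimN_five_term {S T X H Z : Type*} [AddCommGroup S] [Module K S] [AddCommGroup T]
    [Module K T] [AddCommGroup X] [Module K X] [AddCommGroup H] [Module K H]
    [AddCommGroup Z] [Module K Z]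
    (p : T →ₗ[K] X) (q : T →ₗ[K] H) (i : S →ₗ[K] T) (k : Z →ₗ[K] S)
    (hp : Function.Surjective p) (hq : Function.Surjective q)
    (hker : LinearMap.ker q = LinearMap.ker p ⊔ LinearMap.range i)
    (hk : Function.Injective k) (hki : LinearMap.range k = LinearMap.ker (p ∘ₗ i)) :
    dimN K X + dimN K Z = dimN K S + dimN K H := by
  set R := LinearMap.range (p ∘ₗ i)
  have h1 : dimN K R + dimN K Z = dimN K S := by
    rw [dimN_congr (LinearEquiv.ofInjective k hk), hki]
    exact dimN_range_add_ker (p ∘ₗ i)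
  -- Modulo the image `R` of `S`, the map `p` acquires the same kernel as `q`, so `X ⧸ R` and `H`
  -- are isomorphic.
  have hR : LinearMap.ker (R.mkQ ∘ₗ p) = LinearMap.ker q := by
    rw [LinearMap.ker_comp, Submodule.ker_mkQ, hker]
    change Submodule.comap p (LinearMap.range (p ∘ₗ i)) = _
    rw [LinearMap.range_comp, Submodule.comap_map_eq, sup_comm]
  have e : (X ⧸ R) ≃ₗ[K] H :=
    ((R.mkQ ∘ₗ p).quotKerEquivOfSurjective ((Submodule.mkQ_surjective R).comp hp)).symm ≪≫ₗ
      Submodule.quotEquivOfEq _ _ hR ≪≫ₗ q.quotKerEquivOfSurjective hq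
  rw [← dimN_quotient_add R, dimN_congr e, ← h1]
  ring

end Dimension

/-! ### Passage from `ℕ∞` to the extended reals -/

section ExtendedReals

@[simp] theorem toE_natCast (n : ℕ) : toE n = n := by
  have : (((n : ℕ∞) : ENNReal)) = ((n : NNReal) : ENNReal) := by simp
  rw [toE, this]
  exact EReal.coe_natCast

@[simp] theorem toE_top : toE ⊤ = ⊤ := by
  simp [toE]

theorem toE_mono {a b : ℕ∞} (h : a ≤ b) : toE a ≤ toE b := by
  simpa [toE] using h

theorem toE_le_iff {a b : ℕ∞} : toE a ≤ toE b ↔ a ≤ b := by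
  simp [toE]

/-- Subtraction of `h1` and `ξ` is harmless because `hz` makes both finite; `X` and `h2` can then
only be infinite simultaneously. -/
theorem toE_euler {X z h1 h2 ξ d : ℕ∞} {n : ℕ} (h : X + z = n * d + h2) (h' : h1 + ξ = z)
    (hz : z ≠ ⊤) (hd : d ≠ ⊤) :
    toE X = n * toE d - toE ξ + toE h2 - toE h1 := by
  subst h'
  lift d to ℕ using hd
  have : h1 ≠ ⊤ := fun h => by simp [h] at hz
  lift h1 to ℕ using this
  have : ξ ≠ ⊤ := fun h => by simp [h] at hz
  lift ξ to ℕ using this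
  induction X using ENat.recTopCoe with
  | top =>
    have : h2 = ⊤ := by
      by_contra h3
      lift h2 to ℕ using h3
      rw [top_add] at h
      exact absurd h.symm (by exact_mod_cast ENat.natCast_ne_top _)
    subst this
    simp only [toE_top, toE_natCast]
    have : ((n : EReal) * d - ξ) = (((n * d - ξ : ℤ) : ℝ) : EReal) := by
      push_cast; simp
    rw [this, EReal.coe_add_top]
    have : ((h1 : ℕ) : EReal) = ((h1 : ℝ) : EReal) := by simp
    rw [this, EReal.top_sub_coe]
  | coe X =>
    have : h2 ≠ ⊤ := by
      rintro rfl
      simp only [add_top] at h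
      exact absurd h (by exact_mod_cast ENat.natCast_ne_top _)
    lift h2 to ℕ using this
    have h : X + (h1 + ξ) = n * d + h2 := by exact_mod_cast h
    have h : (X : ℝ) = n * d - ξ + h2 - h1 := by
      have : (X : ℝ) + (h1 + ξ) = n * d + h2 := by exact_mod_cast h
      linarith
    simp only [toE_natCast]
    have := congrArg (fun x : ℝ => (x : EReal)) h
    push_cast at this
    exact this

theorem toE_div {m X h : ℕ∞} (hm : m * h = X) (h0 : h ≠ 0) (ht : h ≠ ⊤) :
    toE m = toE X / toE h := by
  subst hm
  lift h to ℕ using ht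
  have h0 : 0 < h := by
    rcases Nat.eq_zero_or_pos h with rfl | h1
    · simp at h0
    · exact h1
  have hh : (0 : EReal) < (h : EReal) := by exact_mod_cast h0
  induction m using ENat.recTopCoe with
  | top =>
    rw [ENat.top_mul (by exact_mod_cast h0.ne'), toE_top, toE_natCast]
    rw [EReal.top_div_of_pos_ne_top hh (EReal.natCast_ne_top h)]
  | coe m =>
    have : ((m : ℕ∞) * h) = ((m * h : ℕ) : ℕ∞) := by push_cast; rfl
    rw [this]
    simp only [toE_natCast]
    rw [EReal.natCast_mul, EReal.div_eq_inv_mul, mul_comm (m : EReal), ← mul_assoc,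
      ← EReal.div_eq_inv_mul, EReal.div_self (EReal.natCast_ne_bot h) (EReal.natCast_ne_top h)
        hh.ne', one_mul]

end ExtendedReals

/-! ### Open normal subgroups and locally constant functions on profinite groups -/

section Topology

open Topology

/-- Intersecting the finitely many `Γ`-translates of an open normal subgroup makes it stable under
`Γ`. -/
theorem exists_openNormal_subset (Γ : Type*) [Group Γ] [Finite Γ] {F : Type*} [Group F]
    [TopologicalSpace F] [IsTopologicalGroup F] [CompactSpace F] [TotallyDisconnectedSpace F]
    [T2Space F] [MulDistribMulAction Γ F] [ContinuousConstSMul Γ F] {U : Set F} (hU : U ∈ 𝓝 (1 : F)) :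
    ∃ V : Subgroup F, V.Normal ∧ IsOpen (V : Set F) ∧ (∀ (γ : Γ), ∀ x ∈ V, γ • x ∈ V) ∧
      (V : Set F) ⊆ U := by
  obtain ⟨O, hOU, hO, h1⟩ := mem_nhds_iff.1 hU
  obtain ⟨V, hV⟩ := ProfiniteGrp.exist_openNormalSubgroup_sub_open_nhds_of_one hO h1
  refine ⟨⨅ γ : Γ, V.toSubgroup.comap (MulDistribMulAction.toMonoidHom F γ), ?_, ?_, ?_, ?_⟩
  · exact Subgroup.normal_iInf_normal fun γ => Subgroup.Normal.comap inferInstance _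
  · rw [Subgroup.coe_iInf]
    exact isOpen_iInter_of_finite fun γ => V.isOpen'.preimage (continuous_const_smul γ)
  · intro γ x hx
    simp only [Subgroup.mem_iInf, Subgroup.mem_comap, MulDistribMulAction.toMonoidHom_apply]
      at hx ⊢
    intro δ
    rw [smul_smul]
    exact hx _
  · intro x hx
    simp only [SetLike.mem_coe, Subgroup.mem_iInf, Subgroup.mem_comap,
      MulDistribMulAction.toMonoidHom_apply] at hx
    have := hx 1
    rw [one_smul] at this
    exact hOU (hV this)

variable {F : Type*} [Group F] [TopologicalSpace F] [IsTopologicalGroup F] [CompactSpace F]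
  [TotallyDisconnectedSpace F] [T2Space F]

theorem exists_openNormal_subset' {U : Set F} (hU : U ∈ 𝓝 (1 : F)) :
    ∃ V : Subgroup F, V.Normal ∧ IsOpen (V : Set F) ∧ (V : Set F) ⊆ U := by
  obtain ⟨O, hOU, hO, h1⟩ := mem_nhds_iff.1 hU
  obtain ⟨V, hV⟩ := ProfiniteGrp.exist_openNormalSubgroup_sub_open_nhds_of_one hO h1
  exact ⟨V.toSubgroup, inferInstance, V.isOpen', hV.trans hOU⟩

theorem exists_openNormal_notMem_sup (Γ : Type*) [Group Γ] [Finite Γ] [MulDistribMulAction Γ F]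
    [ContinuousConstSMul Γ F] {L : Subgroup F} (hL : IsClosed (L : Set F)) {x : F}
    (hx : x ∉ L) :
    ∃ V : Subgroup F, V.Normal ∧ IsOpen (V : Set F) ∧ (∀ (γ : Γ), ∀ x ∈ V, γ • x ∈ V) ∧
      x ∉ L ⊔ V := by
  have hU : {v : F | x * v ∉ L} ∈ 𝓝 (1 : F) := by
    refine (hL.isOpen_compl.preimage (continuous_const_mul x)).mem_nhds ?_
    simpa using hx
  obtain ⟨V, hVn, hVo, hVΓ, hV⟩ := exists_openNormal_subset Γ hU
  refine ⟨V, hVn, hVo, hVΓ, fun h => ?_⟩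
  obtain ⟨l, hl, v, hv, rfl⟩ := Subgroup.mem_sup_of_normal_right.1 h
  exact hV (V.inv_mem hv) (by simpa using hl)

/-- Local constancy near each `(1, x)` becomes uniform in `x` by compactness; in effect a locally
constant function on a profinite group factors through a finite quotient. -/
theorem IsLocallyConstant.exists_openNormal_mul_right {X : Type*} {f : F → X}
    (hf : IsLocallyConstant f) :
    ∃ V : Subgroup F, V.Normal ∧ IsOpen (V : Set F) ∧ ∀ x, ∀ v ∈ V, f (x * v) = f x := by
  have key : ∀ᶠ v in 𝓝 (1 : F), ∀ x ∈ (Set.univ : Set F), f (x * v) = f x := by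
    refine isCompact_univ.eventually_forall_of_forall_eventually fun x _ => ?_
    have h1 : IsLocallyConstant (fun p : F × F => (f (p.2 * p.1), f p.2)) :=
      (hf.comp_continuous (continuous_snd.mul continuous_fst)).prodMk
        (hf.comp_continuous continuous_snd)
    have h2 := h1.isOpen_fiber (f x, f x)
    filter_upwards [h2.mem_nhds (x := ((1 : F), x)) (by simp)] with p hp
    simp only [Prod.mk.injEq] at hp
    rw [hp.1, hp.2]
  obtain ⟨V, hVn, hVo, hV⟩ := exists_openNormal_subset' key
  exact ⟨V, hVn, hVo, fun x v hv => hV hv x trivial⟩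

theorem IsLocallyConstant.exists_openNormal_mul_right₂ {X : Type*} {f : F × F → X}
    (hf : IsLocallyConstant f) :
    ∃ V : Subgroup F, V.Normal ∧ IsOpen (V : Set F) ∧
      ∀ x y, ∀ v ∈ V, ∀ v' ∈ V, f (x * v, y * v') = f (x, y) := by
  obtain ⟨V, hVn, hVo, hV⟩ := hf.exists_openNormal_mul_right
  refine ⟨V.comap (MonoidHom.inl F F) ⊓ V.comap (MonoidHom.inr F F), ?_, ?_, ?_⟩
  · have h1 : (V.comap (MonoidHom.inl F F)).Normal := hVn.comap _
    have h2 : (V.comap (MonoidHom.inr F F)).Normal := hVn.comap _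
    exact Subgroup.normal_inf_normal _ _
  · exact (hVo.preimage (by exact Continuous.prodMk_left 1)).inter
      (hVo.preimage (by exact Continuous.prodMk_right 1))
  · rintro x y v hv v' hv'
    have h := hV (x, y) (v, v') (by
      have := V.mul_mem hv.1 hv'.2
      simpa using this)
    simpa using h

/-- A continuous surjection from a compact space to a Hausdorff space is a quotient map. This lets
functions descend along arbitrary, possibly discontinuous, set-theoretic sections. -/
theorem IsLocallyConstant.of_comp_surjective {E Q X : Type*} [TopologicalSpace E] [CompactSpace E]
    [TopologicalSpace Q] [T2Space Q] {p : E → Q} (hp : Continuous p)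
    (hs : Function.Surjective p) {g : Q → X} (hg : IsLocallyConstant (g ∘ p)) :
    IsLocallyConstant g := by
  have hq : IsQuotientMap p := hp.isClosedMap.isQuotientMap hp hs
  intro s
  rw [← hq.isOpen_preimage]
  exact hg s

theorem IsLocallyConstant.pi {ι X Y : Type*} [Finite ι] [TopologicalSpace X] {f : X → ι → Y}
    (hf : ∀ i, IsLocallyConstant (fun x => f x i)) : IsLocallyConstant f := by
  rw [IsLocallyConstant.iff_eventually_eq]
  intro x
  have h : ∀ᶠ y in 𝓝 x, ∀ i, f y i = f x i :=
    Filter.eventually_all.2 fun i => (IsLocallyConstant.iff_eventually_eq _).1 (hf i) x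
  exact h.mono fun y hy => funext hy

/-- A continuous homomorphism from a normal subgroup to a discrete group extends to a
locally constant function. -/
theorem exists_extension_of_hom {A : Type*} [AddCommGroup A] (N : Subgroup F) [N.Normal]
    (f : N → A) (hf : IsLocallyConstant f) (hadd : ∀ x y, f (x * y) = f x + f y) :
    ∃ c : F → A, IsLocallyConstant c ∧ ∀ (n : N) (x : F), c (n * x) = f n + c x := by
  have f1 : f 1 = 0 := by simpa using hadd 1 1
  have finv : ∀ x, f x⁻¹ = - f x := fun x => by
    have := hadd x⁻¹ x
    rw [inv_mul_cancel, f1] at this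
    exact eq_neg_of_add_eq_zero_left this.symm
  obtain ⟨U, hUo, hU⟩ := isOpen_induced_iff.1 (hf.isOpen_fiber 0)
  have h1U : (1 : F) ∈ U := by
    have : (1 : N) ∈ Subtype.val ⁻¹' U := by rw [hU]; exact f1
    exact this
  obtain ⟨V, hVn, hVo, hVU⟩ := exists_openNormal_subset' (hUo.mem_nhds h1U)
  have hV : ∀ n : N, (n : F) ∈ V → f n = 0 := fun n hn => by
    have : n ∈ Subtype.val ⁻¹' U := hVU hn
    rw [hU] at this
    exact this
  -- Since `f` kills `N ∩ V`, it extends to `P = N V` by ignoring the factor in `V`; representatives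
  -- `t` of the cosets of `P` then carry the extension to all of `F`.
  set P := N ⊔ V
  have hP : P.Normal := Subgroup.sup_normal N V
  let t : F → F := fun x => (QuotientGroup.mk (s := P) x).out
  have ht : ∀ x, x * (t x)⁻¹ ∈ P := fun x => by
    have h : (QuotientGroup.mk (s := P) (t x)) = QuotientGroup.mk x := Quotient.out_eq _
    rw [QuotientGroup.eq] at h
    have := hP.conj_mem _ h (t x)
    simpa [mul_assoc] using this
  have ht' : ∀ p ∈ P, ∀ x, t (p * x) = t x := fun p hp x => by
    have : (QuotientGroup.mk (s := P) (p * x)) = QuotientGroup.mk x := by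
      rw [eq_comm, QuotientGroup.eq]
      have := hP.conj_mem _ hp x⁻¹
      simpa [mul_assoc] using this
    simp only [t, this]
  have hex : ∀ x, ∃ n : N, (n : F)⁻¹ * (x * (t x)⁻¹) ∈ V := fun x => by
    obtain ⟨n, hn, v, hv, h⟩ := Subgroup.mem_sup_of_normal_right.1 (ht x)
    exact ⟨⟨n, hn⟩, by rw [← h]; simpa using hv⟩
  choose s hs using hex
  have huniq : ∀ x (n : N), (n : F)⁻¹ * (x * (t x)⁻¹) ∈ V → f (s x) = f n := fun x n hn => by
    have h : f (n⁻¹ * s x) = 0 := by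
      apply hV
      have := V.mul_mem hn (V.inv_mem (hs x))
      simpa [mul_assoc] using this
    rw [hadd, finv] at h
    exact (eq_neg_of_add_eq_zero_right h).trans (neg_neg _)
  refine ⟨fun x => f (s x), ?_, fun n x => ?_⟩
  · rw [IsLocallyConstant.iff_exists_open]
    intro x
    refine ⟨(fun y => y * x⁻¹) ⁻¹' V, hVo.preimage (continuous_mul_const _), by simp, ?_⟩
    intro y hy
    refine huniq y (s x) ?_
    have hy : y * x⁻¹ ∈ V := hy
    have hty : t y = t x := by
      have := ht' (y * x⁻¹) ((le_sup_right : V ≤ P) hy) x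
      simpa using this
    rw [hty]
    have h := V.mul_mem (hVn.conj_mem _ hy (s x : F)⁻¹) (hs x)
    simpa [mul_assoc] using h
  · change f (s (n * x)) = f n + f (s x)
    rw [huniq (n * x) (n * s x), hadd]
    rw [ht' n ((le_sup_left : N ≤ P) n.2)]
    have := hs x
    simpa [mul_assoc] using this

end Topology

/-! ### The universal property of `F_n(Γ)` for cochains -/

namespace FreeProfinite

variable {n : ℕ} {Γ : Type u} [Group Γ]

/-- The dense copy of the free group. -/
noncomputable def ofFree : FreeGroup (Fin n × Γ) →* FreeProfinite n Γ :=
  (ProfiniteGrp.ProfiniteCompletion.eta (GrpCat.of (FreeGroup (Fin n × Γ)))).hom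

theorem denseRange_ofFree : DenseRange (ofFree : FreeGroup (Fin n × Γ) → FreeProfinite n Γ) :=
  ProfiniteGrp.ProfiniteCompletion.denseRange (GrpCat.of (FreeGroup (Fin n × Γ)))

theorem eq_top_of_letter_mem (S : Subgroup (FreeProfinite n Γ))
    (hS : IsClosed (S : Set (FreeProfinite n Γ))) (h : ∀ i γ, letter i γ ∈ S) : S = ⊤ := by
  have h1 : (ofFree (n := n) (Γ := Γ)).range ≤ S := by
    rintro _ ⟨x, rfl⟩
    have : (⊤ : Subgroup (FreeGroup (Fin n × Γ))) ≤ S.comap ofFree := by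
      rw [← FreeGroup.closure_range_of, Subgroup.closure_le]
      rintro _ ⟨⟨i, γ⟩, rfl⟩
      exact h i γ
    exact this trivial
  rw [eq_top_iff]
  intro x _
  have h2 : closure (Set.range (ofFree (n := n) (Γ := Γ))) ⊆ (S : Set _) :=
    closure_minimal (by rw [← MonoidHom.coe_range]; exact h1) hS
  exact h2 (denseRange_ofFree x)

/-- The universal property of the profinite completion, with `Shrink` moving the finite target into
the universe of `Γ`. -/
theorem exists_hom_of_finite {X : Type*} [Group X] [Finite X] (f : Fin n → Γ → X) :
    ∃ σ : FreeProfinite n Γ →* X, IsLocallyConstant σ ∧ ∀ i γ, σ (letter i γ) = f i γ := by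
  have : Small.{u} X := inferInstance
  let Y := Shrink.{u} X
  let e : Y ≃* X := Shrink.mulEquiv
  let : TopologicalSpace Y := ⊥
  have : DiscreteTopology Y := ⟨rfl⟩
  have : Finite Y := Finite.of_equiv X e.symm.toEquiv
  let P : ProfiniteGrp.{u} := ProfiniteGrp.of Y
  let f0 : FreeGroup (Fin n × Γ) →* Y := FreeGroup.lift (fun p => e.symm (f p.1 p.2))
  let g : GrpCat.of (FreeGroup (Fin n × Γ)) ⟶ GrpCat.of P := GrpCat.ofHom f0
  let σ := ProfiniteGrp.ProfiniteCompletion.lift g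
  refine ⟨e.toMonoidHom.comp (σ.hom.toMonoidHom : FreeProfinite n Γ →* Y), ?_, fun i γ => ?_⟩
  · have : IsLocallyConstant (σ.hom : FreeProfinite n Γ → Y) :=
      (IsLocallyConstant.iff_continuous _).2 σ.hom.continuous_toFun
    exact this.comp e
  · have h := ProfiniteGrp.ProfiniteCompletion.lift_eta g
    have h := CategoryTheory.ConcreteCategory.congr_hom h (FreeGroup.of (i, γ))
    have h2 : σ.hom (letter i γ : FreeProfinite n Γ) = f0 (FreeGroup.of (i, γ)) := h
    change e (σ.hom (letter i γ : FreeProfinite n Γ)) = _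
    rw [h2]
    simp [f0]

end FreeProfinite

/-! ### Twisted products -/

/-- The set `V × Q` underlying the extension of `Q` by `V` attached to a 2-cocycle. -/
@[ext] structure TwistedProd (V : Type w) (Q : Type v) where
  fst : V
  snd : Q

namespace TwistedProd

variable {ℓ : ℕ} {Q : Type v} [Group Q] {V : Type w} [AddCommGroup V] [Module (ZMod ℓ) V]
  (ρ : Representation (ZMod ℓ) Q V) (z : Q × Q → V)

theorem cocycle_one_left (hz : ∀ g h k, ρ g (z (h, k)) + z (g, h * k) = z (g * h, k) + z (g, h))
    (k : Q) : z (1, k) = z (1, 1) := by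
  have := hz 1 1 k
  simpa using this

theorem cocycle_one_right (hz : ∀ g h k, ρ g (z (h, k)) + z (g, h * k) = z (g * h, k) + z (g, h))
    (g : Q) : z (g, 1) = ρ g (z (1, 1)) := by
  have := hz g 1 1
  simpa [eq_comm] using this

/-- The extension of `Q` by `V` attached to a 2-cocycle. -/
@[reducible] noncomputable def group
    (hz : ∀ g h k, ρ g (z (h, k)) + z (g, h * k) = z (g * h, k) + z (g, h)) :
    Group (TwistedProd V Q) :=
  letI : Mul (TwistedProd V Q) :=
    -- With the minus sign, a homomorphism `x ↦ (c x, x)` satisfies `d c = z` rather than `d c =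
    -- -z`.
    ⟨fun x y => ⟨x.fst + ρ x.snd y.fst - z (x.snd, y.snd), x.snd * y.snd⟩⟩
  -- The cocycle is not assumed normalised, so the unit has first coordinate `z (1, 1)`.
  letI : One (TwistedProd V Q) := ⟨⟨z (1, 1), 1⟩⟩
  letI : Inv (TwistedProd V Q) :=
    ⟨fun x => ⟨z (1, 1) + z (x.snd⁻¹, x.snd) - ρ x.snd⁻¹ x.fst, x.snd⁻¹⟩⟩
  Group.ofLeftAxioms
    (fun x y t => by
      have h := hz x.snd y.snd t.snd
      refine TwistedProd.ext ?_ (mul_assoc _ _ _)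
      change x.fst + ρ x.snd y.fst - z (x.snd, y.snd) + ρ (x.snd * y.snd) t.fst
          - z (x.snd * y.snd, t.snd) = x.fst + ρ x.snd (y.fst + ρ y.snd t.fst - z (y.snd, t.snd))
          - z (x.snd, y.snd * t.snd)
      rw [map_sub, map_add, map_mul, Module.End.mul_apply]
      have h' := eq_sub_of_add_eq h
      rw [h']
      abel)
    (fun x => by
      refine TwistedProd.ext ?_ (one_mul _)
      change z (1, 1) + ρ 1 x.fst - z (1, x.snd) = x.fst
      rw [cocycle_one_left ρ z hz x.snd, map_one, Module.End.one_apply]; abel)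
    (fun x => by
      refine TwistedProd.ext ?_ (inv_mul_cancel _)
      change z (1, 1) + z (x.snd⁻¹, x.snd) - ρ x.snd⁻¹ x.fst + ρ x.snd⁻¹ x.fst
        - z (x.snd⁻¹, x.snd) = z (1, 1)
      abel)

end TwistedProd

namespace FreeProfinite

variable {n : ℕ} {Γ : Type u} [Group Γ] {ℓ : ℕ} {V : Type w} [AddCommGroup V]
  [Module (ZMod ℓ) V]

/-- Every continuous 2-cocycle on `F_n(Γ)` is the coboundary of a continuous cochain with
prescribed values on the letters. -/
theorem exists_cochain [Finite V] (ρ : Representation (ZMod ℓ) (FreeProfinite n Γ) V)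
    (hρ : ∀ a, IsLocallyConstant (fun x => ρ x a)) (z : FreeProfinite n Γ × FreeProfinite n Γ → V)
    (hz : z ∈ Z2 ρ) (a : Fin n → Γ → V) :
    ∃ c : FreeProfinite n Γ → V, IsLocallyConstant c ∧
      (∀ x y, z (x, y) = ρ x (c y) - c (x * y) + c x) ∧ ∀ i γ, c (letter i γ) = a i γ := by
  -- The cocycle and the action both factor through a finite quotient `Q`. By freeness `F_n → Q`
  -- lifts to the finite extension of `Q` by `V` defined by the cocycle, with any chosen
  -- `V`-coordinates at the letters; the `V`-coordinate of the lift is the cochain.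
  obtain ⟨U₁, hU₁n, hU₁o, hU₁⟩ := hz.1.exists_openNormal_mul_right₂
  have hρ' : IsLocallyConstant (fun x : FreeProfinite n Γ => (fun a => ρ x a)) :=
    IsLocallyConstant.pi hρ
  obtain ⟨U₂, hU₂n, hU₂o, hU₂⟩ := hρ'.exists_openNormal_mul_right
  let U := U₁ ⊓ U₂
  have : U.Normal := Subgroup.normal_inf_normal _ _
  have hUo : IsOpen (U : Set (FreeProfinite n Γ)) := hU₁o.inter hU₂o
  let Q := FreeProfinite n Γ ⧸ U
  have : Finite Q := Subgroup.quotient_finite_of_isOpen U hUo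
  have hout : ∀ x : FreeProfinite n Γ, ∃ v ∈ U, (QuotientGroup.mk (s := U) x).out = x * v := by
    intro x
    refine ⟨x⁻¹ * (QuotientGroup.mk (s := U) x).out, ?_, by simp⟩
    rw [← QuotientGroup.eq]
    exact (Quotient.out_eq _).symm
  let zQ : Q × Q → V := fun p => z (p.1.out, p.2.out)
  have hzQ : ∀ x y : FreeProfinite n Γ, zQ (QuotientGroup.mk x, QuotientGroup.mk y) = z (x, y) := by
    intro x y
    obtain ⟨v, hv, h⟩ := hout x
    obtain ⟨v', hv', h'⟩ := hout y
    simp only [zQ]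
    rw [h, h']
    exact hU₁ x y v hv.1 v' hv'.1
  have hker : U ≤ ρ.ker := fun v hv => by
    have : (fun a => ρ (1 * v) a) = fun a => ρ 1 a := hU₂ 1 v hv.2
    rw [one_mul] at this
    rw [MonoidHom.mem_ker]
    ext a
    simpa using congrFun this a
  let ρQ : Representation (ZMod ℓ) Q V := QuotientGroup.lift U ρ hker
  have hρQ : ∀ x : FreeProfinite n Γ, ρQ (QuotientGroup.mk x) = ρ x := fun x => rfl
  have hzc : ∀ g h k, ρQ g (zQ (h, k)) + zQ (g, h * k) = zQ (g * h, k) + zQ (g, h) := by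
    intro g h k
    obtain ⟨x, rfl⟩ := QuotientGroup.mk_surjective g
    obtain ⟨y, rfl⟩ := QuotientGroup.mk_surjective h
    obtain ⟨t, rfl⟩ := QuotientGroup.mk_surjective k
    rw [hρQ, ← QuotientGroup.mk_mul, ← QuotientGroup.mk_mul, hzQ, hzQ, hzQ, hzQ]
    exact hz.2 x y t
  let : Group (TwistedProd V Q) := TwistedProd.group ρQ zQ hzc
  have : Finite (TwistedProd V Q) :=
    Finite.of_injective (fun x => (x.fst, x.snd)) fun x y h => by
      simp only [Prod.mk.injEq] at h
      exact TwistedProd.ext h.1 h.2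
  obtain ⟨σ, hσ, hσl⟩ := exists_hom_of_finite (n := n) (Γ := Γ) (X := TwistedProd V Q)
    (fun i γ => ⟨a i γ, QuotientGroup.mk (letter i γ)⟩)
  -- Two homomorphisms agreeing on the letters agree everywhere, because their equaliser is a closed
  -- subgroup.
  have hsnd : ∀ x, (σ x).snd = QuotientGroup.mk x := by
    let pr : TwistedProd V Q →* Q := ⟨⟨fun x => x.snd, rfl⟩, fun _ _ => rfl⟩
    have h := eq_top_of_letter_mem ((pr.comp σ).eqLocus (QuotientGroup.mk' U)) ?_ ?_
    · intro x
      have : x ∈ (pr.comp σ).eqLocus (QuotientGroup.mk' U) := by rw [h]; trivial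
      exact this
    · have h1 : IsLocallyConstant (fun x => ((pr.comp σ) x, QuotientGroup.mk' U x)) := by
        refine (hσ.comp pr).prodMk ?_
        have := QuotientGroup.discreteTopology hUo
        exact (IsLocallyConstant.iff_continuous _).2 QuotientGroup.continuous_mk
      rw [← isOpen_compl_iff]
      exact h1 {p | p.1 ≠ p.2}
    · intro i γ
      change (σ (letter i γ)).snd = _
      rw [hσl]; rfl
  refine ⟨fun x => (σ x).fst, hσ.comp _, fun x y => ?_, fun i γ => by simp only [hσl]⟩
  have h : (σ (x * y)).fst = (σ x).fst + ρQ (σ x).snd (σ y).fst - zQ ((σ x).snd, (σ y).snd) := by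
    rw [map_mul]; rfl
  simp only
  rw [h, hsnd, hsnd, hzQ, hρQ]
  abel

/-- The zero set of a continuous 1-cocycle is a closed subgroup, and the letters generate `F_n`
topologically. -/
theorem cocycle_eq_zero (ρ : Representation (ZMod ℓ) (FreeProfinite n Γ) V)
    (f : FreeProfinite n Γ → V) (hf : f ∈ Z1 ρ) (h : ∀ i γ, f (letter i γ) = 0) : f = 0 := by
  have f1 : f 1 = 0 := by simpa using hf.2 1 1
  let S : Subgroup (FreeProfinite n Γ) :=
    { carrier := {x | f x = 0}
      one_mem' := f1
      mul_mem' := fun {x y} hx hy => by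
        change f (x * y) = 0
        rw [hf.2, show f x = 0 from hx, show f y = 0 from hy]; simp
      inv_mem' := fun {x} hx => by
        have := hf.2 x⁻¹ x
        rw [inv_mul_cancel, f1, show f x = 0 from hx] at this
        simpa using this.symm }
  have hS := eq_top_of_letter_mem S (hf.1.isClosed_fiber 0) h
  funext x
  have : x ∈ S := by rw [hS]; trivial
  exact this

end FreeProfinite

/-! ### Averaging over a finite group -/

section Average

variable {K : Type*} [Field K] {Γ : Type*} [Group Γ] [Finite Γ] {M : Type*} [AddCommGroup M]
  [Module K M]

/-- The average of the values of a function on a finite group. -/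
noncomputable def meanValue (K : Type*) [Field K] {Γ : Type*} [Finite Γ] {M : Type*}
    [AddCommGroup M] [Module K M] (f : Γ → M) : M :=
  (Nat.card Γ : K)⁻¹ • ∑ᶠ γ, f γ

omit [Group Γ] in
theorem meanValue_eq [Fintype Γ] (f : Γ → M) :
    meanValue K f = (Nat.card Γ : K)⁻¹ • ∑ γ, f γ := by
  rw [meanValue, finsum_eq_sum_of_fintype]

omit [Group Γ] in
theorem meanValue_const (hΓ : (Nat.card Γ : K) ≠ 0) (m : M) :
    meanValue K (fun _ : Γ => m) = m := by
  have := Fintype.ofFinite Γ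
  rw [meanValue_eq, Finset.sum_const, Finset.card_univ, ← Nat.card_eq_fintype_card,
    ← Nat.cast_smul_eq_nsmul K, inv_smul_smul₀ hΓ]

omit [Group Γ] in
theorem meanValue_add (f g : Γ → M) :
    meanValue K (fun γ => f γ + g γ) = meanValue K f + meanValue K g := by
  have := Fintype.ofFinite Γ
  simp only [meanValue_eq, Finset.sum_add_distrib, smul_add]

omit [Group Γ] in
theorem meanValue_sub (f g : Γ → M) :
    meanValue K (fun γ => f γ - g γ) = meanValue K f - meanValue K g := by
  have := Fintype.ofFinite Γ
  simp only [meanValue_eq, Finset.sum_sub_distrib, smul_sub]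

omit [Group Γ] in
theorem map_meanValue {M' : Type*} [AddCommGroup M'] [Module K M'] (φ : M →ₗ[K] M') (f : Γ → M) :
    φ (meanValue K f) = meanValue K (fun γ => φ (f γ)) := by
  have := Fintype.ofFinite Γ
  simp only [meanValue_eq, map_smul, map_sum]

omit [Group Γ] in
theorem meanValue_mem (S : Submodule K M) (f : Γ → M) (h : ∀ γ, f γ ∈ S) :
    meanValue K f ∈ S := by
  have := Fintype.ofFinite Γ
  rw [meanValue_eq]
  exact S.smul_mem _ (S.sum_mem fun γ _ => h γ)

theorem meanValue_mul_left (f : Γ → M) (δ : Γ) :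
    meanValue K (fun γ => f (δ * γ)) = meanValue K f := by
  have := Fintype.ofFinite Γ
  simp only [meanValue_eq]
  rw [Fintype.sum_equiv (Equiv.mulLeft δ) (fun γ => f (δ * γ)) f (fun _ => rfl)]

theorem meanValue_mul_right (f : Γ → M) (δ : Γ) :
    meanValue K (fun γ => f (γ * δ)) = meanValue K f := by
  have := Fintype.ofFinite Γ
  simp only [meanValue_eq]
  rw [Fintype.sum_equiv (Equiv.mulRight δ) (fun γ => f (γ * δ)) f (fun _ => rfl)]

omit [Group Γ] in
theorem meanValue_apply {X : Type*} (f : Γ → X → M) (x : X) :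
    meanValue K f x = meanValue K (fun γ => f γ x) :=
  map_meanValue (LinearMap.proj (R := K) (φ := fun _ : X => M) x) f

omit [Group Γ] in
theorem meanValue_sub_mem (hΓ : (Nat.card Γ : K) ≠ 0) (S : Submodule K M) (f : Γ → M) (m : M)
    (h : ∀ γ, f γ - m ∈ S) : meanValue K f - m ∈ S := by
  nth_rewrite 1 [← meanValue_const (K := K) (Γ := Γ) hΓ m]
  rw [← meanValue_sub]
  exact meanValue_mem S _ h

omit [Group Γ] in
theorem IsLocallyConstant.meanValue {X : Type*} [TopologicalSpace X] (f : Γ → X → M)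
    (h : ∀ γ, IsLocallyConstant (f γ)) : IsLocallyConstant (meanValue K f) := by
  have := Fintype.ofFinite Γ
  have h1 : IsLocallyConstant (fun x γ => f γ x) := IsLocallyConstant.pi h
  have := h1.comp (_root_.meanValue K)
  convert this using 1
  funext x
  exact meanValue_apply f x

end Average

/-! ### Coboundaries -/

section Coboundary

variable {ℓ : ℕ} {H : Type v} [Group H] {V : Type w} [AddCommGroup V] [Module (ZMod ℓ) V]
  (ρ : Representation (ZMod ℓ) H V)

/-- The coboundary of a 1-cochain. -/
def d1 : (H → V) →ₗ[ZMod ℓ] (H × H → V) where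
  toFun c p := ρ p.1 (c p.2) - c (p.1 * p.2) + c p.1
  map_add' c c' := by ext p; simp only [Pi.add_apply, map_add]; abel
  map_smul' r c := by
    ext p; simp only [Pi.smul_apply, map_smul, RingHom.id_apply, smul_add, smul_sub]

theorem d1_apply (c : H → V) (g h : H) : d1 ρ c (g, h) = ρ g (c h) - c (g * h) + c g := rfl

theorem d1_eq_zero_iff (c : H → V) : d1 ρ c = 0 ↔ ∀ g h, c (g * h) = c g + ρ g (c h) := by
  constructor
  · intro h g k
    have := congrFun h (g, k)
    rw [d1_apply, Pi.zero_apply, sub_add_eq_add_sub, sub_eq_zero] at this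
    rw [← this, add_comm]
  · intro h
    ext ⟨g, k⟩
    rw [d1_apply, h]; simp

variable [TopologicalSpace H]

theorem mem_B2_iff {f : H × H → V} : f ∈ B2 ρ ↔ ∃ c, IsLocallyConstant c ∧ d1 ρ c = f := by
  constructor
  · rintro ⟨c, hc, h⟩
    exact ⟨c, hc, by ext ⟨g, k⟩; rw [h]; rfl⟩
  · rintro ⟨c, hc, rfl⟩
    exact ⟨c, hc, fun g k => rfl⟩

theorem isLocallyConstant_action [Finite V] (hρ : ∀ a : V, IsLocallyConstant (fun h => ρ h a)) :
    IsLocallyConstant (fun h a => ρ h a) := IsLocallyConstant.pi hρ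

theorem isLocallyConstant_d1 [Finite V] [ContinuousMul H]
    (hρ : ∀ a : V, IsLocallyConstant (fun h => ρ h a)) {c : H → V} (hc : IsLocallyConstant c) :
    IsLocallyConstant (d1 ρ c) := by
  have h1 : IsLocallyConstant (fun p : H × H => ρ p.1 (c p.2)) :=
    (((isLocallyConstant_action ρ hρ).comp_continuous continuous_fst).prodMk
      (hc.comp_continuous continuous_snd)).comp (fun q : (V → V) × V => q.1 q.2)
  exact (h1.sub (hc.comp_continuous continuous_mul)).add (hc.comp_continuous continuous_fst)

theorem d1_mem_Z2 [Finite V] [ContinuousMul H]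
    (hρ : ∀ a : V, IsLocallyConstant (fun h => ρ h a)) {c : H → V} (hc : IsLocallyConstant c) :
    d1 ρ c ∈ Z2 ρ := by
  refine ⟨isLocallyConstant_d1 ρ hρ hc, fun g h k => ?_⟩
  simp only [d1_apply, map_add, map_sub, map_mul, Module.End.mul_apply, mul_assoc]
  abel

end Coboundary

/-! ### Topology of the semidirect product -/

namespace SemiProd

variable {G : Type v} {Γ : Type u} [Group G] [Group Γ] [MulDistribMulAction Γ G]
  [TopologicalSpace G] [TopologicalSpace Γ]

theorem continuous_left : Continuous (fun e : SemiProd G Γ => e.left) :=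
  continuous_fst.comp (continuous_induced_dom (f := fun x : SemiProd G Γ => (x.left, x.right)))

theorem continuous_right : Continuous (fun e : SemiProd G Γ => e.right) :=
  continuous_snd.comp (continuous_induced_dom (f := fun x : SemiProd G Γ => (x.left, x.right)))

theorem continuous_iff {X : Type*} [TopologicalSpace X] {f : X → SemiProd G Γ} :
    Continuous f ↔ Continuous (fun x => (f x).left) ∧ Continuous (fun x => (f x).right) := by
  rw [continuous_induced_rng]
  exact continuous_prodMk

theorem continuous_inl : Continuous (SemidirectProduct.inl : G →* SemiProd G Γ) :=
  continuous_iff.2 ⟨continuous_id, continuous_const⟩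

theorem continuous_smul_left [DiscreteTopology Γ] [ContinuousConstSMul Γ G] :
    Continuous (fun p : SemiProd G Γ × SemiProd G Γ => p.1.right • p.2.left) := by
  have h : Continuous (fun q : Γ × G => q.1 • q.2) :=
    continuous_prod_of_discrete_left.2 fun γ => continuous_const_smul γ
  exact h.comp ((continuous_right.comp continuous_fst).prodMk (continuous_left.comp continuous_snd))

instance [DiscreteTopology Γ] [ContinuousConstSMul Γ G] [ContinuousMul G] :
    ContinuousMul (SemiProd G Γ) where
  continuous_mul := continuous_iff.2
    ⟨(continuous_left.comp continuous_fst).mul continuous_smul_left,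
      (continuous_right.comp continuous_fst).mul (continuous_right.comp continuous_snd)⟩

theorem inr_mul_inl (γ : Γ) (g : G) : (SemidirectProduct.inr γ : SemiProd G Γ) *
    SemidirectProduct.inl g = SemidirectProduct.inl (γ • g) * SemidirectProduct.inr γ := by
  ext <;> simp

end SemiProd

/-! ### Equivariant cochains -/

section Equivariant

variable {ℓ : ℕ} {G : Type v} {Γ : Type u} [Group G] [Group Γ] [MulDistribMulAction Γ G]
  {V : Type w} [AddCommGroup V] [Module (ZMod ℓ) V]
  (ρ : Representation (ZMod ℓ) (SemiProd G Γ) V)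

/-- `Γ`-equivariant 1-cochains on `G`. -/
def equivC1 : Submodule (ZMod ℓ) (G → V) where
  carrier := {f | ∀ (γ : Γ) g, f (γ • g) = resΓ ρ γ (f g)}
  zero_mem' := by simp
  add_mem' := by
    intro f f' h h' γ g
    simp only [Pi.add_apply, map_add, h γ g, h' γ g]
  smul_mem' := by
    intro c f h γ g
    simp only [Pi.smul_apply, map_smul, h γ g]

/-- `Γ`-equivariant 2-cochains on `G`. -/
def equivC2 : Submodule (ZMod ℓ) (G × G → V) where
  carrier := {f | ∀ (γ : Γ) g h, f (γ • g, γ • h) = resΓ ρ γ (f (g, h))}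
  zero_mem' := by simp
  add_mem' := by
    intro f f' h h' γ g k
    simp only [Pi.add_apply, map_add, h γ g k, h' γ g k]
  smul_mem' := by
    intro c f h γ g k
    simp only [Pi.smul_apply, map_smul, h γ g k]

theorem apply_eq (e : SemiProd G Γ) (a : V) :
    ρ e a = resG ρ e.left (resΓ ρ e.right a) := by
  conv_lhs => rw [← SemidirectProduct.inl_left_mul_inr_right e, map_mul]
  rfl

theorem resΓ_resG' (γ : Γ) (g : G) (a : V) :
    resΓ ρ γ (resG ρ g a) = resG ρ (γ • g) (resΓ ρ γ a) := by
  have := resΓ_resG ρ γ (γ • g) a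
  rwa [inv_smul_smul] at this

theorem resΓ_inv_apply (γ : Γ) (a : V) : resΓ ρ γ (resΓ ρ γ⁻¹ a) = a := by
  rw [← Module.End.mul_apply, ← map_mul, mul_inv_cancel, map_one, Module.End.one_apply]

theorem mem_equivC1_iff {f : G → V} : f ∈ equivC1 ρ ↔ ∀ γ, conjC1 ρ γ f = f := by
  constructor
  · intro h γ
    ext g
    change resΓ ρ γ (f (γ⁻¹ • g)) = f g
    rw [← h, smul_inv_smul]
  · intro h γ g
    have := congrFun (h γ) (γ • g)
    change resΓ ρ γ (f (γ⁻¹ • γ • g)) = _ at this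
    rw [inv_smul_smul] at this
    exact this.symm

theorem mem_equivC2_iff {f : G × G → V} : f ∈ equivC2 ρ ↔ ∀ γ, conjC2 ρ γ f = f := by
  constructor
  · intro h γ
    ext ⟨g, k⟩
    change resΓ ρ γ (f (γ⁻¹ • g, γ⁻¹ • k)) = f (g, k)
    rw [← h, smul_inv_smul, smul_inv_smul]
  · intro h γ g k
    have := congrFun (h γ) (γ • g, γ • k)
    change resΓ ρ γ (f (γ⁻¹ • γ • g, γ⁻¹ • γ • k)) = _ at this
    rw [inv_smul_smul, inv_smul_smul] at this
    exact this.symm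

theorem conjC1_mul (γ δ : Γ) (f : G → V) : conjC1 ρ (γ * δ) f = conjC1 ρ γ (conjC1 ρ δ f) := by
  ext g
  change resΓ ρ (γ * δ) (f ((γ * δ)⁻¹ • g)) = resΓ ρ γ (resΓ ρ δ (f (δ⁻¹ • γ⁻¹ • g)))
  rw [mul_inv_rev, mul_smul, map_mul]; rfl

theorem conjC2_mul (γ δ : Γ) (f : G × G → V) :
    conjC2 ρ (γ * δ) f = conjC2 ρ γ (conjC2 ρ δ f) := by
  ext ⟨g, k⟩
  change resΓ ρ (γ * δ) (f ((γ * δ)⁻¹ • g, (γ * δ)⁻¹ • k)) =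
    resΓ ρ γ (resΓ ρ δ (f (δ⁻¹ • γ⁻¹ • g, δ⁻¹ • γ⁻¹ • k)))
  rw [mul_inv_rev, mul_smul, mul_smul, map_mul]; rfl

theorem d1_conjC1 (γ : Γ) (c : G → V) :
    d1 (resG ρ) (conjC1 ρ γ c) = conjC2 ρ γ (d1 (resG ρ) c) := by
  ext ⟨g, k⟩
  change resG ρ g (resΓ ρ γ (c (γ⁻¹ • k))) - resΓ ρ γ (c (γ⁻¹ • (g * k)))
    + resΓ ρ γ (c (γ⁻¹ • g)) = resΓ ρ γ (resG ρ (γ⁻¹ • g) (c (γ⁻¹ • k))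
    - c (γ⁻¹ • g * γ⁻¹ • k) + c (γ⁻¹ • g))
  rw [map_add, map_sub, resΓ_resG, smul_mul']

theorem d1_mem_equivC2 {c : G → V} (hc : c ∈ equivC1 ρ) : d1 (resG ρ) c ∈ equivC2 ρ := by
  rw [mem_equivC2_iff]
  intro γ
  rw [← d1_conjC1, (mem_equivC1_iff ρ).1 hc]

section Average

variable [Finite Γ] [Fact ℓ.Prime]

theorem meanValue_conjC1_mem (c : G → V) :
    meanValue (ZMod ℓ) (fun γ => conjC1 ρ γ c) ∈ equivC1 ρ := by
  rw [mem_equivC1_iff]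
  intro δ
  rw [map_meanValue]
  simp only [← conjC1_mul]
  exact meanValue_mul_left (fun γ => conjC1 ρ γ c) δ

theorem meanValue_conjC2_mem (c : G × G → V) :
    meanValue (ZMod ℓ) (fun γ => conjC2 ρ γ c) ∈ equivC2 ρ := by
  rw [mem_equivC2_iff]
  intro δ
  rw [map_meanValue]
  simp only [← conjC2_mul]
  exact meanValue_mul_left (fun γ => conjC2 ρ γ c) δ

/-- Coboundary and conjugation commute, so averaging `c` averages `d c`, which is already fixed by
`Γ`. -/
theorem d1_meanValue (hΓ : (Nat.card Γ : ZMod ℓ) ≠ 0) {c : G → V}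
    (hc : d1 (resG ρ) c ∈ equivC2 ρ) :
    d1 (resG ρ) (meanValue (ZMod ℓ) (fun γ => conjC1 ρ γ c)) = d1 (resG ρ) c := by
  rw [map_meanValue]
  simp only [d1_conjC1, (mem_equivC2_iff ρ).1 hc]
  exact meanValue_const hΓ _

end Average

variable [TopologicalSpace G]

/-- `Γ`-equivariant continuous 1-cocycles. -/
abbrev equivZ1 : Submodule (ZMod ℓ) (G → V) := Z1 (resG ρ) ⊓ equivC1 ρ

/-- `Γ`-equivariant continuous 2-cocycles. -/
abbrev equivZ2 : Submodule (ZMod ℓ) (G × G → V) := Z2 (resG ρ) ⊓ equivC2 ρ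

theorem Z1_iff_d1 {H : Type*} [Group H] [TopologicalSpace H]
    (τ : Representation (ZMod ℓ) H V) (f : H → V) :
    f ∈ Z1 τ ↔ IsLocallyConstant f ∧ d1 τ f = 0 := by
  rw [d1_eq_zero_iff]; rfl

theorem IsLocallyConstant.conjC1 [ContinuousConstSMul Γ G] {c : G → V} (hc : IsLocallyConstant c)
    (γ : Γ) : IsLocallyConstant (conjC1 ρ γ c) :=
  (hc.comp_continuous (continuous_const_smul γ⁻¹)).comp (resΓ ρ γ)

/-- `j` exhibits its target as equivariant 2-cocycles modulo coboundaries of equivariant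
cochains. -/
structure IsEquivH2 {H : Type*} [AddCommGroup H] [Module (ZMod ℓ) H]
    (j : equivZ2 ρ →ₗ[ZMod ℓ] H) : Prop where
  surjective : Function.Surjective j
  ker : ∀ z : equivZ2 ρ, j z = 0 ↔
    ∃ c ∈ equivC1 ρ, IsLocallyConstant c ∧ d1 (resG ρ) c = z

section Invariants

variable [ContinuousConstSMul Γ G] [Finite Γ] [Fact ℓ.Prime]

theorem mem_B2_iff_equivariant (hΓ : (Nat.card Γ : ZMod ℓ) ≠ 0) {z : G × G → V}
    (hz : z ∈ equivC2 ρ) :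
    z ∈ B2 (resG ρ) ↔ ∃ c ∈ equivC1 ρ, IsLocallyConstant c ∧ d1 (resG ρ) c = z := by
  rw [mem_B2_iff]
  constructor
  · rintro ⟨c, hc, rfl⟩
    exact ⟨_, meanValue_conjC1_mem ρ c, IsLocallyConstant.meanValue _ fun γ => hc.conjC1 ρ γ,
      d1_meanValue ρ hΓ hz⟩
  · rintro ⟨c, -, hc, h⟩
    exact ⟨c, hc, h⟩

theorem mem_H2inv_mk (z : Z2 (resG ρ)) : Submodule.Quotient.mk z ∈ H2inv ρ ↔
    ∀ γ, conjC2 ρ γ z - z ∈ B2 (resG ρ) := by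
  simp only [H2inv, Submodule.mem_iInf, LinearMap.mem_eqLocus]
  refine forall_congr' fun γ => ?_
  change Submodule.Quotient.mk _ = Submodule.Quotient.mk _ ↔ _
  rw [Submodule.Quotient.eq]
  rfl

theorem mem_H1inv_mk (z : Z1 (resG ρ)) : Submodule.Quotient.mk z ∈ H1inv ρ ↔
    ∀ γ, conjC1 ρ γ z - z ∈ B1 (resG ρ) := by
  simp only [H1inv, Submodule.mem_iInf, LinearMap.mem_eqLocus]
  refine forall_congr' fun γ => ?_
  change Submodule.Quotient.mk _ = Submodule.Quotient.mk _ ↔ _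
  rw [Submodule.Quotient.eq]
  rfl

/-- The class in `H²(G, V)^Γ` of an equivariant cocycle. -/
def toH2inv : equivZ2 ρ →ₗ[ZMod ℓ] H2inv ρ :=
  ((Submodule.mkQ _).comp (Submodule.inclusion inf_le_left)).codRestrict _ fun z => by
    change Submodule.Quotient.mk _ ∈ H2inv ρ
    rw [mem_H2inv_mk]
    intro γ
    have := (mem_equivC2_iff ρ).1 z.2.2 γ
    change conjC2 ρ γ z.1 - z.1 ∈ _
    rw [this, sub_self]
    exact Submodule.zero_mem _

/-- A cocycle whose class is fixed differs from each conjugate by a coboundary, hence also from its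
average, which is equivariant. For the kernel, a primitive of an equivariant cocycle can be averaged
as well. -/
theorem isEquivH2_toH2inv (hΓ : (Nat.card Γ : ZMod ℓ) ≠ 0) : IsEquivH2 ρ (toH2inv ρ) where
  surjective := by
    rintro ⟨x, hx⟩
    obtain ⟨z, rfl⟩ := Submodule.Quotient.mk_surjective _ x
    rw [mem_H2inv_mk] at hx
    refine ⟨⟨meanValue (ZMod ℓ) (fun γ => conjC2 ρ γ z), ⟨?_, meanValue_conjC2_mem ρ _⟩⟩, ?_⟩
    · exact meanValue_mem _ _ fun γ => conjC2_mem ρ γ _ z.2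
    · refine Subtype.ext ?_
      refine (Submodule.Quotient.eq _).2 ?_
      exact meanValue_sub_mem hΓ _ _ _ hx
  ker z := by
    rw [← mem_B2_iff_equivariant ρ hΓ z.2.2, ← Submodule.coe_eq_zero]
    change Submodule.Quotient.mk _ = 0 ↔ _
    rw [Submodule.Quotient.mk_eq_zero]
    rfl

/-- The 1-cocycle attached to a vector fixed by `Γ`. -/
def fixedCoboundary : (resΓ ρ).invariants →ₗ[ZMod ℓ] (G → V) where
  toFun a g := resG ρ g a - a
  map_add' a b := by ext g; simp only [Submodule.coe_add, map_add, Pi.add_apply]; abel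
  map_smul' c a := by
    ext g; simp only [Submodule.coe_smul, map_smul, Pi.smul_apply, smul_sub, RingHom.id_apply]

theorem B1_le_Z1 {H : Type*} [Group H] [TopologicalSpace H] (τ : Representation (ZMod ℓ) H V)
    (hτ : ∀ a : V, IsLocallyConstant (fun h => τ h a)) : B1 τ ≤ Z1 τ := by
  rintro f ⟨a, ha⟩
  obtain rfl : f = fun g => τ g a - a := funext ha
  refine ⟨(hτ a).sub (IsLocallyConstant.const a), fun g h => ?_⟩
  simp only [map_mul, Module.End.mul_apply, map_sub]
  abel

theorem ker_fixedCoboundary : LinearMap.ker (fixedCoboundary ρ) =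
    ρ.invariants.submoduleOf (resΓ ρ).invariants := by
  ext ⟨a, ha⟩
  rw [LinearMap.mem_ker]
  change _ ↔ a ∈ ρ.invariants
  simp only [Representation.mem_invariants] at ha ⊢
  constructor
  · intro h e
    have := congrFun h e.left
    change resG ρ e.left a - a = 0 at this
    rw [apply_eq, ha, sub_eq_zero.1 this]
  · intro h
    ext g
    exact sub_eq_zero.2 (h _)

theorem fixedCoboundary_mem_equivC1 (a : (resΓ ρ).invariants) :
    fixedCoboundary ρ a ∈ equivC1 ρ := by
  intro γ g
  have ha : resΓ ρ γ a.1 = a.1 := a.2 γ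
  change resG ρ (γ • g) a.1 - a.1 = resΓ ρ γ (resG ρ g a.1 - a.1)
  rw [map_sub, resΓ_resG', ha]

/-- An equivariant coboundary comes from a fixed vector. -/
theorem mem_range_fixedCoboundary (hΓ : (Nat.card Γ : ZMod ℓ) ≠ 0) {f : G → V}
    (hf : f ∈ equivC1 ρ) :
    f ∈ B1 (resG ρ) ↔ f ∈ LinearMap.range (fixedCoboundary ρ) := by
  constructor
  · rintro ⟨a, ha⟩
    refine ⟨⟨meanValue (ZMod ℓ) (fun γ => resΓ ρ γ a), fun δ => ?_⟩, ?_⟩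
    · rw [map_meanValue]
      simp only [← Module.End.mul_apply, ← map_mul]
      exact meanValue_mul_left (fun γ => resΓ ρ γ a) δ
    · ext g
      change resG ρ g _ - _ = _
      rw [map_meanValue, ← meanValue_sub]
      -- Equivariance of `f` means that every translate of `a` under `Γ` has the same coboundary
      -- `f`.
      have : ∀ γ, resG ρ g (resΓ ρ γ a) - resΓ ρ γ a = f g := fun γ => by
        rw [← resΓ_resG, ← map_sub, ← ha, ← hf, smul_inv_smul]
      simp only [this]
      exact meanValue_const hΓ _
  · rintro ⟨a, rfl⟩
    exact ⟨a, fun g => rfl⟩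

/-- The dimension of `V^Γ / V^{G ⋊ Γ}`. -/
noncomputable def xiN : ℕ∞ :=
  dimN (ZMod ℓ) ((resΓ ρ).invariants ⧸ ρ.invariants.submoduleOf (resΓ ρ).invariants)

/-- This is where `ξ` enters: a `Γ`-fixed vector has zero coboundary on `G` exactly when all of `G ⋊
Γ` fixes it. -/
theorem dimN_range_fixedCoboundary :
    dimN (ZMod ℓ) (LinearMap.range (fixedCoboundary ρ)) = xiN ρ := by
  rw [xiN, ← dimN_congr (fixedCoboundary ρ).quotKerEquivRange]
  exact dimN_congr (Submodule.quotEquivOfEq _ _ (ker_fixedCoboundary ρ))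

/-- A module `H` that is the quotient of the equivariant 1-cocycles by the coboundaries of
`Γ`-fixed vectors. -/
theorem dimN_add_xiN {H : Type*} [AddCommGroup H] [Module (ZMod ℓ) H]
    (hρ : ∀ a : V, IsLocallyConstant (fun g : G => resG ρ g a))
    (j : equivZ1 ρ →ₗ[ZMod ℓ] H) (hj : Function.Surjective j)
    (hk : ∀ f : equivZ1 ρ, j f = 0 ↔ (f : G → V) ∈ LinearMap.range (fixedCoboundary ρ)) :
    dimN (ZMod ℓ) H + xiN ρ = dimN (ZMod ℓ) (equivZ1 ρ) := by
  have hle : LinearMap.range (fixedCoboundary ρ) ≤ equivZ1 ρ := by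
    rintro _ ⟨a, rfl⟩
    exact ⟨B1_le_Z1 _ hρ ⟨a, fun g => rfl⟩, fixedCoboundary_mem_equivC1 ρ a⟩
  rw [← dimN_add_ker_of_surjective j hj, ← dimN_range_fixedCoboundary]
  congr 1
  have : LinearMap.ker j = (LinearMap.range (fixedCoboundary ρ)).submoduleOf (equivZ1 ρ) := by
    ext f
    rw [LinearMap.mem_ker, hk]
    rfl
  rw [this]
  exact (dimN_congr (Submodule.submoduleOfEquivOfLe hle)).symm

theorem dimN_H1inv_add_xiN (hΓ : (Nat.card Γ : ZMod ℓ) ≠ 0)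
    (hρ : ∀ a : V, IsLocallyConstant (fun g : G => resG ρ g a)) :
    dimN (ZMod ℓ) (H1inv ρ) + xiN ρ = dimN (ZMod ℓ) (equivZ1 ρ) := by
  let j : equivZ1 ρ →ₗ[ZMod ℓ] H1inv ρ :=
    ((Submodule.mkQ _).comp (Submodule.inclusion inf_le_left)).codRestrict _ fun z => by
      change Submodule.Quotient.mk _ ∈ H1inv ρ
      rw [mem_H1inv_mk]
      intro γ
      have := (mem_equivC1_iff ρ).1 z.2.2 γ
      change conjC1 ρ γ z.1 - z.1 ∈ _
      rw [this, sub_self]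
      exact Submodule.zero_mem _
  refine dimN_add_xiN ρ hρ j ?_ ?_
  · rintro ⟨x, hx⟩
    obtain ⟨z, rfl⟩ := Submodule.Quotient.mk_surjective _ x
    rw [mem_H1inv_mk] at hx
    refine ⟨⟨meanValue (ZMod ℓ) (fun γ => conjC1 ρ γ z), ⟨?_, meanValue_conjC1_mem ρ _⟩⟩, ?_⟩
    · exact meanValue_mem _ _ fun γ => conjC1_mem ρ γ _ z.2
    · refine Subtype.ext ?_
      refine (Submodule.Quotient.eq _).2 ?_
      exact meanValue_sub_mem hΓ _ _ _ hx
  · intro f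
    rw [← mem_range_fixedCoboundary ρ hΓ f.2.2, ← Submodule.coe_eq_zero]
    change Submodule.Quotient.mk _ = 0 ↔ _
    rw [Submodule.Quotient.mk_eq_zero]
    rfl

end Invariants

end Equivariant

/-! ### Cohomology of the semidirect product -/

section SemidirectCohomology

variable {ℓ : ℕ} {G : Type v} {Γ : Type u} [Group G] [Group Γ] [MulDistribMulAction Γ G]
  {V : Type w} [AddCommGroup V] [Module (ZMod ℓ) V]
  (ρ : Representation (ZMod ℓ) (SemiProd G Γ) V)

/-- Extension of a 1-cochain from `G` to `G ⋊ Γ`. -/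
def inflC1 : (G → V) →ₗ[ZMod ℓ] (SemiProd G Γ → V) where
  toFun f e := f e.left
  map_add' _ _ := rfl
  map_smul' _ _ := rfl

/-- Extension of a 2-cochain from `G` to `G ⋊ Γ`. -/
def inflC2 : (G × G → V) →ₗ[ZMod ℓ] (SemiProd G Γ × SemiProd G Γ → V) where
  toFun z p := z (p.1.left, p.1.right • p.2.left)
  map_add' _ _ := rfl
  map_smul' _ _ := rfl

theorem inflC2_apply (z : G × G → V) (e e' : SemiProd G Γ) :
    inflC2 (Γ := Γ) (ℓ := ℓ) z (e, e') = z (e.left, e.right • e'.left) := rfl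

theorem d1_inflC1 {c : G → V} (hc : c ∈ equivC1 ρ) :
    d1 ρ (inflC1 (Γ := Γ) (ℓ := ℓ) c) = inflC2 (Γ := Γ) (ℓ := ℓ) (d1 (resG ρ) c) := by
  ext ⟨e, e'⟩
  rw [d1_apply, inflC2_apply, d1_apply, apply_eq]
  change resG ρ e.left (resΓ ρ e.right (c e'.left)) - c (e * e').left + c e.left = _
  rw [← hc]
  rfl

variable [TopologicalSpace G] [TopologicalSpace Γ]

theorem inflC1_mem {f : G → V} (hf : f ∈ equivZ1 ρ) :
    inflC1 (Γ := Γ) (ℓ := ℓ) f ∈ Z1 ρ := by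
  refine ⟨hf.1.1.comp_continuous SemiProd.continuous_left, fun e e' => ?_⟩
  change f (e.left * e.right • e'.left) = f e.left + ρ e (f e'.left)
  rw [hf.1.2, hf.2, ← apply_eq]

variable [DiscreteTopology Γ] [ContinuousConstSMul Γ G]

theorem inflC2_mem {z : G × G → V} (hz : z ∈ equivZ2 ρ) :
    inflC2 (Γ := Γ) (ℓ := ℓ) z ∈ Z2 ρ := by
  refine ⟨hz.1.1.comp_continuous ((SemiProd.continuous_left.comp continuous_fst).prodMk
    SemiProd.continuous_smul_left), fun e₁ e₂ e₃ => ?_⟩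
  have h := hz.1.2 e₁.left (e₁.right • e₂.left) ((e₁.right * e₂.right) • e₃.left)
  rw [inflC2_apply, inflC2_apply, inflC2_apply, inflC2_apply, apply_eq, ← hz.2, smul_smul]
  refine Eq.trans ?_ h
  congr 2
  change (e₁.left, e₁.right • (e₂.left * e₂.right • e₃.left)) = _
  rw [smul_mul', smul_smul]

/-- The class in `H²(G ⋊ Γ, V)` of an equivariant cocycle on `G`. -/
def toH2semi : equivZ2 ρ →ₗ[ZMod ℓ] H2 ρ :=
  (Submodule.mkQ _).comp
    (((inflC2 (Γ := Γ) (ℓ := ℓ)).comp (Submodule.subtype _)).codRestrict (Z2 ρ)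
      fun z => inflC2_mem ρ z.2)

variable [Finite Γ] [Fact ℓ.Prime] [ContinuousMul G] [Finite V]
  (hρ : ∀ a : V, IsLocallyConstant (fun h => ρ h a))
include hρ

/-- Normalisation of a 2-cocycle on `G ⋊ Γ` on the right. -/
theorem exists_cocycle_right_invariant (hΓ : (Nat.card Γ : ZMod ℓ) ≠ 0)
    {Z : SemiProd G Γ × SemiProd G Γ → V} (hZ : Z ∈ Z2 ρ) :
    ∃ b, IsLocallyConstant b ∧
      (∀ e e' (γ : Γ), (Z - d1 ρ b) (e, e' * SemidirectProduct.inr γ) = (Z - d1 ρ b) (e, e')) ∧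
      ∀ e, (Z - d1 ρ b) (e, 1) = 0 := by
  let b : SemiProd G Γ → V :=
    meanValue (ZMod ℓ) (fun (δ : Γ) e => Z (e, SemidirectProduct.inr δ))
  have hb : ∀ e, b e = meanValue (ZMod ℓ) (fun δ : Γ => Z (e, SemidirectProduct.inr δ)) :=
    fun e => meanValue_apply _ e
  -- The cocycle identity, averaged over a third argument running through `Γ`.
  have key : ∀ e e', (Z - d1 ρ b) (e, e') =
      meanValue (ZMod ℓ) (fun δ : Γ => Z (e, e' * SemidirectProduct.inr δ)) - b e := by
    intro e e'
    have h : ρ e (b e') = b (e * e') + Z (e, e') -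
        meanValue (ZMod ℓ) (fun δ : Γ => Z (e, e' * SemidirectProduct.inr δ)) := by
      rw [hb, hb, map_meanValue]
      conv_rhs => rw [← meanValue_const (Γ := Γ) hΓ (Z (e, e'))]
      rw [← meanValue_add, ← meanValue_sub]
      congr 1
      ext δ
      exact eq_sub_of_add_eq (hZ.2 _ _ _)
    rw [Pi.sub_apply, d1_apply, h]
    abel
  refine ⟨b, IsLocallyConstant.meanValue _ fun δ => ?_, fun e e' γ => ?_, fun e => ?_⟩
  · exact hZ.1.comp_continuous (continuous_id.prodMk continuous_const)
  · rw [key, key]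
    congr 1
    simp only [mul_assoc, ← map_mul]
    exact meanValue_mul_left (fun δ : Γ => Z (e, e' * SemidirectProduct.inr δ)) γ
  · rw [key, hb]
    simp

/-- Every class in `H²(G ⋊ Γ, V)` comes from an equivariant cocycle on `G`. -/
theorem exists_equivariant_cocycle (hΓ : (Nat.card Γ : ZMod ℓ) ≠ 0)
    {Z : SemiProd G Γ × SemiProd G Γ → V} (hZ : Z ∈ Z2 ρ) :
    ∃ z ∈ equivZ2 ρ, Z - inflC2 (Γ := Γ) (ℓ := ℓ) z ∈ B2 ρ := by
  obtain ⟨b, hb, hbr, hb1⟩ := exists_cocycle_right_invariant ρ hρ hΓ hZ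
  have hZ' : Z - d1 ρ b ∈ Z2 ρ := Submodule.sub_mem _ hZ (d1_mem_Z2 ρ hρ hb)
  set Z' := Z - d1 ρ b with hZ'def
  have hmk : ∀ e : SemiProd G Γ,
      SemidirectProduct.inl e.left * SemidirectProduct.inr e.right = e :=
    SemidirectProduct.inl_left_mul_inr_right
  have hZ'l : ∀ e e' : SemiProd G Γ, Z' (e, e') = Z' (e, SemidirectProduct.inl e'.left) := by
    intro e e'
    conv_lhs => rw [← hmk e']
    exact hbr _ _ _
  -- Up to a twist, `γ ↦ Z' (γ, ·)` is a 1-cocycle of `Γ` with values in functions on `G`; its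
  -- average `u` is a primitive, as `hkey` records.
  let u : G → V := meanValue (ZMod ℓ)
    (fun (δ : Γ) h => resΓ ρ δ⁻¹ (Z' (SemidirectProduct.inr δ, SemidirectProduct.inl h)))
  have hu : ∀ h, u h = meanValue (ZMod ℓ)
    (fun δ : Γ => resΓ ρ δ⁻¹ (Z' (SemidirectProduct.inr δ, SemidirectProduct.inl h))) :=
    fun h => meanValue_apply _ h
  have hul : IsLocallyConstant u := IsLocallyConstant.meanValue _ fun δ =>
    (hZ'.1.comp_continuous (continuous_const.prodMk SemiProd.continuous_inl)).comp _
  have hu1 : u 1 = 0 := by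
    rw [hu]
    simp only [map_one, hb1, map_zero]
    exact meanValue_const hΓ 0
  have hkey : ∀ (δ : Γ) h, Z' (SemidirectProduct.inr δ, SemidirectProduct.inl h) =
      resΓ ρ δ (u h) - u (δ • h) := by
    intro δ h
    have h1 : u h = resΓ ρ δ⁻¹ (Z' (SemidirectProduct.inr δ, SemidirectProduct.inl h)) +
        resΓ ρ δ⁻¹ (u (δ • h)) := by
      rw [hu (δ • h), map_meanValue]
      conv_rhs => rw [← meanValue_const (Γ := Γ) hΓ
        (resΓ ρ δ⁻¹ (Z' (SemidirectProduct.inr δ, SemidirectProduct.inl h)))]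
      rw [hu h, ← meanValue_mul_right _ δ, ← meanValue_add]
      congr 1
      ext γ
      have hc := hZ'.2 (SemidirectProduct.inr γ) (SemidirectProduct.inr δ)
        (SemidirectProduct.inl h)
      have h2 : Z' (SemidirectProduct.inr γ, SemidirectProduct.inr δ) = 0 := by
        rw [hZ'l]; simpa using hb1 _
      rw [h2, add_zero, SemiProd.inr_mul_inl, hbr, ← map_mul] at hc
      rw [← hc, map_add]
      congr 1
      · change resΓ ρ (γ * δ)⁻¹ (resΓ ρ γ _) = _
        rw [← Module.End.mul_apply, ← map_mul]
        congr 2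
        group
      · rw [mul_inv_rev, map_mul]; rfl
    rw [h1, map_add, resΓ_inv_apply, resΓ_inv_apply]
    abel
  -- Subtracting the coboundary of `u` keeps invariance on the right and makes the cocycle vanish on
  -- `Γ × G`. The cocycle identity at `(g, γ, h)` then moves `γ` from the first argument to the
  -- second (`hgen`), so that `Z''` is determined by its restriction to `G × G`.
  let U : SemiProd G Γ → V := inflC1 (Γ := Γ) (ℓ := ℓ) u
  have hU : IsLocallyConstant U := hul.comp_continuous SemiProd.continuous_left
  have hZ'' : Z' - d1 ρ U ∈ Z2 ρ := Submodule.sub_mem _ hZ' (d1_mem_Z2 ρ hρ hU)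
  set Z'' := Z' - d1 ρ U with hZ''def
  have hr : ∀ e e' (γ : Γ), Z'' (e, e' * SemidirectProduct.inr γ) = Z'' (e, e') := by
    intro e e' γ
    rw [hZ''def, Pi.sub_apply, Pi.sub_apply, hbr, d1_apply, d1_apply]
    have h1 : U (e' * SemidirectProduct.inr γ) = U e' := by
      change u (e' * SemidirectProduct.inr γ).left = u e'.left
      simp
    have h2 : U (e * (e' * SemidirectProduct.inr γ)) = U (e * e') := by
      rw [← mul_assoc]
      change u (e * e' * SemidirectProduct.inr γ).left = u (e * e').left
      simp
    rw [h1, h2]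
  have hr' : ∀ e e' : SemiProd G Γ, Z'' (e, e') = Z'' (e, SemidirectProduct.inl e'.left) := by
    intro e e'
    conv_lhs => rw [← hmk e']
    exact hr _ _ _
  have h1 : ∀ e, Z'' (e, 1) = 0 := by
    intro e
    rw [hZ''def, Pi.sub_apply, hb1, d1_apply]
    have : U 1 = 0 := hu1
    rw [this]; simp
  have h1' : ∀ e (γ : Γ), Z'' (e, SemidirectProduct.inr γ) = 0 := by
    intro e γ
    rw [hr']; simpa using h1 e
  have hl : ∀ (γ : Γ) h, Z'' (SemidirectProduct.inr γ, SemidirectProduct.inl h) = 0 := by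
    intro γ h
    rw [hZ''def, Pi.sub_apply, hkey, d1_apply]
    have h2 : U (SemidirectProduct.inl h) = u h := rfl
    have h3 : U (SemidirectProduct.inr γ) = 0 := hu1
    have h4 : U (SemidirectProduct.inr γ * SemidirectProduct.inl h) = u (γ • h) := by
      rw [SemiProd.inr_mul_inl]
      change u (SemidirectProduct.inl (γ • h) * SemidirectProduct.inr γ : SemiProd G Γ).left = _
      simp
    rw [h2, h3, h4]
    change _ - (resΓ ρ γ (u h) - u (γ • h) + 0) = 0
    abel
  have hgen : ∀ g (γ : Γ) h, Z'' (SemidirectProduct.inl g * SemidirectProduct.inr γ,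
      SemidirectProduct.inl h) = Z'' (SemidirectProduct.inl g, SemidirectProduct.inl (γ • h)) := by
    intro g γ h
    have := hZ''.2 (SemidirectProduct.inl g) (SemidirectProduct.inr γ) (SemidirectProduct.inl h)
    rw [hl, h1', map_zero, zero_add, add_zero, SemiProd.inr_mul_inl, hr] at this
    exact this.symm
  let z : G × G → V := fun p => Z'' (SemidirectProduct.inl p.1, SemidirectProduct.inl p.2)
  have hz : inflC2 (Γ := Γ) (ℓ := ℓ) z = Z'' := by
    ext ⟨e, e'⟩
    rw [hr', ← hmk e, hgen, hmk]
    rfl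
  refine ⟨z, ⟨⟨?_, fun g h k => ?_⟩, fun γ g h => ?_⟩, ?_⟩
  · exact hZ''.1.comp_continuous ((SemiProd.continuous_inl.comp continuous_fst).prodMk
      (SemiProd.continuous_inl.comp continuous_snd))
  · have := hZ''.2 (SemidirectProduct.inl g) (SemidirectProduct.inl h) (SemidirectProduct.inl k)
    rw [← map_mul, ← map_mul] at this
    exact this
  · have := hZ''.2 (SemidirectProduct.inr γ) (SemidirectProduct.inl g) (SemidirectProduct.inl h)
    rw [← map_mul, hl, hl, add_zero, add_zero, SemiProd.inr_mul_inl, hgen] at this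
    exact this.symm
  · rw [hz, hZ''def, hZ'def]
    refine (mem_B2_iff ρ).2 ⟨b + U, hb.add hU, ?_⟩
    rw [map_add]; abel

/-- For the kernel: a primitive on `G ⋊ Γ` restricts to `G`, where averaging makes it equivariant;
conversely an equivariant primitive on `G` extends to `G ⋊ Γ` by ignoring the `Γ`-coordinate. -/
theorem isEquivH2_toH2semi (hΓ : (Nat.card Γ : ZMod ℓ) ≠ 0) : IsEquivH2 ρ (toH2semi ρ) where
  surjective := by
    intro x
    obtain ⟨Z, rfl⟩ := Submodule.Quotient.mk_surjective _ x
    obtain ⟨z, hz, h⟩ := exists_equivariant_cocycle ρ hρ hΓ Z.2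
    refine ⟨⟨z, hz⟩, ?_⟩
    refine (Submodule.Quotient.eq _).2 ?_
    rw [← neg_sub]
    exact Submodule.neg_mem _ h
  ker z := by
    change Submodule.Quotient.mk _ = 0 ↔ _
    rw [Submodule.Quotient.mk_eq_zero]
    change inflC2 (Γ := Γ) (ℓ := ℓ) z.1 ∈ B2 ρ ↔ _
    rw [mem_B2_iff]
    constructor
    · rintro ⟨c, hc, h⟩
      rw [← mem_B2_iff_equivariant ρ hΓ z.2.2, mem_B2_iff]
      refine ⟨fun g => c (SemidirectProduct.inl g), hc.comp_continuous SemiProd.continuous_inl, ?_⟩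
      ext ⟨g, k⟩
      have := congrFun h (SemidirectProduct.inl g, SemidirectProduct.inl k)
      rw [d1_apply, inflC2_apply, ← map_mul] at this
      refine Eq.trans this ?_
      simp
    · rintro ⟨c, hc, hcl, h⟩
      exact ⟨inflC1 (Γ := Γ) (ℓ := ℓ) c, hcl.comp_continuous SemiProd.continuous_left, by
        rw [d1_inflC1 ρ hc, h]⟩

/-- Averaging the values on `Γ` gives a coboundary that makes a cocycle on `G ⋊ Γ` vanish on `Γ`. It
is then invariant under right translation by `Γ`, so it comes from its restriction to `G`, which is
equivariant. -/
theorem dimN_H1_add_xiN (hΓ : (Nat.card Γ : ZMod ℓ) ≠ 0) :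
    dimN (ZMod ℓ) (H1 ρ) + xiN ρ = dimN (ZMod ℓ) (equivZ1 ρ) := by
  let j : equivZ1 ρ →ₗ[ZMod ℓ] H1 ρ := (Submodule.mkQ _).comp
    (((inflC1 (Γ := Γ) (ℓ := ℓ)).comp (Submodule.subtype _)).codRestrict (Z1 ρ)
      fun z => inflC1_mem ρ z.2)
  have hρG : ∀ a : V, IsLocallyConstant (fun g : G => resG ρ g a) := fun a =>
    (hρ a).comp_continuous SemiProd.continuous_inl
  refine dimN_add_xiN ρ hρG j ?_ ?_
  · intro x
    obtain ⟨F, rfl⟩ := Submodule.Quotient.mk_surjective _ x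
    let a : V := meanValue (ZMod ℓ) (fun δ : Γ => F.1 (SemidirectProduct.inr δ))
    have hF1 : F.1 1 = 0 := by simpa using F.2.2 1 1
    have ha : ∀ γ : Γ, F.1 (SemidirectProduct.inr γ) + (resΓ ρ γ a - a) = 0 := by
      intro γ
      have : F.1 (SemidirectProduct.inr γ) + resΓ ρ γ a = a := by
        rw [map_meanValue, ← meanValue_const (Γ := Γ) hΓ (F.1 (SemidirectProduct.inr γ)),
          ← meanValue_add]
        have h : ∀ δ : Γ, F.1 (SemidirectProduct.inr γ) +
            resΓ ρ γ (F.1 (SemidirectProduct.inr δ)) = F.1 (SemidirectProduct.inr (γ * δ)) := by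
          intro δ
          rw [map_mul]
          exact (F.2.2 _ _).symm
        simp only [h]
        exact meanValue_mul_left (fun δ : Γ => F.1 (SemidirectProduct.inr δ)) γ
      rw [← add_sub_assoc, this, sub_self]
    let f' : SemiProd G Γ → V := fun e => F.1 e + (ρ e a - a)
    have hf' : f' ∈ Z1 ρ := Submodule.add_mem _ F.2 (B1_le_Z1 ρ hρ ⟨a, fun g => rfl⟩)
    have hr : ∀ e (γ : Γ), f' (e * SemidirectProduct.inr γ) = f' e := by
      intro e γ
      rw [hf'.2]
      have : f' (SemidirectProduct.inr γ) = 0 := ha γ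
      rw [this, map_zero, add_zero]
    let f : G → V := fun g => f' (SemidirectProduct.inl g)
    have hf : f ∈ equivZ1 ρ := by
      refine ⟨⟨hf'.1.comp_continuous SemiProd.continuous_inl, fun g h => ?_⟩, fun γ g => ?_⟩
      · simp only [f, map_mul]
        exact hf'.2 _ _
      · have h := hf'.2 (SemidirectProduct.inr γ) (SemidirectProduct.inl g)
        rw [SemiProd.inr_mul_inl, hr] at h
        have h0 : f' (SemidirectProduct.inr γ) = 0 := ha γ
        rw [h0, zero_add] at h
        exact h
    refine ⟨⟨f, hf⟩, ?_⟩
    refine (Submodule.Quotient.eq _).2 ⟨a, fun e => ?_⟩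
    change f e.left - F.1 e = ρ e a - a
    have : f e.left = f' e := by
      conv_rhs => rw [← SemidirectProduct.inl_left_mul_inr_right e]
      exact (hr _ _).symm
    rw [this]
    simp [f']
  · intro f
    rw [← mem_range_fixedCoboundary ρ hΓ f.2.2]
    change Submodule.Quotient.mk _ = 0 ↔ _
    rw [Submodule.Quotient.mk_eq_zero]
    change inflC1 (Γ := Γ) (ℓ := ℓ) f.1 ∈ B1 ρ ↔ _
    constructor
    · rintro ⟨a, ha⟩
      exact ⟨a, fun g => ha (SemidirectProduct.inl g)⟩
    · intro h
      obtain ⟨a, ha⟩ := (mem_range_fixedCoboundary ρ hΓ f.2.2).1 h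
      refine ⟨a.1, fun e => ?_⟩
      change f.1 e.left = _
      rw [← ha, apply_eq]
      have : resΓ ρ e.right a.1 = a.1 := a.2 e.right
      rw [this]
      rfl

end SemidirectCohomology

/-! ### The five-term exact sequence of a `Γ`-presentation -/

section EqHom

variable {ℓ : ℕ} {F : Type*} [Group F] [TopologicalSpace F] {Γ : Type*} [Group Γ]
  [MulDistribMulAction Γ F] {V : Type*} [AddCommGroup V] [Module (ZMod ℓ) V]

/-- The continuous `F ⋊ Γ`-equivariant homomorphisms from a normal subgroup `N` of `F` to a
module. -/
def eqHom (N : Subgroup F) (τ : Representation (ZMod ℓ) (SemiProd F Γ) V) :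
    Submodule (ZMod ℓ) (N → V) where
  carrier := {f | IsLocallyConstant f ∧ (∀ x y, f (x * y) = f x + f y) ∧
    ∀ (h : SemiProd F Γ) (y z : N), (z : F) = h.left * (h.right • (y : F)) * h.left⁻¹ →
      f z = τ h (f y)}
  zero_mem' := ⟨IsLocallyConstant.const 0, by simp, by simp⟩
  add_mem' := by
    rintro f f' ⟨h1, h2, h3⟩ ⟨h1', h2', h3'⟩
    refine ⟨h1.add h1', fun x y => ?_, fun h y z hz => ?_⟩
    · simp only [Pi.add_apply, h2, h2']; abel
    · simp only [Pi.add_apply, h3 h y z hz, h3' h y z hz, map_add]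
  smul_mem' := by
    rintro c f ⟨h1, h2, h3⟩
    refine ⟨h1.comp (fun a => c • a), fun x y => ?_, fun h y z hz => ?_⟩
    · simp only [Pi.smul_apply, h2, smul_add]
    · simp only [Pi.smul_apply, h3 h y z hz, map_smul]

end EqHom

section FiveTerm

variable {ℓ : ℕ} [Fact ℓ.Prime] {n : ℕ} {Γ : Type u} [Group Γ] {G : Type v} [Group G]
  [TopologicalSpace G] [MulDistribMulAction Γ G]
  {V : Type w} [AddCommGroup V] [Module (ZMod ℓ) V]

theorem resG_comp_map {F : Type*} [Group F] [MulDistribMulAction Γ F] (φ : F →* G)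
    (hφ : ∀ (γ : Γ) (x : F), φ (γ • x) = γ • φ x)
    (ρ : Representation (ZMod ℓ) (SemiProd G Γ) V) (x : F) :
    resG (ρ.comp (SemiProd.map φ hφ)) x = resG ρ (φ x) := by
  change ρ (SemiProd.map φ hφ (SemidirectProduct.inl x)) = ρ (SemidirectProduct.inl (φ x))
  simp [SemiProd.map]

theorem resΓ_comp_map {F : Type*} [Group F] [MulDistribMulAction Γ F] (φ : F →* G)
    (hφ : ∀ (γ : Γ) (x : F), φ (γ • x) = γ • φ x)
    (ρ : Representation (ZMod ℓ) (SemiProd G Γ) V) (γ : Γ) :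
    resΓ (ρ.comp (SemiProd.map φ hφ)) γ = resΓ ρ γ := by
  change ρ (SemiProd.map φ hφ (SemidirectProduct.inr γ)) = ρ (SemidirectProduct.inr γ)
  simp [SemiProd.map]

section Free

variable [Finite V] (τ : Representation (ZMod ℓ) (SemiProd (FreeProfinite n Γ) Γ) V)
  (hτ : ∀ a : V, IsLocallyConstant (fun x => resG τ x a))
include hτ

/-- Take the value `γ a_i` at `x_{i,γ}`. The difference between the resulting cochain and any
conjugate is a cocycle, since `z` is equivariant, and it vanishes on the letters. -/
theorem exists_equivariant_cochain {z : FreeProfinite n Γ × FreeProfinite n Γ → V}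
    (hz : z ∈ equivZ2 τ) (a : Fin n → V) :
    ∃ c ∈ equivC1 τ, IsLocallyConstant c ∧ d1 (resG τ) c = z ∧
      ∀ i, c (FreeProfinite.letter i 1) = a i := by
  obtain ⟨c, hc, hcz, hca⟩ := FreeProfinite.exists_cochain (resG τ) hτ z hz.1
    (fun i γ => resΓ τ γ (a i))
  have hd : d1 (resG τ) c = z := by ext ⟨x, y⟩; rw [hcz]; rfl
  refine ⟨c, ?_, hc, hd, fun i => by rw [hca]; simp⟩
  rw [mem_equivC1_iff]
  intro γ
  rw [← sub_eq_zero]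
  refine FreeProfinite.cocycle_eq_zero (resG τ) _ ?_ fun i δ => ?_
  · rw [Z1_iff_d1]
    refine ⟨(hc.conjC1 τ γ).sub hc, ?_⟩
    rw [map_sub, d1_conjC1, hd, (mem_equivC2_iff τ).1 hz.2, sub_self]
  · change resΓ τ γ (c (γ⁻¹ • FreeProfinite.letter i δ)) - c (FreeProfinite.letter i δ) = 0
    rw [FreeProfinite.smul_letter, hca, hca, ← Module.End.mul_apply, ← map_mul,
      mul_inv_cancel_left, sub_self]

/-- Evaluation at the letters `x_{i,1}` is an isomorphism onto `V^n`: equivariance fixes the values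
at the other letters, and the existence of a cocycle with given values is the case `z = 0` of
`exists_equivariant_cochain`. -/
theorem dimN_equivZ1_free : dimN (ZMod ℓ) (equivZ1 τ) = n * dimN (ZMod ℓ) V := by
  rw [← dimN_pi]
  let ev : equivZ1 τ →ₗ[ZMod ℓ] (Fin n → V) :=
    { toFun := fun f i => f.1 (FreeProfinite.letter i 1)
      map_add' := fun _ _ => rfl
      map_smul' := fun _ _ => rfl }
  refine dimN_congr (LinearEquiv.ofBijective ev ⟨?_, fun a => ?_⟩)
  · rw [injective_iff_map_eq_zero]
    intro f hf
    refine Subtype.ext (FreeProfinite.cocycle_eq_zero (resG τ) f.1 f.2.1 fun i γ => ?_)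
    have h := f.2.2 γ (FreeProfinite.letter i 1)
    rw [FreeProfinite.smul_letter, mul_one] at h
    rw [h, show f.1 (FreeProfinite.letter i 1) = 0 from congrFun hf i, map_zero]
  · obtain ⟨c, hc, hcl, hd, hca⟩ := exists_equivariant_cochain τ hτ
      (Submodule.zero_mem (equivZ2 τ)) a
    exact ⟨⟨c, (Z1_iff_d1 _ _).2 ⟨hcl, hd⟩, hc⟩, funext hca⟩

end Free

variable [T2Space G] [Finite Γ] [Finite V] (φ : FreeProfinite n Γ →* G) (hφc : Continuous φ)
  (hφ : Function.Surjective φ) (hΓ : ∀ (γ : Γ) (x : FreeProfinite n Γ), φ (γ • x) = γ • φ x)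
  (ρ : Representation (ZMod ℓ) (SemiProd G Γ) V)

/-- Pairs of a cochain on `F_n(Γ)` and a cocycle on `G` whose inflation is its coboundary. -/
noncomputable def transgressionPairs :
    Submodule (ZMod ℓ) ((FreeProfinite n Γ → V) × (G × G → V)) where
  carrier := {p | p.1 ∈ equivC1 (ρ.comp (SemiProd.map φ hΓ)) ∧ IsLocallyConstant p.1 ∧
    p.2 ∈ equivZ2 ρ ∧ ∀ x y, d1 (resG (ρ.comp (SemiProd.map φ hΓ))) p.1 (x, y) = p.2 (φ x, φ y)}
  zero_mem' := ⟨Submodule.zero_mem _, IsLocallyConstant.const 0, Submodule.zero_mem _, by simp⟩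
  add_mem' := by
    rintro p q ⟨h1, h2, h3, h4⟩ ⟨h1', h2', h3', h4'⟩
    exact ⟨Submodule.add_mem _ h1 h1', h2.add h2', Submodule.add_mem _ h3 h3', fun x y => by
      simp only [Prod.fst_add, Prod.snd_add, map_add, Pi.add_apply, h4, h4']⟩
  smul_mem' := by
    rintro r p ⟨h1, h2, h3, h4⟩
    exact ⟨Submodule.smul_mem _ _ h1, h2.comp (fun a => r • a), Submodule.smul_mem _ _ h3,
      fun x y => by simp only [Prod.smul_fst, Prod.smul_snd, map_smul, Pi.smul_apply, h4]⟩

omit [T2Space G] [Finite Γ] [Finite V] in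
theorem d1_fst_apply (p : transgressionPairs φ hΓ ρ) (x y : FreeProfinite n Γ) :
    resG ρ (φ x) (p.1.1 y) - p.1.1 (x * y) + p.1.1 x = p.1.2 (φ x, φ y) := by
  have := p.2.2.2.2 x y
  rw [d1_apply, resG_comp_map] at this
  exact this

omit [T2Space G] [Finite Γ] [Finite V] in
-- When one argument lies in the kernel and comes first, the inflated cocycle has the constant value
-- `z (1, 1)`, which is the value of the cochain at `1`. Without normalisation the cochain is
-- therefore additive on the kernel only after subtracting its value at `1`.
theorem fst_mul_left (p : transgressionPairs φ hΓ ρ) (m : φ.ker) (x : FreeProfinite n Γ) :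
    p.1.1 (m * x) = p.1.1 m - p.1.1 1 + p.1.1 x := by
  have h := d1_fst_apply φ hΓ ρ p m x
  have h1 := d1_fst_apply φ hΓ ρ p 1 1
  have hm : φ m = 1 := m.2
  rw [hm, map_one, Module.End.one_apply,
    TwistedProd.cocycle_one_left (resG ρ) p.1.2 p.2.2.2.1.1.2] at h
  simp only [map_one, mul_one, Module.End.one_apply, sub_self, zero_add] at h1
  rw [← h1] at h
  rw [← h]
  abel

omit [T2Space G] [Finite Γ] [Finite V] in
theorem fst_mul_right (p : transgressionPairs φ hΓ ρ) (m : φ.ker) (x : FreeProfinite n Γ) :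
    p.1.1 (x * m) = resG ρ (φ x) (p.1.1 m - p.1.1 1) + p.1.1 x := by
  have h := d1_fst_apply φ hΓ ρ p x m
  have h1 := d1_fst_apply φ hΓ ρ p 1 1
  have hm : φ m = 1 := m.2
  rw [hm, TwistedProd.cocycle_one_right (resG ρ) p.1.2 p.2.2.2.1.1.2] at h
  simp only [map_one, mul_one, Module.End.one_apply, sub_self, zero_add] at h1
  rw [← h1] at h
  rw [map_sub, ← h]
  abel

/-- Restriction of a cochain to the kernel of the presentation. -/
noncomputable def restrictKer : transgressionPairs φ hΓ ρ →ₗ[ZMod ℓ]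
    eqHom φ.ker (ρ.comp (SemiProd.map φ hΓ)) where
  toFun p := ⟨fun m => p.1.1 m - p.1.1 1, by
    refine ⟨(p.2.2.1.comp_continuous continuous_subtype_val).sub (IsLocallyConstant.const _),
      fun x y => ?_, fun h y z hz => ?_⟩
    · beta_reduce
      rw [Subgroup.coe_mul, fst_mul_left]; abel
    · have e1 : p.1.1 1 = resΓ ρ h.right (p.1.1 1) := by
        have := p.2.1 h.right 1
        rwa [smul_one, resΓ_comp_map] at this
      have e2 : p.1.1 (h.right • (y : FreeProfinite n Γ)) = resΓ ρ h.right (p.1.1 y) := by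
        have := p.2.1 h.right y
        rwa [resΓ_comp_map] at this
      have hy : h.right • (y : FreeProfinite n Γ) ∈ φ.ker := by
        rw [MonoidHom.mem_ker, hΓ, show φ y = 1 from y.2, smul_one]
      have h1 := fst_mul_left φ hΓ ρ p z h.left
      have h2 := fst_mul_right φ hΓ ρ p ⟨_, hy⟩ h.left
      rw [hz, inv_mul_cancel_right] at h1
      rw [h1, add_right_cancel_iff] at h2
      beta_reduce
      rw [hz, h2, apply_eq, resG_comp_map, resΓ_comp_map, map_sub (resΓ ρ h.right), ← e1, ← e2]⟩
  map_add' p q := by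
    ext m
    change p.1.1 m + q.1.1 m - (p.1.1 1 + q.1.1 1) = p.1.1 m - p.1.1 1 + (q.1.1 m - q.1.1 1)
    abel
  map_smul' r p := by
    ext m
    change r • p.1.1 m - r • p.1.1 1 = r • (p.1.1 m - p.1.1 1)
    rw [smul_sub]

/-- The second projection. -/
noncomputable def sndPair : transgressionPairs φ hΓ ρ →ₗ[ZMod ℓ] equivZ2 ρ :=
  ((LinearMap.snd _ _ _).comp (Submodule.subtype _)).codRestrict _ fun p => p.2.2.2.1

/-- Cocycles as pairs. -/
noncomputable def cocyclePair : equivZ1 (ρ.comp (SemiProd.map φ hΓ)) →ₗ[ZMod ℓ] transgressionPairs φ hΓ ρ :=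
  ((LinearMap.inl _ _ _).comp (Submodule.subtype _)).codRestrict _ fun f =>
    ⟨f.2.2, f.2.1.1, Submodule.zero_mem _, fun x y => by
      change d1 _ f.1 (x, y) = 0
      rw [((Z1_iff_d1 _ _).1 f.2.1).2]; rfl⟩

/-- Inflation of cocycles. -/
noncomputable def inflateZ1 : equivZ1 ρ →ₗ[ZMod ℓ] equivZ1 (ρ.comp (SemiProd.map φ hΓ)) :=
  ((LinearMap.funLeft (ZMod ℓ) V φ).comp (Submodule.subtype _)).codRestrict _ fun f =>
    ⟨⟨f.2.1.1.comp_continuous hφc, fun x y => by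
      change f.1 (φ (x * y)) = f.1 (φ x) + resG _ x (f.1 (φ y))
      rw [map_mul, f.2.1.2, resG_comp_map]⟩, fun γ x => by
      change f.1 (φ (γ • x)) = resΓ _ γ (f.1 (φ x))
      rw [hΓ, f.2.2, resΓ_comp_map]⟩

omit [Finite Γ] [Finite V] in
/-- A cochain invariant under the kernel descends. -/
theorem exists_descent (hφc : Continuous φ) (hφ : Function.Surjective φ)
    {c : FreeProfinite n Γ → V} (hc : IsLocallyConstant c)
    (hcΓ : c ∈ equivC1 (ρ.comp (SemiProd.map φ hΓ)))
    (h : ∀ (m : φ.ker) x, c (m * x) = c x) :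
    ∃ b ∈ equivC1 ρ, IsLocallyConstant b ∧ ∀ x, b (φ x) = c x := by
  let b : G → V := fun g => c (Function.surjInv hφ g)
  have hb : ∀ x, b (φ x) = c x := by
    intro x
    have h1 : Function.surjInv hφ (φ x) * x⁻¹ ∈ φ.ker := by
      rw [MonoidHom.mem_ker, map_mul, Function.surjInv_eq hφ, map_inv, mul_inv_cancel]
    have := h ⟨_, h1⟩ x
    simpa using this
  refine ⟨b, fun γ g => ?_, ?_, hb⟩
  · obtain ⟨x, rfl⟩ := hφ g
    rw [← hΓ, hb, hb, hcΓ, resΓ_comp_map]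
  · refine IsLocallyConstant.of_comp_surjective hφc hφ ?_
    have : b ∘ φ = c := funext hb
    rwa [this]

include hφc hφ

/-- A homomorphism on the kernel extends to a locally constant function on `F_n` that is additive
for left translation by the kernel, and averaging over `Γ` makes the extension equivariant. Its
coboundary is invariant under the kernel in both variables, so it descends to a 2-cocycle on `G`.
This is the transgression. -/
theorem restrictKer_surjective (hcard : (Nat.card Γ : ZMod ℓ) ≠ 0)
    (hρ : ∀ a : V, IsLocallyConstant (fun g => resG ρ g a)) :
    Function.Surjective (restrictKer φ hΓ ρ) := by
  set τ := ρ.comp (SemiProd.map φ hΓ) with hτdef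
  intro f
  have hτ : ∀ a : V, IsLocallyConstant (fun x => resG τ x a) := fun a => by
    simp only [hτdef, resG_comp_map]
    exact (hρ a).comp_continuous hφc
  obtain ⟨c₀, hc₀, hc₀N⟩ := exists_extension_of_hom φ.ker f.1 f.2.1 f.2.2.1
  let c : FreeProfinite n Γ → V := meanValue (ZMod ℓ) (fun γ : Γ => conjC1 τ γ c₀)
  have hc : IsLocallyConstant c := IsLocallyConstant.meanValue _ fun γ => hc₀.conjC1 τ γ
  have hcΓ : c ∈ equivC1 τ := meanValue_conjC1_mem τ c₀
  have hcN : ∀ (m : φ.ker) x, c (m * x) = f.1 m + c x := by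
    intro m x
    simp only [c, meanValue_apply]
    conv_rhs => rw [← meanValue_const (Γ := Γ) hcard (f.1 m)]
    rw [← meanValue_add]
    congr 1
    ext γ
    change resΓ τ γ (c₀ (γ⁻¹ • ((m : FreeProfinite n Γ) * x))) = f.1 m + resΓ τ γ (c₀ (γ⁻¹ • x))
    have hm : γ⁻¹ • (m : FreeProfinite n Γ) ∈ φ.ker := by
      rw [MonoidHom.mem_ker, hΓ, show φ m = 1 from m.2, smul_one]
    have h1 := hc₀N ⟨_, hm⟩ (γ⁻¹ • x)
    have h2 := f.2.2.2 (SemidirectProduct.inr γ⁻¹) m ⟨_, hm⟩ (by simp)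
    rw [smul_mul', h1, h2, map_add]
    congr 1
    exact resΓ_inv_apply τ γ _
  -- Equivariance of `f` under conjugation turns left translation by the kernel into right
  -- translation.
  have hcNr : ∀ (m : φ.ker) x, c (x * m) = resG τ x (f.1 m) + c x := by
    intro m x
    have hm : x * m * x⁻¹ ∈ φ.ker := (MonoidHom.normal_ker φ).conj_mem _ m.2 x
    have h1 := hcN ⟨_, hm⟩ x
    have h2 := f.2.2.2 (SemidirectProduct.inl x) m ⟨_, hm⟩ (by simp)
    rw [inv_mul_cancel_right] at h1
    rw [h1, h2]
    rfl
  have hτN : ∀ (m : φ.ker), resG τ m = 1 := fun m => by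
    rw [hτdef, resG_comp_map, show φ m = 1 from m.2, map_one]
  have hdl : ∀ (m : φ.ker) x y, d1 (resG τ) c (m * x, y) = d1 (resG τ) c (x, y) := by
    intro m x y
    rw [d1_apply, d1_apply, mul_assoc, hcN, hcN, map_mul, hτN, one_mul]
    abel
  have hdr : ∀ (m : φ.ker) x y, d1 (resG τ) c (x, m * y) = d1 (resG τ) c (x, y) := by
    intro m x y
    have : x * (m * y) = (x * m * x⁻¹) * (x * y) := by group
    have hm : x * m * x⁻¹ ∈ φ.ker := (MonoidHom.normal_ker φ).conj_mem _ m.2 x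
    rw [d1_apply, d1_apply, this, hcN ⟨_, hm⟩, hcN, map_add]
    have h2 := f.2.2.2 (SemidirectProduct.inl x) m ⟨_, hm⟩ (by simp)
    rw [h2]
    change resG τ x (f.1 m) + _ - (resG τ x (f.1 m) + _) + _ = _
    abel
  let s := Function.surjInv hφ
  have hs : ∀ g, φ (s g) = g := Function.surjInv_eq hφ
  let z : G × G → V := fun p => d1 (resG τ) c (s p.1, s p.2)
  have hker : ∀ x, x * (s (φ x))⁻¹ ∈ φ.ker := fun x => by
    rw [MonoidHom.mem_ker, map_mul, map_inv, hs, mul_inv_cancel]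
  have hz : ∀ x y, d1 (resG τ) c (x, y) = z (φ x, φ y) := by
    intro x y
    have h1 := hdl ⟨_, hker x⟩ (s (φ x)) y
    have h2 := hdr ⟨_, hker y⟩ (s (φ x)) (s (φ y))
    rw [inv_mul_cancel_right] at h1 h2
    rw [h1, h2]
  have hdZ := d1_mem_Z2 (resG τ) hτ hc
  have hdΓ := d1_mem_equivC2 τ hcΓ
  have hzZ : z ∈ equivZ2 ρ := by
    refine ⟨⟨?_, fun g h k => ?_⟩, fun γ g h => ?_⟩
    · refine IsLocallyConstant.of_comp_surjective (p := Prod.map φ φ) (hφc.prodMap hφc)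
        (hφ.prodMap hφ) ?_
      have : z ∘ Prod.map φ φ = d1 (resG τ) c := by
        ext ⟨x, y⟩
        exact (hz x y).symm
      rw [this]
      exact hdZ.1
    · obtain ⟨x, rfl⟩ := hφ g
      obtain ⟨y, rfl⟩ := hφ h
      obtain ⟨t, rfl⟩ := hφ k
      rw [← map_mul, ← map_mul, ← hz, ← hz, ← hz, ← hz, ← resG_comp_map φ hΓ ρ]
      exact hdZ.2 x y t
    · obtain ⟨x, rfl⟩ := hφ g
      obtain ⟨y, rfl⟩ := hφ h
      rw [← hΓ, ← hΓ, ← hz, ← hz, hdΓ, resΓ_comp_map]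
  refine ⟨⟨(c, z), hcΓ, hc, hzZ, hz⟩, ?_⟩
  ext m
  change c m - c 1 = f.1 m
  have := hcN m 1
  rw [mul_one] at this
  rw [this]; abel

/-- The Euler characteristic form of the five-term exact sequence of a presentation. -/
theorem dimN_eqHom_add (hcard : (Nat.card Γ : ZMod ℓ) ≠ 0)
    (hρ : ∀ a : V, IsLocallyConstant (fun g => resG ρ g a))
    {H : Type*} [AddCommGroup H] [Module (ZMod ℓ) H] (j : equivZ2 ρ →ₗ[ZMod ℓ] H)
    (hj : IsEquivH2 ρ j) :
    dimN (ZMod ℓ) (eqHom φ.ker (ρ.comp (SemiProd.map φ hΓ))) + dimN (ZMod ℓ) (equivZ1 ρ) =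
      n * dimN (ZMod ℓ) V + dimN (ZMod ℓ) H := by
  have hτ : ∀ a : V, IsLocallyConstant
      (fun x => resG (ρ.comp (SemiProd.map φ hΓ)) x a) := fun a => by
    simp only [resG_comp_map]
    exact (hρ a).comp_continuous hφc
  rw [← dimN_equivZ1_free (ρ.comp (SemiProd.map φ hΓ)) hτ]
  refine dimN_five_term (restrictKer φ hΓ ρ) (j.comp (sndPair φ hΓ ρ)) (cocyclePair φ hΓ ρ)
    (inflateZ1 φ hφc hΓ ρ) (restrictKer_surjective φ hφc hφ hΓ ρ hcard hρ) ?_ ?_ ?_ ?_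
  -- An equivariant cocycle on `G`, inflated to `F_n`, is the coboundary of an equivariant cochain.
  · refine hj.surjective.comp fun z => ?_
    have hz : (fun p : FreeProfinite n Γ × FreeProfinite n Γ => z.1 (φ p.1, φ p.2)) ∈
        equivZ2 (ρ.comp (SemiProd.map φ hΓ)) := by
      refine ⟨⟨z.2.1.1.comp_continuous (hφc.prodMap hφc), fun x y t => ?_⟩, fun γ x y => ?_⟩
      · beta_reduce
        rw [resG_comp_map, map_mul, map_mul]
        exact z.2.1.2 _ _ _
      · simp only [hΓ]
        rw [z.2.2, resΓ_comp_map]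
    obtain ⟨c, hcΓ, hc, hd, -⟩ := exists_equivariant_cochain _ hτ hz 0
    exact ⟨⟨(c, z), hcΓ, hc, z.2, fun x y => by rw [hd]⟩, rfl⟩
  -- If `z = d b` with `b` equivariant on `G`, then `(b ∘ φ, z)` restricts to zero on the kernel,
  -- and removing it from the pair leaves a cocycle on `F_n`. Conversely, a pair restricting to zero
  -- on the kernel has a cochain that descends to a primitive of `z` on `G`.
  · ext p
    rw [LinearMap.mem_ker, LinearMap.comp_apply, hj.ker, Submodule.mem_sup]
    constructor
    · rintro ⟨b, hbΓ, hb, hbz⟩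
      have hbz : d1 (resG ρ) b = p.1.2 := hbz
      have hbφ : b ∘ φ ∈ equivC1 (ρ.comp (SemiProd.map φ hΓ)) := fun γ x => by
        change b (φ (γ • x)) = _
        rw [hΓ, hbΓ, resΓ_comp_map]; rfl
      have hbφd : ∀ x y, d1 (resG (ρ.comp (SemiProd.map φ hΓ))) (b ∘ φ) (x, y) =
          p.1.2 (φ x, φ y) := fun x y => by
        rw [d1_apply, ← hbz, d1_apply, resG_comp_map, ← map_mul]; rfl
      have hbl : IsLocallyConstant (b ∘ φ) := hb.comp_continuous hφc
      refine ⟨⟨(b ∘ φ, p.1.2), hbφ, hbl, p.2.2.2.1, hbφd⟩, ?_,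
        cocyclePair φ hΓ ρ ⟨p.1.1 - b ∘ φ, (Z1_iff_d1 _ _).2 ⟨p.2.2.1.sub hbl, ?_⟩,
          Submodule.sub_mem _ p.2.1 hbφ⟩, ⟨_, rfl⟩, ?_⟩
      · rw [LinearMap.mem_ker]
        ext m
        change b (φ m) - b (φ 1) = 0
        rw [show φ m = 1 from m.2, map_one, sub_self]
      · ext ⟨x, y⟩
        rw [map_sub, Pi.sub_apply, hbφd, p.2.2.2.2, sub_self]; rfl
      · refine Subtype.ext (Prod.ext ?_ ?_)
        · change b ∘ φ + (p.1.1 - b ∘ φ) = _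
          abel
        · exact add_zero _
    · rintro ⟨q, hq, _, ⟨f, rfl⟩, rfl⟩
      rw [LinearMap.mem_ker] at hq
      have hq' : ∀ m : φ.ker, q.1.1 m - q.1.1 1 = 0 := fun m =>
        congrFun (congrArg Subtype.val hq) m
      obtain ⟨b, hbΓ, hb, hbφ⟩ := exists_descent φ hΓ ρ hφc hφ q.2.2.1 q.2.1 fun m x => by
        rw [fst_mul_left, hq', zero_add]
      refine ⟨b, hbΓ, hb, ?_⟩
      ext ⟨g, h⟩
      obtain ⟨x, rfl⟩ := hφ g
      obtain ⟨y, rfl⟩ := hφ h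
      rw [d1_apply, ← map_mul, hbφ, hbφ, hbφ, d1_fst_apply]
      exact (add_zero _).symm
  · rw [injective_iff_map_eq_zero]
    intro f hf
    ext g
    obtain ⟨x, rfl⟩ := hφ g
    exact congrFun (congrArg Subtype.val hf) x
  -- A cocycle on `F_n` that vanishes on the kernel is inflated from `G`.
  · ext f
    rw [LinearMap.mem_ker]
    constructor
    · rintro ⟨g, rfl⟩
      ext m
      change g.1 (φ m) - g.1 (φ 1) = 0
      rw [show φ m = 1 from m.2, map_one, sub_self]
    · intro hf
      have hf1 : f.1 1 = 0 := by simpa using f.2.1.2 1 1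
      have hfm : ∀ m : φ.ker, f.1 m = 0 := fun m => by
        have := congrFun (congrArg Subtype.val hf) m
        change f.1 m - f.1 1 = 0 at this
        rwa [hf1, sub_zero] at this
      obtain ⟨b, hbΓ, hb, hbφ⟩ := exists_descent φ hΓ ρ hφc hφ f.2.1.1 f.2.2 fun m x => by
        rw [f.2.1.2, hfm, zero_add, resG_comp_map, show φ m = 1 from m.2, map_one]; rfl
      refine ⟨⟨b, ⟨hb, fun g h => ?_⟩, hbΓ⟩, ?_⟩
      · obtain ⟨x, rfl⟩ := hφ g
        obtain ⟨y, rfl⟩ := hφ h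
        rw [← map_mul, hbφ, hbφ, hbφ, f.2.1.2, resG_comp_map]
      · ext x
        exact hbφ x

end FiveTerm

/-! ### Maximal proper normal subgroups and the decomposition into irreducible groups -/

section Operators

variable {F : Type*} [Group F] {Γ : Type*} [Group Γ] [MulDistribMulAction Γ F]

/-- The conjugation action of `F ⋊ Γ` on `F`. -/
def opAct (h : SemiProd F Γ) : F →* F where
  toFun y := h.left * (h.right • y) * h.left⁻¹
  map_one' := by simp
  map_mul' x y := by simp [smul_mul', mul_assoc]

theorem opAct_apply (h : SemiProd F Γ) (y : F) :
    opAct h y = h.left * (h.right • y) * h.left⁻¹ := rfl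

theorem opAct_one (y : F) : opAct (1 : SemiProd F Γ) y = y := by
  simp [opAct_apply]

theorem opAct_mul (h h' : SemiProd F Γ) (y : F) : opAct (h * h') y = opAct h (opAct h' y) := by
  simp [opAct_apply, smul_mul', mul_assoc, mul_smul]

theorem opAct_inl (x y : F) : opAct (SemidirectProduct.inl x : SemiProd F Γ) y = x * y * x⁻¹ := by
  simp [opAct_apply]

theorem opAct_inr (γ : Γ) (y : F) : opAct (SemidirectProduct.inr γ : SemiProd F Γ) y = γ • y := by
  simp [opAct_apply]

/-- An action by automorphisms from a multiplicative family of endomorphisms. -/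
def mulAutOfEnd {H B : Type*} [Group H] [Group B] (a : H → (B →* B)) (h1 : ∀ b, a 1 b = b)
    (hmul : ∀ h h' b, a (h * h') b = a h (a h' b)) : H →* MulAut B where
  toFun h :=
    { toFun := a h
      invFun := a h⁻¹
      left_inv := fun b => by rw [← hmul, inv_mul_cancel, h1]
      right_inv := fun b => by rw [← hmul, mul_inv_cancel, h1]
      map_mul' := map_mul (a h) }
  map_one' := MulEquiv.ext h1
  map_mul' h h' := MulEquiv.ext (hmul h h')

variable [TopologicalSpace F]

theorem IsClosedNormal.opAct_mem {N : Subgroup F} (hN : IsClosedNormal Γ N) (h : SemiProd F Γ)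
    {y : F} (hy : y ∈ N) : opAct h y ∈ N :=
  hN.2.1.conj_mem _ (hN.2.2 _ _ hy) _

theorem isClosedNormal_of_opAct {N : Subgroup F} (hc : IsClosed (N : Set F))
    (h : ∀ (h : SemiProd F Γ), ∀ y ∈ N, opAct h y ∈ N) : IsClosedNormal Γ N := by
  refine ⟨hc, ⟨fun y hy x => ?_⟩, fun γ y hy => ?_⟩
  · rw [← opAct_inl (Γ := Γ)]; exact h _ _ hy
  · rw [← opAct_inr]; exact h _ _ hy

theorem IsClosedNormal.inf {N U : Subgroup F} (hN : IsClosedNormal Γ N) (hU : IsClosedNormal Γ U) :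
    IsClosedNormal Γ (N ⊓ U) :=
  isClosedNormal_of_opAct (hN.1.inter hU.1) fun h _ hy => ⟨hN.opAct_mem h hy.1, hU.opAct_mem h hy.2⟩

theorem isClosedNormal_sInf {S : Set (Subgroup F)} (hS : ∀ U ∈ S, IsClosedNormal Γ U) :
    IsClosedNormal Γ (sInf S) := by
  refine isClosedNormal_of_opAct ?_ fun h y hy => ?_
  · rw [Subgroup.coe_sInf]
    exact isClosed_biInter fun U hU => (hS U hU).1
  · rw [Subgroup.mem_sInf] at hy ⊢
    exact fun U hU => (hS U hU).opAct_mem h (hy U hU)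

/-- The conjugation action of `F ⋊ Γ` on a normal subgroup. -/
def IsClosedNormal.opEnd {N : Subgroup F} (hN : IsClosedNormal Γ N) (h : SemiProd F Γ) :
    N →* N :=
  ((opAct h).comp N.subtype).codRestrict N fun y => hN.opAct_mem h y.2

/-- The action of `F ⋊ Γ` on the quotient of two normal subgroups. -/
def quotientAct {N U : Subgroup F} (hN : IsClosedNormal Γ N) (hU : IsClosedNormal Γ U)
    [(U.subgroupOf N).Normal] : SemiProd F Γ →* MulAut (N ⧸ U.subgroupOf N) :=
  mulAutOfEnd (fun h => QuotientGroup.map _ _ (hN.opEnd h) fun _ hy => hU.opAct_mem h hy)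
    (fun b => by
      obtain ⟨y, rfl⟩ := QuotientGroup.mk_surjective b
      exact congrArg QuotientGroup.mk (Subtype.ext (opAct_one y.1)))
    (fun h h' b => by
      obtain ⟨y, rfl⟩ := QuotientGroup.mk_surjective b
      exact congrArg QuotientGroup.mk (Subtype.ext (opAct_mul h h' y.1)))

end Operators

/-! ### Existence of maximal subgroups and of a decomposition -/

section Maximal

variable {F : Type v} [Group F] [TopologicalSpace F] [IsTopologicalGroup F] [CompactSpace F]
  [T2Space F] [TotallyDisconnectedSpace F] {Γ : Type u} [Group Γ] [Finite Γ]
  [MulDistribMulAction Γ F] [ContinuousConstSMul Γ F]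

omit [TotallyDisconnectedSpace F] [Finite Γ] [ContinuousConstSMul Γ F] in
theorem isClosedNormal_sup {K U : Subgroup F} (hK : IsClosedNormal Γ K) (hU : IsClosedNormal Γ U) :
    IsClosedNormal Γ (K ⊔ U) := by
  have := hK.2.1
  have := hU.2.1
  refine isClosedNormal_of_opAct ?_ fun h y hy => ?_
  · rw [Subgroup.mul_normal]
    exact (hK.1.isCompact.mul hU.1.isCompact).isClosed
  · obtain ⟨k, hk, x, hx, rfl⟩ := Subgroup.mem_sup_of_normal_right.1 hy
    rw [map_mul]
    exact Subgroup.mul_mem_sup (hK.opAct_mem h hk) (hU.opAct_mem h hx)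

theorem exists_openNormal_of_lt {N U : Subgroup F} (hU : IsClosedNormal Γ U) (hlt : U < N) :
    ∃ V : Subgroup F, V.Normal ∧ IsOpen (V : Set F) ∧ IsClosedNormal Γ V ∧ N ⊓ (U ⊔ V) < N := by
  obtain ⟨x, hxN, hxU⟩ := SetLike.exists_of_lt hlt
  obtain ⟨V, hVn, hVo, hVΓ, hV⟩ := exists_openNormal_notMem_sup Γ hU.1 hxU
  exact ⟨V, hVn, hVo, ⟨V.isClosed_of_isOpen hVo, hVn, hVΓ⟩,
    lt_of_le_of_ne inf_le_left fun h => hV (by rw [← h] at hxN; exact hxN.2)⟩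

/-- Enlarging `U` by a small open normal subgroup gives finite index in `N` while staying proper; a
proper closed normal subgroup of least index above it is maximal. -/
theorem exists_isMaximalProper {N U : Subgroup F} (hN : IsClosedNormal Γ N)
    (hU : IsClosedNormal Γ U) (hlt : U < N) : ∃ U', IsMaximalProper Γ N U' ∧ U ≤ U' := by
  obtain ⟨V, hVn, hVo, hV, hVlt⟩ := exists_openNormal_of_lt hU hlt
  set U₁ := N ⊓ (U ⊔ V)
  have hU₁ : IsClosedNormal Γ U₁ := hN.inf (isClosedNormal_sup hU hV)
  have hUU₁ : U ≤ U₁ := le_inf hlt.le le_sup_left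
  have hVf : V.FiniteIndex := by
    have := Subgroup.quotient_finite_of_isOpen V hVo
    exact Subgroup.finiteIndex_of_finite_quotient
  have hfin : ∀ W : Subgroup F, U₁ ≤ W → W.relIndex N ≠ 0 := by
    intro W hW h0
    have h1 : V.relIndex N ≠ 0 := Subgroup.FiniteIndex.index_ne_zero (H := V.subgroupOf N)
    have h2 : (N ⊓ V).relIndex N ≠ 0 := by
      rwa [inf_comm, Subgroup.inf_relIndex_right]
    exact h2 (Subgroup.relIndex_eq_zero_of_le_left
      ((inf_le_inf_left N le_sup_right : N ⊓ V ≤ U₁).trans hW) h0)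
  have hne : {k | ∃ W, IsClosedNormal Γ W ∧ U₁ ≤ W ∧ W < N ∧ W.relIndex N = k}.Nonempty :=
    ⟨_, U₁, hU₁, le_rfl, hVlt, rfl⟩
  obtain ⟨W, hW, hUW, hWN, hWk⟩ := Nat.sInf_mem hne
  refine ⟨W, ⟨⟨hW, hWN⟩, fun W' hW' hle hlt' => ?_⟩, hUU₁.trans hUW⟩
  have h1 : W.relIndex N ≤ W'.relIndex N := by
    rw [hWk]
    exact Nat.sInf_le ⟨W', hW', hUW.trans hle, hlt', rfl⟩
  have h2 := Subgroup.relIndex_mul_relIndex W W' N hle hlt'.le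
  have h3 := hfin W hUW
  have h4 := hfin W' (hUW.trans hle)
  have h5 : W.relIndex W' = 1 := by
    have h6 : W.relIndex W' ≠ 0 := fun h => h3 (by rw [← h2, h, zero_mul])
    rw [← h2] at h1
    have h7 : 0 < W'.relIndex N := Nat.pos_of_ne_zero h4
    by_contra h8
    have := Nat.mul_le_mul_right (W'.relIndex N) (show 2 ≤ W.relIndex W' by omega)
    omega
  exact le_antisymm (Subgroup.relIndex_eq_one.1 h5) hle

/-- For a small open normal `V`, the group `N ⊓ (U ⊔ V)` is still proper, so it equals `U` by
maximality. Thus `U` is open in `N`. -/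
theorem IsMaximalProper.exists_openNormal {N U : Subgroup F} (hN : IsClosedNormal Γ N)
    (hU : IsMaximalProper Γ N U) :
    ∃ V : Subgroup F, V.Normal ∧ IsOpen (V : Set F) ∧ N ⊓ V ≤ U := by
  obtain ⟨V, hVn, hVo, hV, hVlt⟩ := exists_openNormal_of_lt hU.1.1 hU.1.2
  refine ⟨V, hVn, hVo, ?_⟩
  rw [← hU.2 _ (hN.inf (isClosedNormal_sup hU.1.1 hV)) (le_inf hU.1.2.le le_sup_left) hVlt]
  exact inf_le_inf_left N le_sup_right

theorem IsMaximalProper.isLocallyConstant_mk {N U : Subgroup F} (hN : IsClosedNormal Γ N)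
    (hU : IsMaximalProper Γ N U) :
    IsLocallyConstant (fun x : N => (QuotientGroup.mk x : N ⧸ U.subgroupOf N)) := by
  obtain ⟨V, hVn, hVo, hV⟩ := hU.exists_openNormal hN
  rw [IsLocallyConstant.iff_exists_open]
  intro x
  refine ⟨(fun y : N => (x : F)⁻¹ * y) ⁻¹' V,
    hVo.preimage ((continuous_const_mul _).comp continuous_subtype_val), by simp, fun y hy => ?_⟩
  rw [eq_comm, QuotientGroup.eq]
  exact hV ⟨N.mul_mem (N.inv_mem x.2) y.2, hy⟩

theorem IsMaximalProper.finite_quotient {N U : Subgroup F} (hN : IsClosedNormal Γ N)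
    (hU : IsMaximalProper Γ N U) : Finite (N ⧸ U.subgroupOf N) := by
  have : CompactSpace N := isCompact_iff_compactSpace.1 hN.1.isCompact
  have h := (hU.isLocallyConstant_mk hN).range_finite
  rw [QuotientGroup.mk_surjective.range_eq] at h
  exact Set.finite_univ_iff.1 h

omit [Finite Γ] [TotallyDisconnectedSpace F] [ContinuousConstSMul Γ F] in
theorem IsMaximalProper.sup_eq {N U K : Subgroup F} (hU : IsMaximalProper Γ N U)
    (hK : IsClosedNormal Γ K) (hKN : K ≤ N) (hKU : ¬ K ≤ U) : K ⊔ U = N := by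
  by_contra h
  refine hKU ?_
  rw [← hU.2 (K ⊔ U) (isClosedNormal_sup hK hU.1.1) le_sup_right
    (lt_of_le_of_ne (sup_le hKN hU.1.2.le) h)]
  exact le_sup_left

/-- Stable subgroups of the quotient correspond to closed normal subgroups between `U` and `N`;
closedness is automatic because the quotient map is locally constant. -/
theorem IsMaximalProper.irreducible {N U : Subgroup F} (hN : IsClosedNormal Γ N)
    (hU : IsMaximalProper Γ N U) [(U.subgroupOf N).Normal] :
    IsIrreducibleGroup (quotientAct hN hU.1.1) := by
  constructor
  · rw [← not_subsingleton_iff_nontrivial]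
    intro h
    obtain ⟨x, hxN, hxU⟩ := SetLike.exists_of_lt hU.1.2
    have : (QuotientGroup.mk (⟨x, hxN⟩ : N) : N ⧸ U.subgroupOf N) = 1 := Subsingleton.elim _ _
    rw [QuotientGroup.eq_one_iff] at this
    exact hxU this
  · intro S hS
    set P := (S.comap (QuotientGroup.mk' (U.subgroupOf N))).map N.subtype
    have hPmem : ∀ y : N, (y : F) ∈ P ↔ (QuotientGroup.mk y : N ⧸ U.subgroupOf N) ∈ S := by
      intro y
      constructor
      · rintro ⟨y', hy', h⟩
        rw [← Subtype.ext h]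
        exact hy'
      · intro h
        exact ⟨y, h, rfl⟩
    have hPN : P ≤ N := by
      rintro _ ⟨y, -, rfl⟩
      exact y.2
    have hP : IsClosedNormal Γ P := by
      refine isClosedNormal_of_opAct ?_ fun h y hy => ?_
      · have h1 : IsClosed {y : N | (QuotientGroup.mk y : N ⧸ U.subgroupOf N) ∈ S} := by
          rw [← isOpen_compl_iff]
          exact hU.isLocallyConstant_mk hN (S : Set _)ᶜ
        exact hN.1.isClosedEmbedding_subtypeVal.isClosedMap _ h1
      · have := (hPmem ⟨y, hPN hy⟩).1 hy
        exact (hPmem (hN.opEnd h ⟨y, hPN hy⟩)).2 (hS h _ this)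
    have hUP : U ≤ P := by
      intro x hx
      refine (hPmem ⟨x, hU.1.2.le hx⟩).2 ?_
      have : (QuotientGroup.mk (⟨x, hU.1.2.le hx⟩ : N) : N ⧸ U.subgroupOf N) = 1 :=
        (QuotientGroup.eq_one_iff _).2 hx
      rw [this]; exact S.one_mem
    rcases hPN.lt_or_eq with hlt | heq
    · left
      have hPU := hU.2 P hP hUP hlt
      rw [eq_bot_iff]
      intro b hb
      obtain ⟨y, rfl⟩ := QuotientGroup.mk_surjective b
      have := (hPmem y).2 hb
      rw [hPU] at this
      exact (QuotientGroup.eq_one_iff _).2 this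
    · right
      rw [eq_top_iff]
      intro b _
      obtain ⟨y, rfl⟩ := QuotientGroup.mk_surjective b
      refine (hPmem y).1 ?_
      rw [heq]; exact y.2

/-- A family of maximal subgroups whose quotients are independent. -/
def IsIndependentFamily (Γ : Type*) [Group Γ] [MulDistribMulAction Γ F] (N : Subgroup F)
    (I : Set (Subgroup F)) : Prop :=
  (∀ U ∈ I, IsMaximalProper Γ N U) ∧ ∀ J : Finset (Subgroup F), (J : Set (Subgroup F)) ⊆ I →
    ∀ t : Subgroup F → F, (∀ U, t U ∈ N) → ∃ x ∈ N, ∀ U ∈ J, (t U)⁻¹ * x ∈ U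

omit [IsTopologicalGroup F] [CompactSpace F] [T2Space F] [TotallyDisconnectedSpace F] [Finite Γ]
  [ContinuousConstSMul Γ F] in
-- Independence is a condition on finite subfamilies, so it passes to unions of chains.
theorem exists_maximal_independentFamily (N : Subgroup F) :
    ∃ I, Maximal (· ∈ {I | IsIndependentFamily Γ N I}) I := by
  refine zorn_subset _ fun c hc hchain => ?_
  rcases c.eq_empty_or_nonempty with rfl | hne
  · refine ⟨∅, ⟨by simp, fun J hJ t ht => ⟨1, N.one_mem, fun U hU => ?_⟩⟩, by simp⟩
    exact absurd (hJ hU) (Set.notMem_empty U)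
  · refine ⟨⋃ i ∈ c, i, ⟨fun U hU => ?_, fun J hJ => ?_⟩, fun s hs => Set.subset_biUnion_of_mem (u := id) hs⟩
    · obtain ⟨i, hi, hUi⟩ := Set.mem_iUnion₂.1 hU
      exact (hc hi).1 U hUi
    · obtain ⟨i, hi, hJi⟩ := DirectedOn.exists_mem_subset_of_finset_subset_biUnion
        (f := fun i : Set (Subgroup F) => i) hne hchain.directedOn hJ
      exact (hc hi).2 J hJi

omit [TotallyDisconnectedSpace F] [Finite Γ] [ContinuousConstSMul Γ F] in
-- The congruences define closed subsets of the compact group `N`, and solvability of any finite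
-- number of them suffices.
theorem exists_mem_of_independentFamily {N : Subgroup F} (hN : IsClosedNormal Γ N)
    {I : Set (Subgroup F)} (hI : IsIndependentFamily Γ N I) (t : Subgroup F → F)
    (ht : ∀ U, t U ∈ N) : ∃ x ∈ N, ∀ U ∈ I, (t U)⁻¹ * x ∈ U := by
  have := hN.1.isCompact.inter_iInter_nonempty (ι := I) (fun U => {x | (t U)⁻¹ * x ∈ U.1})
    (fun U => (hI.1 U U.2).1.1.1.preimage (continuous_const_mul _)) fun u => by
      classical
      obtain ⟨x, hxN, hx⟩ := hI.2 (u.image Subtype.val) (by simp) t ht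
      refine ⟨x, hxN, Set.mem_iInter₂.2 fun U hU => hx U ?_⟩
      exact Finset.mem_image_of_mem _ hU
  obtain ⟨x, hxN, hx⟩ := this
  exact ⟨x, hxN, fun U hU => Set.mem_iInter.1 hx ⟨U, hU⟩⟩

omit [TotallyDisconnectedSpace F] [Finite Γ] [ContinuousConstSMul Γ F] in
-- If `x` lies in every member of the family but not in `U`, then for each finite subfamily its
-- intersection `K` with `N` is not contained in `U`, so `K ⊔ U = N`. A solution of the finitely
-- many congruences can then be corrected by an element of `K` to satisfy the one at `U`, and `U`
-- could be adjoined to the family.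
theorem mem_of_maximal_independentFamily {N : Subgroup F} (hN : IsClosedNormal Γ N)
    {I : Set (Subgroup F)} (hI : Maximal (· ∈ {I | IsIndependentFamily Γ N I}) I) {x : F}
    (hxN : x ∈ N) (hx : ∀ U ∈ I, x ∈ U) {U : Subgroup F} (hU : IsMaximalProper Γ N U) : x ∈ U := by
  classical
  by_contra hxU
  have hins : IsIndependentFamily Γ N (insert U I) := by
    refine ⟨?_, fun J hJ t ht => ?_⟩
    · rintro U' (rfl | hU')
      · exact hU
      · exact hI.1.1 _ hU'
    · have hJ' : ((J.erase U : Finset (Subgroup F)) : Set (Subgroup F)) ⊆ I := by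
        intro U' hU'
        rw [Finset.mem_coe, Finset.mem_erase] at hU'
        exact (hJ hU'.2).resolve_left hU'.1
      obtain ⟨x₀, hx₀N, hx₀⟩ := hI.1.2 _ hJ' t ht
      set K := N ⊓ sInf ((J.erase U : Finset (Subgroup F)) : Set (Subgroup F))
      have hK : IsClosedNormal Γ K :=
        hN.inf (isClosedNormal_sInf fun U' hU' => (hI.1.1 U' (hJ' hU')).1.1)
      have hxK : x ∈ K := ⟨hxN, Subgroup.mem_sInf.2 fun U' hU' => hx U' (hJ' hU')⟩
      have hsup := hU.sup_eq hK inf_le_left fun h => hxU (h hxK)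
      have hmem : x₀⁻¹ * t U ∈ K ⊔ U := by
        rw [hsup]; exact N.mul_mem (N.inv_mem hx₀N) (ht U)
      have := hU.1.1.2.1
      obtain ⟨k, hk, y, hy, hky⟩ := Subgroup.mem_sup_of_normal_right.1 hmem
      refine ⟨x₀ * k, N.mul_mem hx₀N hk.1, fun U' hU' => ?_⟩
      by_cases h : U' = U
      · subst h
        have : (t U')⁻¹ * (x₀ * k) = y⁻¹ := by
          have h2 : (t U')⁻¹ * x₀ = (k * y)⁻¹ := by rw [hky]; group
          rw [← mul_assoc, h2]; group
        rw [this]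
        exact Subgroup.inv_mem _ hy
      · have hmem' : U' ∈ J.erase U := Finset.mem_erase.2 ⟨h, hU'⟩
        rw [← mul_assoc]
        exact U'.mul_mem (hx₀ U' hmem') (Subgroup.mem_sInf.1 hk.2 U' hmem')
  have : U ∈ I := hI.2 hins (Set.subset_insert U I) (Set.mem_insert U I)
  exact hxU (hx U this)

/-- The factors are the quotients `N / U` for `U` in a maximal independent family: independence
gives surjectivity onto the product, and maximality shows that the kernel is the full intersection.
-/
theorem nonempty_irreducibleDecomposition {N : Subgroup F} (hN : IsClosedNormal Γ N) :
    Nonempty (IrreducibleDecomposition Γ N) := by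
  obtain ⟨I, hI⟩ := exists_maximal_independentFamily (Γ := Γ) N
  have hmax : ∀ U : I, IsMaximalProper Γ N U.1 := fun U => hI.1.1 U.1 U.2
  have hnor : ∀ U : I, (U.1.subgroupOf N).Normal := fun U => (hmax U).1.1.2.1.subgroupOf N
  refine ⟨{
    ι := I
    B := fun U => N ⧸ U.1.subgroupOf N
    finite := fun U => (hmax U).finite_quotient hN
    act := fun U => quotientAct hN (hmax U).1.1
    irreducible := fun U => (hmax U).irreducible hN
    proj := Pi.monoidHom fun U => QuotientGroup.mk' _
    continuous_proj := fun U => (hmax U).isLocallyConstant_mk hN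
    surjective_proj := ?_
    ker_proj := ?_
    equivariant := ?_ }⟩
  · intro p
    classical
    choose s hs using fun U : I => QuotientGroup.mk_surjective (p U)
    obtain ⟨x, hxN, hx⟩ := exists_mem_of_independentFamily hN hI.1
      (fun U => if h : U ∈ I then (s ⟨U, h⟩ : F) else 1) fun U => by
        split_ifs
        · exact (s _).2
        · exact N.one_mem
    refine ⟨⟨x, hxN⟩, funext fun U => ?_⟩
    have := hx U U.2
    rw [dif_pos U.2] at this
    rw [← hs U]
    refine Eq.symm ((QuotientGroup.eq).2 ?_)
    exact this
  · intro x
    constructor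
    · intro h
      refine ⟨x.2, Subgroup.mem_sInf.2 fun U hU =>
        mem_of_maximal_independentFamily hN hI x.2 (fun U' hU' => ?_) hU⟩
      exact (QuotientGroup.eq_one_iff x).1 (congrFun h ⟨U', hU'⟩)
    · intro h
      ext U
      exact (QuotientGroup.eq_one_iff x).2 (Subgroup.mem_sInf.1 h.2 U.1 (hmax U))
  · intro h y z hz U
    have : z = hN.opEnd h y := Subtype.ext hz
    rw [this]
    rfl

end Maximal

/-! ### Equivariant homomorphisms to irreducible groups -/

section ToIrreducible

variable {F : Type v} [Group F] [TopologicalSpace F] [IsTopologicalGroup F] [CompactSpace F]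
  [T2Space F] {Γ : Type u} [Group Γ] [MulDistribMulAction Γ F]
  {N : Subgroup F} (hN : IsClosedNormal Γ N)
  {C : Type w} [Group C] {σ : SemiProd F Γ →* MulAut C}

/-- Continuous equivariant homomorphisms from a normal subgroup to a discrete group with
operators. -/
def IsEquivariantHom (σ : SemiProd F Γ →* MulAut C) (ψ : N →* C) : Prop :=
  IsLocallyConstant ψ ∧ ∀ (h : SemiProd F Γ) (y z : N), (z : F) = opAct h (y : F) →
    ψ z = σ h (ψ y)

include hN in
theorem isClosedNormal_map_ker {ψ : N →* C} (hψ : IsEquivariantHom σ ψ) :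
    IsClosedNormal Γ (ψ.ker.map N.subtype) := by
  refine isClosedNormal_of_opAct ?_ fun h y hy => ?_
  · refine hN.1.isClosedEmbedding_subtypeVal.isClosedMap _ ?_
    exact hψ.1.isClosed_fiber 1
  · obtain ⟨y, hy, rfl⟩ := hy
    refine ⟨hN.opEnd h y, ?_, rfl⟩
    change ψ _ = 1
    rw [hψ.2 h y _ rfl, show ψ y = 1 from hy, map_one]

theorem mem_map_ker {ψ : N →* C} (x : N) : (x : F) ∈ ψ.ker.map N.subtype ↔ ψ x = 1 := by
  constructor
  · rintro ⟨y, hy, h⟩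
    rw [← Subtype.ext h]; exact hy
  · intro h; exact ⟨x, h, rfl⟩

include hN in
/-- The kernel of a nontrivial homomorphism to an irreducible group is a maximal proper
normal subgroup. -/
theorem isMaximalProper_map_ker (hσ : IsIrreducibleGroup σ) {ψ : N →* C}
    (hψ : IsEquivariantHom σ ψ) (hne : ψ ≠ 1) : IsMaximalProper Γ N (ψ.ker.map N.subtype) := by
  have hle : ψ.ker.map N.subtype ≤ N := by
    rintro _ ⟨y, -, rfl⟩; exact y.2
  refine ⟨⟨isClosedNormal_map_ker hN hψ, lt_of_le_of_ne hle fun h => hne ?_⟩, fun V hV hVle hVN => ?_⟩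
  · ext x
    exact (mem_map_ker x).1 (by rw [h]; exact x.2)
  · rcases hσ.2 ((V.subgroupOf N).map ψ) (by
      rintro h _ ⟨y, hy, rfl⟩
      exact ⟨hN.opEnd h y, hV.opAct_mem h hy, hψ.2 h y _ rfl⟩) with h | h
    · refine le_antisymm (fun x hx => ?_) hVle
      have : ψ ⟨x, hVN.le hx⟩ ∈ (V.subgroupOf N).map ψ := ⟨_, hx, rfl⟩
      rw [h] at this
      exact (mem_map_ker ⟨x, hVN.le hx⟩).2 this
    · refine absurd (le_antisymm hVN.le fun x hx => ?_) hVN.ne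
      have : ψ ⟨x, hx⟩ ∈ (V.subgroupOf N).map ψ := by rw [h]; trivial
      obtain ⟨y, hy, hyx⟩ := this
      have h1 : ((y⁻¹ * ⟨x, hx⟩ : N) : F) ∈ V := hVle ((mem_map_ker _).2 (by
        rw [map_mul, map_inv, hyx, inv_mul_cancel]))
      have h2 := V.mul_mem (show (y : F) ∈ V from hy) h1
      simpa using h2

include hN in
theorem map_eq_one_of_mem_maximalIntersection (hσ : IsIrreducibleGroup σ) {ψ : N →* C}
    (hψ : IsEquivariantHom σ ψ) (x : N) (hx : (x : F) ∈ maximalIntersection Γ N) : ψ x = 1 := by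
  by_cases hne : ψ = 1
  · rw [hne]; rfl
  · exact (mem_map_ker x).1 (Subgroup.mem_sInf.1 hx.2 _ (isMaximalProper_map_ker hN hσ hψ hne))

variable (D : IrreducibleDecomposition Γ N)

include hN in
-- The set where `ψ ≠ 1` is compact and is covered by the open sets where some coordinate is
-- nontrivial, because `ψ` kills the intersection of the maximal subgroups.
theorem exists_finite_support (hσ : IsIrreducibleGroup σ) {ψ : N →* C}
    (hψ : IsEquivariantHom σ ψ) :
    ∃ J : Finset D.ι, ∀ x, (∀ j ∈ J, D.proj x j = 1) → ψ x = 1 := by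
  have hcN : CompactSpace N := isCompact_iff_compactSpace.1 hN.1.isCompact
  have hK : IsCompact {x : N | ψ x ≠ 1} := by
    refine IsClosed.isCompact ?_
    rw [← isOpen_compl_iff]
    exact hψ.1 {c | c ≠ 1}ᶜ
  obtain ⟨J, hJ⟩ := hK.elim_finite_subfamily_closed (fun i : D.ι => {x : N | D.proj x i = 1})
    (fun i => (D.continuous_proj i).isClosed_fiber 1) (by
      rw [Set.eq_empty_iff_forall_notMem]
      rintro x ⟨hx, hx'⟩
      refine hx (map_eq_one_of_mem_maximalIntersection hN hσ hψ x ((D.ker_proj x).1 ?_))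
      ext i
      exact Set.mem_iInter.1 hx' i)
  refine ⟨J, fun x hx => ?_⟩
  by_contra h
  have : x ∈ ({x : N | ψ x ≠ 1} ∩ ⋂ i ∈ J, {x : N | D.proj x i = 1} : Set N) :=
    ⟨h, Set.mem_iInter₂.2 hx⟩
  rw [hJ] at this
  exact this

include hN in
theorem map_eq_of_proj_eq (hσ : IsIrreducibleGroup σ) {ψ : N →* C}
    (hψ : IsEquivariantHom σ ψ) {x y : N} (h : D.proj x = D.proj y) : ψ x = ψ y := by
  have h1 : D.proj (x * y⁻¹) = 1 := by rw [map_mul, map_inv, h, mul_inv_cancel]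
  have := map_eq_one_of_mem_maximalIntersection hN hσ hψ _ ((D.ker_proj _).1 h1)
  rwa [map_mul, map_inv, mul_inv_eq_one] at this

include hN in
open Classical in
/-- The components of an equivariant homomorphism with respect to a decomposition. -/
theorem exists_component (hσ : IsIrreducibleGroup σ) {ψ : N →* C}
    (hψ : IsEquivariantHom σ ψ) (i : D.ι) :
    ∃ θ : D.B i →* C, (∀ x b, D.proj x = Pi.mulSingle i b → ψ x = θ b) ∧
      ∀ h b, θ (D.act i h b) = σ h (θ b) := by
  choose s hs using fun b : D.B i => D.surjective_proj (Pi.mulSingle i b)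
  have key : ∀ x b, D.proj x = Pi.mulSingle i b → ψ x = ψ (s b) := fun x b hx =>
    map_eq_of_proj_eq hN D hσ hψ (hx.trans (hs b).symm)
  refine ⟨⟨⟨fun b => ψ (s b), ?_⟩, fun b b' => ?_⟩, key, fun h b => ?_⟩
  · rw [← key 1 1 (by rw [map_one, Pi.mulSingle_one]), map_one]
  · change ψ (s (b * b')) = ψ (s b) * ψ (s b')
    rw [← map_mul]
    refine (key _ _ ?_).symm
    rw [map_mul, hs, hs, Pi.mulSingle_mul]
  · change ψ (s (D.act i h b)) = σ h (ψ (s b))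
    rw [← hψ.2 h (s b) (hN.opEnd h (s b)) rfl]
    refine (key _ _ ?_).symm
    ext j
    rw [D.equivariant h (s b) _ rfl j, hs]
    by_cases hj : j = i
    · subst hj; simp
    · simp [hj]

/-- Schur's lemma: the kernel and the range are stable subgroups. -/
theorem trivial_or_bijective {H B C : Type*} [Group H] [Group B] [Group C] {α : H →* MulAut B}
    {β : H →* MulAut C} (hα : IsIrreducibleGroup α) (hβ : IsIrreducibleGroup β) (θ : B →* C)
    (hθ : ∀ h b, θ (α h b) = β h (θ b)) : θ = 1 ∨ Function.Bijective θ := by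
  rcases hα.2 θ.ker (fun h b hb => by
    rw [MonoidHom.mem_ker] at hb ⊢
    rw [hθ, hb, map_one]) with h | h
  · rcases hβ.2 θ.range (by
      rintro h _ ⟨b, rfl⟩
      exact ⟨α h b, hθ h b⟩) with h' | h'
    · left
      ext b
      have : θ b ∈ θ.range := ⟨b, rfl⟩
      rw [h'] at this
      exact this
    · right
      exact ⟨(MonoidHom.ker_eq_bot_iff θ).1 h, MonoidHom.range_eq_top.1 h'⟩
  · left
    ext b
    have : b ∈ θ.ker := by rw [h]; trivial
    exact this

section Components

variable (hσ : IsIrreducibleGroup σ) {ψ : N →* C} (hψ : IsEquivariantHom σ ψ)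

/-- A chosen component. -/
noncomputable def component (hN : IsClosedNormal Γ N) (D : IrreducibleDecomposition Γ N)
    (hσ : IsIrreducibleGroup σ) {ψ : N →* C} (hψ : IsEquivariantHom σ ψ) (i : D.ι) : D.B i →* C :=
  (exists_component hN D hσ hψ i).choose

open Classical in
theorem component_spec (i : D.ι) {x : N} {b : D.B i} (h : D.proj x = Pi.mulSingle i b) :
    ψ x = component hN D hσ hψ i b :=
  (exists_component hN D hσ hψ i).choose_spec.1 x b h

theorem component_equivariant (i : D.ι) (h : SemiProd F Γ) (b : D.B i) :
    component hN D hσ hψ i (D.act i h b) = σ h (component hN D hσ hψ i b) :=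
  (exists_component hN D hσ hψ i).choose_spec.2 h b

/-- The product of the components of `x` in a finite set of indices is realised by an element
of `N` truncating `x`. -/
theorem exists_truncation (x : N) (J : Finset D.ι) :
    ∃ y : N, (∀ j ∈ J, D.proj y j = D.proj x j) ∧ ∀ j ∉ J, D.proj y j = 1 := by
  classical
  obtain ⟨y, hy⟩ := D.surjective_proj (fun j => if j ∈ J then D.proj x j else 1)
  exact ⟨y, fun j hj => by rw [hy]; exact if_pos hj, fun j hj => by rw [hy]; exact if_neg hj⟩

theorem map_truncation_insert [DecidableEq D.ι] (x : N) {i : D.ι} {J : Finset D.ι} (hi : i ∉ J)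
    {y y' : N} (hy : (∀ j ∈ J, D.proj y j = D.proj x j) ∧ ∀ j ∉ J, D.proj y j = 1)
    (hy' : (∀ j ∈ insert i J, D.proj y' j = D.proj x j) ∧ ∀ j ∉ insert i J, D.proj y' j = 1) :
    ψ y' = component hN D hσ hψ i (D.proj x i) * ψ y := by
  have h : ψ (y' * y⁻¹) = component hN D hσ hψ i (D.proj x i) := by
    refine component_spec hN D hσ hψ i ?_
    ext j
    rw [map_mul, map_inv, Pi.mul_apply, Pi.inv_apply]
    by_cases hj : j = i
    · subst hj
      rw [hy'.1 j (Finset.mem_insert_self _ _), hy.2 j hi]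
      simp
    · by_cases hjJ : j ∈ J
      · rw [hy'.1 j (Finset.mem_insert_of_mem hjJ), hy.1 j hjJ]
        simp [hj]
      · rw [hy'.2 j (by simp [hj, hjJ]), hy.2 j hjJ]
        simp [hj]
  rw [← h, map_mul, map_inv, inv_mul_cancel_right]

theorem map_eq_of_truncation {J : Finset D.ι}
    (hJ : ∀ x, (∀ j ∈ J, D.proj x j = 1) → ψ x = 1) {x y : N}
    (hy : ∀ j ∈ J, D.proj y j = D.proj x j) : ψ x = ψ y := by
  have := hJ (x * y⁻¹) fun j hj => by
    rw [map_mul, map_inv, Pi.mul_apply, Pi.inv_apply, hy j hj, mul_inv_cancel]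
  rwa [map_mul, map_inv, mul_inv_eq_one] at this

include hN hσ hψ in
theorem map_eq_one_of_support_empty {y : N} (hy : ∀ j, D.proj y j = 1) : ψ y = 1 := by
  rw [← map_one ψ]
  refine map_eq_of_proj_eq hN D hσ hψ ?_
  rw [map_one]
  exact funext hy

theorem eq_one_of_component_eq_one (h : ∀ i, component hN D hσ hψ i = 1) : ψ = 1 := by
  classical
  obtain ⟨J, hJ⟩ := exists_finite_support hN D hσ hψ
  have key : ∀ (J : Finset D.ι) (x y : N), (∀ j ∈ J, D.proj y j = D.proj x j) →
      (∀ j ∉ J, D.proj y j = 1) → ψ y = 1 := by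
    intro J x
    induction J using Finset.induction_on with
    | empty => exact fun y _ hy => map_eq_one_of_support_empty hN D hσ hψ fun j => hy j (by simp)
    | insert i J hi ih =>
      intro y' h1 h2
      obtain ⟨y, hy⟩ := exists_truncation D x J
      rw [map_truncation_insert hN D hσ hψ x hi hy ⟨h1, h2⟩, ih y hy.1 hy.2, h i]
      simp
  ext x
  obtain ⟨y, hy⟩ := exists_truncation D x J
  rw [map_eq_of_truncation D hJ hy.1]
  exact key J x y hy.1 hy.2

/-- If `C` is not commutative then an equivariant homomorphism to `C` with a nontrivial
component factors through this component. -/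
theorem map_eq_component_of_noncomm (hC : ¬ ∀ a b : C, a * b = b * a) (i : D.ι)
    (hi : component hN D hσ hψ i ≠ 1) (x : N) :
    ψ x = component hN D hσ hψ i (D.proj x i) := by
  classical
  have hbij := (trivial_or_bijective (D.irreducible i) hσ _
    (component_equivariant hN D hσ hψ i)).resolve_left hi
  obtain ⟨y, hy⟩ := D.surjective_proj (Pi.mulSingle i (D.proj x i))
  have hψy := component_spec hN D hσ hψ i hy
  -- The element `x * y⁻¹` has trivial coordinate at `i`, so modulo the kernel of `D.proj` it
  -- commutes with the `i`-th factor, and this factor maps onto `C`.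
  have hcen : ψ (x * y⁻¹) ∈ Subgroup.center C := by
    rw [Subgroup.mem_center_iff]
    intro c
    obtain ⟨b, rfl⟩ := hbij.2 c
    obtain ⟨t, ht⟩ := D.surjective_proj (Pi.mulSingle i b)
    rw [← component_spec hN D hσ hψ i ht, ← map_mul, ← map_mul]
    refine map_eq_of_proj_eq hN D hσ hψ ?_
    have hone : D.proj (x * y⁻¹) i = 1 := by
      rw [map_mul, map_inv, Pi.mul_apply, Pi.inv_apply, hy, Pi.mulSingle_eq_same, mul_inv_cancel]
    ext j
    rw [map_mul D.proj t, map_mul D.proj _ t, Pi.mul_apply, Pi.mul_apply]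
    by_cases hj : j = i
    · subst hj
      rw [hone, mul_one, one_mul]
    · rw [ht, Pi.mulSingle_eq_of_ne hj, mul_one, one_mul]
  -- The centre is a stable subgroup, and it is not all of `C`.
  have hbot : Subgroup.center C = ⊥ := by
    refine (hσ.2 (Subgroup.center C) fun h c hc => ?_).resolve_right fun htop => hC fun a b => ?_
    · rw [Subgroup.mem_center_iff] at hc ⊢
      intro g
      obtain ⟨g, rfl⟩ := (σ h).surjective g
      rw [← map_mul, ← map_mul, hc]
    · have : b ∈ Subgroup.center C := by rw [htop]; trivial
      exact Subgroup.mem_center_iff.1 this a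
  rw [hbot, Subgroup.mem_bot, map_mul, map_inv, mul_inv_eq_one] at hcen
  rw [hcen, hψy]

end Components

theorem map_eq_prod_component {C : Type w} [CommGroup C] {σ : SemiProd F Γ →* MulAut C}
    (hσ : IsIrreducibleGroup σ) {ψ : N →* C} (hψ : IsEquivariantHom σ ψ) :
    ∃ J : Finset D.ι, ∀ x, ψ x = ∏ i ∈ J, component hN D hσ hψ i (D.proj x i) := by
  classical
  obtain ⟨J, hJ⟩ := exists_finite_support hN D hσ hψ
  refine ⟨J, fun x => ?_⟩
  have key : ∀ (J : Finset D.ι) (y : N), (∀ j ∈ J, D.proj y j = D.proj x j) →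
      (∀ j ∉ J, D.proj y j = 1) → ψ y = ∏ i ∈ J, component hN D hσ hψ i (D.proj x i) := by
    intro J
    induction J using Finset.induction_on with
    | empty => exact fun y _ hy => map_eq_one_of_support_empty hN D hσ hψ fun j => hy j (by simp)
    | insert i J hi ih =>
      intro y' h1 h2
      obtain ⟨y, hy⟩ := exists_truncation D x J
      rw [map_truncation_insert hN D hσ hψ x hi hy ⟨h1, h2⟩, ih y hy.1 hy.2,
        Finset.prod_insert hi]
  obtain ⟨y, hy⟩ := exists_truncation D x J
  rw [map_eq_of_truncation D hJ hy.1]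
  exact key J y hy.1 hy.2

end ToIrreducible

/-! ### Multiplicities and equivariant homomorphisms -/

section Multiplicity

variable {ℓ : ℕ} [Fact ℓ.Prime] {V : Type w} [AddCommGroup V] [Module (ZMod ℓ) V]

/-- Over a prime field every additive subgroup is a subspace, so forgetting scalars adds no stable
subgroups. -/
theorem isIrreducibleGroup_moduleAut {H : Type*} [Group H] (τ : Representation (ZMod ℓ) H V)
    [hτ : τ.IsIrreducible] : IsIrreducibleGroup (moduleAut τ) := by
  constructor
  · rw [← not_subsingleton_iff_nontrivial]
    intro h
    have hV : Subsingleton V := h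
    refine bot_ne_top (α := Subrepresentation τ) ?_
    apply Subrepresentation.toSubmodule_injective
    exact Subsingleton.elim _ _
  · intro S hS
    let W : Subrepresentation τ :=
      { toSubmodule := AddSubgroup.toZModSubmodule ℓ
          { carrier := {a | Multiplicative.ofAdd a ∈ S}
            zero_mem' := S.one_mem
            add_mem' := fun ha hb => S.mul_mem ha hb
            neg_mem' := fun ha => S.inv_mem ha }
        apply_mem_toSubmodule := fun h a ha => hS h (Multiplicative.ofAdd a) ha }
    have hW : ∀ a, a ∈ W.toSubmodule ↔ Multiplicative.ofAdd a ∈ S := fun a => Iff.rfl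
    rcases eq_bot_or_eq_top W with h | h
    · left
      rw [eq_bot_iff]
      intro a ha
      have : a.toAdd ∈ W.toSubmodule := ha
      rw [h] at this
      exact this
    · right
      rw [eq_top_iff]
      intro a _
      refine (hW a.toAdd).1 ?_
      rw [h]
      trivial

variable {F : Type v} [Group F] [TopologicalSpace F] [IsTopologicalGroup F] [CompactSpace F]
  [T2Space F] {Γ : Type u} [Group Γ] [MulDistribMulAction Γ F]
  {N : Subgroup F} (hN : IsClosedNormal Γ N) (τ : Representation (ZMod ℓ) (SemiProd F Γ) V)

/-- The multiplicative form of an equivariant additive map. -/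
def eqHomToHom (f : eqHom N τ) : N →* Multiplicative V where
  toFun x := Multiplicative.ofAdd (f.1 x)
  map_one' := by
    have := f.2.2.1 1 1
    rw [mul_one, left_eq_add] at this
    rw [this]; rfl
  map_mul' x y := by rw [f.2.2.1]; rfl

theorem isEquivariantHom_eqHomToHom (f : eqHom N τ) :
    IsEquivariantHom (moduleAut τ) (eqHomToHom τ f) :=
  ⟨f.2.1.comp Multiplicative.ofAdd, fun h y z hz => by
    change Multiplicative.ofAdd (f.1 z) = Multiplicative.ofAdd (τ h (f.1 y))
    rw [f.2.2.2 h y z hz]⟩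

variable {τ} in
/-- The additive form of an equivariant homomorphism. -/
def eqHomOfHom {ψ : N →* Multiplicative V} (hψ : IsEquivariantHom (moduleAut τ) ψ) : eqHom N τ :=
  ⟨fun x => (ψ x).toAdd, hψ.1.comp Multiplicative.toAdd,
    fun x y => congrArg Multiplicative.toAdd (map_mul ψ x y),
    fun h y z hz => congrArg Multiplicative.toAdd (hψ.2 h y z hz)⟩

variable (D : IrreducibleDecomposition Γ N)

/-- Homomorphisms factoring through a factor of the decomposition isomorphic to the module. -/
noncomputable def homOfFactor (i : D.ι) (e : D.B i ≃* Multiplicative V)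
    (he : ∀ h b, e (D.act i h b) = moduleAut τ h (e b)) :
    Representation.IntertwiningMap τ τ →ₗ[ZMod ℓ] eqHom N τ where
  toFun ψ := ⟨fun x => ψ (e (D.proj x i)).toAdd, by
    refine ⟨(D.continuous_proj i).comp (fun b => ψ (e b).toAdd), fun x y => ?_,
      fun h y z hz => ?_⟩
    · beta_reduce
      rw [map_mul, Pi.mul_apply, map_mul, toAdd_mul, map_add]
    · beta_reduce
      rw [D.equivariant h y z hz, he]
      exact Representation.IntertwiningMap.isIntertwining _ _ ψ h _⟩
  map_add' _ _ := rfl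
  map_smul' _ _ := rfl

include hN in
/-- The multiplicity of a simple module in a decomposition, in terms of equivariant
homomorphisms to the module. -/
theorem count_mul_dimN [hτ : τ.IsIrreducible] :
    D.count (moduleAut τ) * dimN (ZMod ℓ) (Representation.IntertwiningMap τ τ) =
      dimN (ZMod ℓ) (eqHom N τ) := by
  classical
  set I := {i : D.ι | IsoGroups (D.act i) (moduleAut τ)} with hI
  have hσ := isIrreducibleGroup_moduleAut τ
  choose e he using fun i : I => show IsoGroups (D.act i.1) (moduleAut τ) from i.2
  -- A finitely supported family of endomorphisms is sent to the sum of its composites with the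
  -- projections to the factors. Elements concentrated in one factor show injectivity; for
  -- surjectivity, a homomorphism is a finite sum of components, and a nonzero component is an
  -- isomorphism, hence an endomorphism composed with the chosen `e i`.
  let Φ : (I →₀ Representation.IntertwiningMap τ τ) →ₗ[ZMod ℓ] eqHom N τ :=
    Finsupp.lsum (ZMod ℓ)
    fun i : I => homOfFactor τ D i.1 (e i) (he i)
  have hcount : D.count (moduleAut τ) = ENat.card I := rfl
  rw [hcount, ← dimN_finsupp]
  refine dimN_congr (LinearEquiv.ofBijective Φ ⟨?_, fun f => ?_⟩)
  · rw [injective_iff_map_eq_zero]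
    intro s hs
    ext i v
    obtain ⟨x, hx⟩ := D.surjective_proj
      (Pi.mulSingle i.1 ((e i).symm (Multiplicative.ofAdd v)))
    have h := congrFun (congrArg Subtype.val hs) x
    have h1 : (Φ s).1 x = s i v := by
      simp only [Φ, Finsupp.lsum_apply, Finsupp.sum]
      rw [AddSubmonoidClass.coe_finsetSum, Finset.sum_apply, Finset.sum_eq_single i]
      · change s i (e i (D.proj x i)).toAdd = _
        rw [hx, Pi.mulSingle_eq_same, MulEquiv.apply_symm_apply]
        rfl
      · intro j _ hj
        change s j (e j (D.proj x j)).toAdd = _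
        rw [hx, Pi.mulSingle_eq_of_ne (fun h => hj (Subtype.ext h)), map_one]
        exact map_zero (s j)
      · intro hi
        rw [Finsupp.notMem_support_iff.1 hi, map_zero]
        rfl
    exact h1.symm.trans h
  · rw [← LinearMap.mem_range]
    have hψ := isEquivariantHom_eqHomToHom τ f
    obtain ⟨J, hJ⟩ := map_eq_prod_component hN D hσ hψ
    have hcomp : ∀ i : D.ι, ∃ g ∈ LinearMap.range Φ, ∀ x, g.1 x =
        (component hN D hσ hψ i (D.proj x i)).toAdd := by
      intro i
      rcases trivial_or_bijective (D.irreducible i) hσ _ (component_equivariant hN D hσ hψ i)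
        with h1 | hbij
      · exact ⟨0, Submodule.zero_mem _, fun x => by rw [h1]; rfl⟩
      · let e₀ := MulEquiv.ofBijective _ hbij
        have hi : i ∈ I := ⟨e₀, component_equivariant hN D hσ hψ i⟩
        let e' := e ⟨i, hi⟩
        have he' := he ⟨i, hi⟩
        let a : V →+ V := MonoidHom.toAdditive
          ((component hN D hσ hψ i).comp e'.symm.toMonoidHom)
        have ha : ∀ v, a v = (component hN D hσ hψ i
          (e'.symm (Multiplicative.ofAdd v))).toAdd := fun v => rfl
        let s : Representation.IntertwiningMap τ τ :=
          (a.toZModLinearMap ℓ).intertwiningMap_of_isIntertwiningMap τ τ (fun h v => by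
            change a (τ h v) = τ h (a v)
            have h2 : e'.symm (Multiplicative.ofAdd (τ h v)) =
                D.act i h (e'.symm (Multiplicative.ofAdd v)) := by
              apply e'.injective
              rw [he', MulEquiv.apply_symm_apply, MulEquiv.apply_symm_apply]
              rfl
            rw [ha, h2, component_equivariant]
            rfl)
        refine ⟨Φ (Finsupp.single ⟨i, hi⟩ s), ⟨_, rfl⟩, fun x => ?_⟩
        simp only [Φ, Finsupp.lsum_single]
        change a (e' (D.proj x i)).toAdd = _
        rw [ha]
        change (component hN D hσ hψ i (e'.symm (e' (D.proj x i)))).toAdd = _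
        rw [MulEquiv.symm_apply_apply]
    choose g hg hgx using hcomp
    have : f = ∑ i ∈ J, g i := by
      ext x
      rw [AddSubmonoidClass.coe_finsetSum, Finset.sum_apply]
      simp only [hgx]
      have := congrArg Multiplicative.toAdd (hJ x)
      rw [toAdd_prod] at this
      exact this
    rw [this]
    exact Submodule.sum_mem _ fun i _ => hg i

end Multiplicity

/-! ### Pro-`m'` groups and pro-`m'` completions -/

section ProPrime

open Topology

variable {F : Type*} [Group F] [TopologicalSpace F] [IsTopologicalGroup F]

theorem isClosed_proPrimeKernel (m : ℕ) : IsClosed (proPrimeKernel m F : Set F) := by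
  rw [proPrimeKernel, Subgroup.coe_sInf]
  exact isClosed_biInter fun V hV => V.isClosed_of_isOpen hV.2.1

/-- Cosets of an open normal subgroup containing the kernel are clopen and saturated, so their
images separate points. -/
theorem ProPrimeCompletion.totallySeparatedSpace (m : ℕ) :
    TotallySeparatedSpace (ProPrimeCompletion m F) := by
  rw [totallySeparatedSpace_iff_exists_isClopen]
  intro a b hab
  obtain ⟨x, rfl⟩ := QuotientGroup.mk_surjective a
  obtain ⟨y, rfl⟩ := QuotientGroup.mk_surjective b
  rw [Ne, QuotientGroup.eq, proPrimeKernel, Subgroup.mem_sInf] at hab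
  push Not at hab
  obtain ⟨V, hV, hxy⟩ := hab
  have hle : proPrimeKernel m F ≤ V := sInf_le hV
  have hpre : (QuotientGroup.mk : F → ProPrimeCompletion m F) ⁻¹'
      ((QuotientGroup.mk : F → ProPrimeCompletion m F) '' {z | x⁻¹ * z ∈ V}) =
        {z | x⁻¹ * z ∈ V} := by
    refine Set.Subset.antisymm ?_ (Set.subset_preimage_image _ _)
    rintro z ⟨t, ht, htz⟩
    have h := hle (QuotientGroup.eq.1 htz)
    have := V.mul_mem ht h
    rwa [← mul_assoc, mul_assoc x⁻¹, mul_inv_cancel, mul_one] at this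
  refine ⟨(QuotientGroup.mk : F → ProPrimeCompletion m F) '' {z | x⁻¹ * z ∈ V}, ?_,
    ⟨x, by simp [V.one_mem], rfl⟩, fun h => ?_⟩
  · rw [← (QuotientGroup.isQuotientMap_mk (proPrimeKernel m F)).isClopen_preimage, hpre]
    exact ⟨(V.isClosed_of_isOpen hV.2.1).preimage (continuous_const_mul _),
      hV.2.1.preimage (continuous_const_mul _)⟩
  · have : y ∈ {z | x⁻¹ * z ∈ V} := by rw [← hpre]; exact h
    exact hxy this

instance (m : ℕ) : TotallyDisconnectedSpace (ProPrimeCompletion m F) :=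
  have := ProPrimeCompletion.totallySeparatedSpace (F := F) m
  inferInstance

instance (m : ℕ) : T2Space (ProPrimeCompletion m F) :=
  have := ProPrimeCompletion.totallySeparatedSpace (F := F) m
  inferInstance

theorem ProPrimeCompletion.continuous_mk (m : ℕ) :
    Continuous (QuotientGroup.mk' (proPrimeKernel m F)) := QuotientGroup.continuous_mk

instance (m : ℕ) {Γ : Type*} [Group Γ] [MulDistribMulAction Γ F] [ContinuousConstSMul Γ F] :
    ContinuousConstSMul Γ (ProPrimeCompletion m F) where
  continuous_const_smul γ := by
    rw [(QuotientGroup.isQuotientMap_mk (proPrimeKernel m F)).continuous_iff]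
    exact QuotientGroup.continuous_mk.comp (continuous_const_smul γ)

theorem ProPrimeCompletion.continuous_map (m : ℕ) {G : Type*} [Group G] [TopologicalSpace G]
    [IsTopologicalGroup G] (f : F →ₜ* G) : Continuous (ProPrimeCompletion.map m f) := by
  rw [(QuotientGroup.isQuotientMap_mk (proPrimeKernel m F)).continuous_iff]
  exact QuotientGroup.continuous_mk.comp f.continuous_toFun

theorem Subgroup.coprime_index_inf {V W : Subgroup F} {m : ℕ} [V.Normal]
    (hV : V.index.Coprime m) (hW : W.index.Coprime m) : (V ⊓ W).index.Coprime m := by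
  rw [← Subgroup.relIndex_mul_index (inf_le_right : V ⊓ W ≤ W), Subgroup.inf_relIndex_right]
  exact Nat.Coprime.mul_left
    (Nat.Coprime.coprime_dvd_left (Subgroup.relIndex_dvd_index_of_normal V W) hV) hW

/-- All open normal subgroups have index prime to `m`. -/
def IsProPrime (m : ℕ) (F : Type*) [Group F] [TopologicalSpace F] : Prop :=
  ∀ V : Subgroup F, V.Normal → IsOpen (V : Set F) → V.index.Coprime m

variable [CompactSpace F]

/-- The open normal subgroups of index prime to `m` form a directed family, so by compactness one of
them already lies in `V`. -/
theorem coprime_index_of_proPrimeKernel_le {m : ℕ} {V : Subgroup F}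
    (hVo : IsOpen (V : Set F)) (hV : proPrimeKernel m F ≤ V) : V.index.Coprime m := by
  let ι := {W : Subgroup F | W.Normal ∧ IsOpen (W : Set F) ∧ W.index.Coprime m}
  have : Nonempty ι := ⟨⟨⊤, inferInstance, isOpen_univ, by simp⟩⟩
  obtain ⟨W, hW⟩ := (hVo.isClosed_compl.isCompact).elim_directed_family_closed
    (fun W : ι => (W.1 : Set F)) (fun W => W.1.isClosed_of_isOpen W.2.2.1) (by
      rw [Set.eq_empty_iff_forall_notMem]
      rintro x ⟨hx, hx'⟩
      refine hx (hV ?_)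
      rw [proPrimeKernel, Subgroup.mem_sInf]
      exact fun W hW => Set.mem_iInter.1 hx' ⟨W, hW⟩) (by
      intro W W'
      have := W.2.1
      have := W'.2.1
      exact ⟨⟨W.1 ⊓ W'.1, Subgroup.normal_inf_normal _ _, W.2.2.1.inter W'.2.2.1,
        Subgroup.coprime_index_inf W.2.2.2 W'.2.2.2⟩, fun x hx => hx.1, fun x hx => hx.2⟩)
  have hWV : W.1 ≤ V := fun x hx => by
    by_contra h
    exact (Set.eq_empty_iff_forall_notMem.1 hW x) ⟨h, hx⟩
  exact Nat.Coprime.coprime_dvd_left (Subgroup.index_dvd_of_le hWV) W.2.2.2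

theorem isProPrime_proPrimeCompletion (m : ℕ) : IsProPrime m (ProPrimeCompletion m F) := by
  intro V _ hV
  have h := coprime_index_of_proPrimeKernel_le (m := m)
    (V := V.comap (QuotientGroup.mk' (proPrimeKernel m F)))
    (hV.preimage (ProPrimeCompletion.continuous_mk m)) (fun x hx => by
      rw [Subgroup.mem_comap, show QuotientGroup.mk' (proPrimeKernel m F) x = 1 from
        (QuotientGroup.eq_one_iff x).2 hx]
      exact V.one_mem)
  rwa [Subgroup.index_comap_of_surjective _ (QuotientGroup.mk'_surjective _)] at h

variable [T2Space F] [TotallyDisconnectedSpace F]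

/-- For `V` open and normal, the index of `L V` in `L V M` is a power of `ℓ`, and `L V M` has index
prime to `m`. So `L V` has index prime to `m` and contains the kernel; the closed group `L` is the
intersection of such `L V`. -/
theorem proPrimeKernel_le_of_pow_mem {m ℓ : ℕ} [hp : Fact ℓ.Prime] (hℓ : ℓ.Coprime m)
    {L M : Subgroup F} (hLc : IsClosed (L : Set F)) [L.Normal] [M.Normal]
    (hM : ∀ V : Subgroup F, V.Normal → IsOpen (V : Set F) → M ≤ V → V.index.Coprime m)
    (hpow : ∀ x ∈ M, x ^ ℓ ∈ L) : proPrimeKernel m F ≤ L := by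
  intro x hx
  by_contra hxL
  have hU : {v : F | x * v ∉ L} ∈ 𝓝 (1 : F) := by
    refine (hLc.isOpen_compl.preimage (continuous_const_mul x)).mem_nhds ?_
    simpa using hxL
  obtain ⟨V, hVn, hVo, hV⟩ := exists_openNormal_subset' hU
  have hxV : x ∉ L ⊔ V := fun h => by
    obtain ⟨l, hl, v, hv, rfl⟩ := Subgroup.mem_sup_of_normal_right.1 h
    exact hV (V.inv_mem hv) (by simpa using hl)
  set P := L ⊔ V
  have hPn : P.Normal := Subgroup.sup_normal L V
  have hPo : IsOpen (P : Set F) := Subgroup.isOpen_mono le_sup_right hVo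
  have hQn : (P ⊔ M).Normal := Subgroup.sup_normal P M
  have hQ := hM _ hQn (Subgroup.isOpen_mono le_sup_left hPo) le_sup_right
  have hfin : P.FiniteIndex := by
    have := Subgroup.quotient_finite_of_isOpen P hPo
    exact Subgroup.finiteIndex_of_finite_quotient
  have hpg : IsPGroup ℓ ((P ⊔ M : Subgroup F) ⧸ P.subgroupOf (P ⊔ M)) := by
    intro q
    obtain ⟨y, rfl⟩ := QuotientGroup.mk_surjective q
    refine ⟨1, ?_⟩
    rw [pow_one, ← QuotientGroup.mk_pow, QuotientGroup.eq_one_iff]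
    obtain ⟨p, hp, z, hz, hy⟩ := Subgroup.mem_sup_of_normal_right.1 y.2
    change (y : F) ^ ℓ ∈ P
    rw [← hy, ← QuotientGroup.eq_one_iff, QuotientGroup.mk_pow, QuotientGroup.mk_mul,
      (QuotientGroup.eq_one_iff p).2 hp, one_mul, ← QuotientGroup.mk_pow, QuotientGroup.eq_one_iff]
    exact (le_sup_left : L ≤ P) (hpow z hz)
  have hfin' : Finite ((P ⊔ M : Subgroup F) ⧸ P.subgroupOf (P ⊔ M)) :=
    Subgroup.finite_quotient_of_finiteIndex
  obtain ⟨k, hk⟩ := IsPGroup.iff_card.1 hpg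
  have hPi : P.index.Coprime m := by
    rw [← Subgroup.relIndex_mul_index (le_sup_left : P ≤ P ⊔ M)]
    refine Nat.Coprime.mul_left ?_ hQ
    change Nat.Coprime (Nat.card _) m
    rw [hk]
    exact Nat.Coprime.pow_left k hℓ
  exact hxV ((sInf_le ⟨hPn, hPo, hPi⟩ : proPrimeKernel m F ≤ P) hx)

/-- The kernel of `ψ` contains `N ∩ V` for some open normal `V`, and the index of `N ∩ V` in `N`
divides that of `V` in `F`. -/
theorem IsProPrime.coprime_card {m : ℕ} (hF : IsProPrime m F) {N : Subgroup F} {C : Type*}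
    [Group C] {ψ : N →* C} (hψ : IsLocallyConstant ψ) (hs : Function.Surjective ψ) :
    (Nat.card C).Coprime m := by
  obtain ⟨U, hUo, hU⟩ := isOpen_induced_iff.1 (hψ.isOpen_fiber 1)
  have h1U : (1 : F) ∈ U := by
    have : (1 : N) ∈ Subtype.val ⁻¹' U := by rw [hU]; exact map_one ψ
    exact this
  obtain ⟨V, hVn, hVo, hVU⟩ := exists_openNormal_subset' (hUo.mem_nhds h1U)
  have hle : V.subgroupOf N ≤ ψ.ker := fun x hx => by
    have : x ∈ Subtype.val ⁻¹' U := hVU hx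
    rw [hU] at this
    exact this
  have hcard : Nat.card C = ψ.ker.index := by
    rw [Subgroup.index_ker, MonoidHom.range_eq_top.2 hs, Subgroup.card_top]
  rw [hcard]
  exact Nat.Coprime.coprime_dvd_left ((Subgroup.index_dvd_of_le hle).trans
    (Subgroup.relIndex_dvd_index_of_normal V N)) (hF V hVn hVo)

end ProPrime

/-! ### Homomorphisms to `ℓ`-torsion modules and the pro-`m'` kernel -/

section EqHomProPrime

variable {F : Type*} [Group F] [TopologicalSpace F] [IsTopologicalGroup F] [CompactSpace F]
  {Γ : Type*} [Group Γ] [MulDistribMulAction Γ F]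
  {ℓ : ℕ} [Fact ℓ.Prime] {V : Type*} [AddCommGroup V] [Module (ZMod ℓ) V]

theorem map_pow_eq_zero {N : Type*} [Group N] {f : N → V} (hadd : ∀ x y, f (x * y) = f x + f y)
    (x : N) : f (x ^ ℓ) = 0 := by
  have key : ∀ k : ℕ, f (x ^ k) = k • f x := fun k => by
    induction k with
    | zero =>
      have := hadd 1 1
      rw [mul_one, left_eq_add] at this
      rw [pow_zero, this, zero_smul]
    | succ k ih => rw [pow_succ, hadd, ih, succ_nsmul]
  rw [key, ← Nat.cast_smul_eq_nsmul (ZMod ℓ), ZMod.natCast_self, zero_smul]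

/-- Pullback along `q` is the isomorphism; `hker` is exactly what is needed for homomorphisms on `M`
to descend to `N'`. -/
theorem dimN_eqHom_comap {F' : Type*} [Group F'] [TopologicalSpace F'] [T2Space F']
    [MulDistribMulAction Γ F'] {q : F →* F'} (hqc : Continuous q) (hqs : Function.Surjective q)
    (hq : ∀ (γ : Γ) (x : F), q (γ • x) = γ • q x) {N' : Subgroup F'} {M : Subgroup F}
    (hMc : IsClosed (M : Set F)) (hM : ∀ x, x ∈ M ↔ q x ∈ N')
    {τ' : Representation (ZMod ℓ) (SemiProd F' Γ) V} {τ : Representation (ZMod ℓ) (SemiProd F Γ) V}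
    (hτ : ∀ h, τ h = τ' (SemiProd.map q hq h))
    (hker : ∀ f ∈ eqHom M τ, ∀ x : M, q x = 1 → f x = 0) :
    dimN (ZMod ℓ) (eqHom N' τ') = dimN (ZMod ℓ) (eqHom M τ) := by
  let p : M →* N' := (q.comp M.subtype).codRestrict N' fun x => (hM x).1 x.2
  have hps : Function.Surjective p := fun y => by
    obtain ⟨x, hx⟩ := hqs y
    exact ⟨⟨x, (hM x).2 (by rw [hx]; exact y.2)⟩, Subtype.ext hx⟩
  have hpc : Continuous p := (hqc.comp continuous_subtype_val).subtype_mk _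
  have : CompactSpace M := isCompact_iff_compactSpace.1 hMc.isCompact
  have hleft : ∀ h : SemiProd F Γ, (SemiProd.map q hq h).left = q h.left := fun h => rfl
  have hright : ∀ h : SemiProd F Γ, (SemiProd.map q hq h).right = h.right := fun h => rfl
  let Φ : eqHom N' τ' →ₗ[ZMod ℓ] eqHom M τ :=
    ((LinearMap.funLeft (ZMod ℓ) V p).comp (Submodule.subtype _)).codRestrict _ fun f => by
      refine ⟨f.2.1.comp_continuous hpc, fun x y => ?_, fun h y z hz => ?_⟩
      · change f.1 (p (x * y)) = f.1 (p x) + f.1 (p y)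
        rw [map_mul, f.2.2.1]
      · change f.1 (p z) = τ h (f.1 (p y))
        rw [hτ]
        refine f.2.2.2 _ (p y) (p z) ?_
        change q z = _
        rw [hleft, hright, hz, map_mul, map_mul, hq, map_inv]
        rfl
  refine dimN_congr (LinearEquiv.ofBijective Φ ⟨?_, fun f => ?_⟩)
  · rw [injective_iff_map_eq_zero]
    intro f hf
    ext y
    obtain ⟨x, rfl⟩ := hps y
    exact congrFun (congrArg Subtype.val hf) x
  · let g : N' → V := fun y => f.1 (Function.surjInv hps y)
    have hg : ∀ x, g (p x) = f.1 x := fun x => by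
      have h1 : p (Function.surjInv hps (p x)) = p x := Function.surjInv_eq hps _
      have h2 : q ((Function.surjInv hps (p x) * x⁻¹ : M) : F) = 1 := by
        have : p (Function.surjInv hps (p x) * x⁻¹) = 1 := by
          rw [map_mul, h1, map_inv, mul_inv_cancel]
        exact congrArg Subtype.val this
      have h3 := f.2.2.1 (Function.surjInv hps (p x) * x⁻¹) x
      rw [inv_mul_cancel_right, hker f.1 f.2 _ h2, zero_add] at h3
      exact h3
    refine ⟨⟨g, ?_, fun x y => ?_, fun h y z hz => ?_⟩, ?_⟩
    · refine IsLocallyConstant.of_comp_surjective hpc hps ?_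
      have : g ∘ p = f.1 := funext hg
      rw [this]; exact f.2.1
    · obtain ⟨x, rfl⟩ := hps x
      obtain ⟨y, rfl⟩ := hps y
      rw [← map_mul, hg, hg, hg, f.2.2.1]
    · obtain ⟨y, rfl⟩ := hps y
      obtain ⟨x, hx⟩ := hqs h.left
      let h' : SemiProd F Γ := ⟨x, h.right⟩
      have hh' : SemiProd.map q hq h' = h := SemidirectProduct.ext hx rfl
      have hz' : (z : F') = q (x * (h.right • (y : F)) * x⁻¹) := by
        rw [hz, map_mul, map_mul, hq, map_inv, hx]; rfl
      have hmem : x * (h.right • (y : F)) * x⁻¹ ∈ M := (hM _).2 (by rw [← hz']; exact z.2)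
      have hzp : z = p ⟨_, hmem⟩ := Subtype.ext hz'
      have h3 := f.2.2.2 h' y ⟨_, hmem⟩ rfl
      rw [hτ, hh'] at h3
      rw [hzp, hg, hg]
      exact h3
    · ext x
      exact hg x

variable [T2Space F] [TotallyDisconnectedSpace F]

/-- The kernel of `f` is closed, normal in `F` by equivariance, and contains the `ℓ`-th powers of
`M`, so `proPrimeKernel_le_of_pow_mem` applies. -/
theorem eqHom_eq_zero_of_mem_proPrimeKernel {m : ℕ} (hℓ : ℓ.Coprime m) {M : Subgroup F}
    (hM : IsClosedNormal Γ M) (hKM : proPrimeKernel m F ≤ M)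
    {τ : Representation (ZMod ℓ) (SemiProd F Γ) V} {f : M → V} (hf : f ∈ eqHom M τ)
    (x : M) (hx : (x : F) ∈ proPrimeKernel m F) : f x = 0 := by
  have hL := isClosedNormal_map_ker hM (isEquivariantHom_eqHomToHom τ ⟨f, hf⟩)
  have := hL.2.1
  have := hM.2.1
  have hle := proPrimeKernel_le_of_pow_mem (M := M) hℓ hL.1
    (fun V _ hVo hMV => coprime_index_of_proPrimeKernel_le hVo (hKM.trans hMV))
    (fun y hy => ⟨(⟨y, hy⟩ : M) ^ ℓ, map_pow_eq_zero hf.2.1 _, rfl⟩)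
  exact (mem_map_ker x).1 (hle hx)

omit [Group Γ] [MulDistribMulAction Γ F] in
-- Here `f` is not equivariant, so its kernel need not be normal in `F`. Its normal core still
-- contains all `ℓ`-th powers, because a conjugate of an `ℓ`-th power is again one.
theorem hom_proPrimeKernel_eq_zero {m : ℕ} (hℓ : ℓ.Coprime m) {f : proPrimeKernel m F → V}
    (hf : IsLocallyConstant f) (hadd : ∀ x y, f (x * y) = f x + f y) (x) : f x = 0 := by
  let ψ : proPrimeKernel m F →* Multiplicative V :=
    MonoidHom.mk' (fun x => Multiplicative.ofAdd (f x)) fun x y => by rw [hadd]; rfl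
  set L := ψ.ker.map (proPrimeKernel m F).subtype
  have hL : IsClosed (L : Set F) := by
    refine (isClosed_proPrimeKernel m).isClosedEmbedding_subtypeVal.isClosedMap _ ?_
    exact hf.isClosed_fiber 0
  have hle := proPrimeKernel_le_of_pow_mem (M := proPrimeKernel m F) (L := L.normalCore) hℓ
    (L.normalCore_isClosed hL)
    (fun V _ hVo hMV => coprime_index_of_proPrimeKernel_le hVo hMV) (fun y hy b => by
      refine ⟨(⟨b * y * b⁻¹, (proPrimeKernel_normal m F).conj_mem y hy b⟩ :
        proPrimeKernel m F) ^ ℓ, map_pow_eq_zero hadd _, ?_⟩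
      change (b * y * b⁻¹) ^ ℓ = b * y ^ ℓ * b⁻¹
      rw [conj_pow])
  exact (mem_map_ker x).1 (L.normalCore_le (hle x.2))

end EqHomProPrime

/-! ### Restriction from the preimage of the pro-`m'` kernel to the kernel of the presentation -/

section Restriction

variable {F : Type*} [Group F] [TopologicalSpace F] [IsTopologicalGroup F] [CompactSpace F]
  [T2Space F] [TotallyDisconnectedSpace F]
  {G : Type*} [Group G] [TopologicalSpace G] [IsTopologicalGroup G] [CompactSpace G]
  [T2Space G] [TotallyDisconnectedSpace G]
  {Γ : Type*} [Group Γ] [MulDistribMulAction Γ F] [ContinuousConstSMul Γ F]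
  {ℓ : ℕ} [Fact ℓ.Prime] {V : Type*} [AddCommGroup V] [Module (ZMod ℓ) V]
  {m : ℕ} {φ : F →* G} {M : Subgroup F}

/-- The map to the prime-to-`m` kernel of `G` from its preimage. -/
def toProPrimeKernel (hM : ∀ x, x ∈ M ↔ φ x ∈ proPrimeKernel m G) : M →* proPrimeKernel m G :=
  (φ.comp M.subtype).codRestrict _ fun x => (hM x).1 x.2

omit [TopologicalSpace F] [IsTopologicalGroup F] [CompactSpace F] [T2Space F]
  [TotallyDisconnectedSpace F] [IsTopologicalGroup G] [CompactSpace G]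
  [T2Space G] [TotallyDisconnectedSpace G] in
theorem toProPrimeKernel_surjective (hφs : Function.Surjective φ)
    (hM : ∀ x, x ∈ M ↔ φ x ∈ proPrimeKernel m G) :
    Function.Surjective (toProPrimeKernel hM) := fun y => by
  obtain ⟨x, hx⟩ := hφs y
  exact ⟨⟨x, (hM x).2 (by rw [hx]; exact y.2)⟩, Subtype.ext hx⟩

omit [IsTopologicalGroup F] [CompactSpace F] [T2Space F]
  [TotallyDisconnectedSpace F] [IsTopologicalGroup G] [CompactSpace G]
  [T2Space G] [TotallyDisconnectedSpace G] in
theorem continuous_toProPrimeKernel (hφc : Continuous φ)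
    (hM : ∀ x, x ∈ M ↔ φ x ∈ proPrimeKernel m G) :
    Continuous (toProPrimeKernel hM) := (hφc.comp continuous_subtype_val).subtype_mk _

omit [IsTopologicalGroup F] [T2Space F] [TotallyDisconnectedSpace F] in
-- Such an `f` descends to the pro-`m'` kernel of `G`, which has no nonzero continuous homomorphisms
-- to an `ℓ`-torsion group.
theorem hom_eq_zero_of_ker (hℓ : ℓ.Coprime m) (hφc : Continuous φ) (hφs : Function.Surjective φ)
    (hMc : IsClosed (M : Set F)) (hM : ∀ x, x ∈ M ↔ φ x ∈ proPrimeKernel m G)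
    {f : M → V} (hf : IsLocallyConstant f) (hadd : ∀ x y, f (x * y) = f x + f y)
    (hN : ∀ x : M, φ x = 1 → f x = 0) (x : M) : f x = 0 := by
  have hps := toProPrimeKernel_surjective hφs hM
  have : CompactSpace M := isCompact_iff_compactSpace.1 hMc.isCompact
  let p := toProPrimeKernel hM
  let g : proPrimeKernel m G → V := fun y => f (Function.surjInv hps y)
  have hg : ∀ x, g (p x) = f x := fun x => by
    have h1 : p (Function.surjInv hps (p x)) = p x := Function.surjInv_eq hps _
    have h2 : φ ((Function.surjInv hps (p x) * x⁻¹ : M) : F) = 1 := by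
      have : p (Function.surjInv hps (p x) * x⁻¹) = 1 := by
        rw [map_mul, h1, map_inv, mul_inv_cancel]
      exact congrArg Subtype.val this
    have h3 := hadd (Function.surjInv hps (p x) * x⁻¹) x
    rw [inv_mul_cancel_right, hN _ h2, zero_add] at h3
    exact h3
  rw [← hg]
  refine hom_proPrimeKernel_eq_zero hℓ (f := g) ?_ (fun a b => ?_) _
  · refine IsLocallyConstant.of_comp_surjective (continuous_toProPrimeKernel hφc hM) hps ?_
    have : g ∘ p = f := funext hg
    exact this ▸ hf
  · obtain ⟨a, rfl⟩ := hps a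
    obtain ⟨b, rfl⟩ := hps b
    change g (p a * p b) = g (p a) + g (p b)
    rw [← map_mul, hg, hg, hg, hadd]

/-- The action is trivial, so coordinates in a basis of `V` reduce the claim to coefficients `ZMod
ℓ`. -/
theorem mem_B2_trivial_of_subsingleton {W : Type*} [Group W] [TopologicalSpace W] [Finite V]
    (h : Subsingleton (H2 (Representation.trivial (ZMod ℓ) W (ZMod ℓ))))
    {z : W × W → V} (hz : z ∈ Z2 (Representation.trivial (ZMod ℓ) W V)) :
    ∃ b : W → V, IsLocallyConstant b ∧ ∀ x y, z (x, y) = b y - b (x * y) + b x := by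
  let e := (Module.finBasis (ZMod ℓ) V).equivFun
  have key : ∀ i, ∃ b : W → ZMod ℓ, IsLocallyConstant b ∧
      ∀ x y, e (z (x, y)) i = b y - b (x * y) + b x := by
    intro i
    have hzi : (fun p => e (z p) i) ∈ Z2 (Representation.trivial (ZMod ℓ) W (ZMod ℓ)) := by
      refine ⟨hz.1.comp (fun a => e a i), fun x y t => ?_⟩
      have := congrArg (fun a => e a i) (hz.2 x y t)
      simpa using this
    have h0 : (Submodule.Quotient.mk ⟨_, hzi⟩ :
        H2 (Representation.trivial (ZMod ℓ) W (ZMod ℓ))) = 0 := Subsingleton.elim _ _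
    rw [Submodule.Quotient.mk_eq_zero] at h0
    obtain ⟨b, hb, hbz⟩ := h0
    exact ⟨b, hb, fun x y => hbz x y⟩
  choose b hb hbz using key
  refine ⟨fun x => e.symm (fun i => b i x), ?_, fun x y => ?_⟩
  · have h1 : IsLocallyConstant (fun x => fun i => b i x) := IsLocallyConstant.pi hb
    exact h1.comp e.symm
  · apply e.injective
    ext i
    simp [hbz]

variable {N : Subgroup F} {τ : Representation (ZMod ℓ) (SemiProd F Γ) V}

/-- Restriction of equivariant homomorphisms to a smaller subgroup. -/
def restrictEqHom (hNM : N ≤ M) (τ : Representation (ZMod ℓ) (SemiProd F Γ) V) :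
    eqHom M τ →ₗ[ZMod ℓ] eqHom N τ :=
  ((LinearMap.funLeft (ZMod ℓ) V (Subgroup.inclusion hNM)).comp
    (Submodule.subtype _)).codRestrict _ fun f =>
      ⟨f.2.1.comp_continuous (continuous_inclusion hNM),
        fun x y => f.2.2.1 (Subgroup.inclusion hNM x) (Subgroup.inclusion hNM y),
        fun h y z hz => f.2.2.2 h _ _ hz⟩

omit [IsTopologicalGroup F] [T2Space F] [TotallyDisconnectedSpace F]
  [ContinuousConstSMul Γ F] in
theorem restrictEqHom_injective (hℓ : ℓ.Coprime m) (hφc : Continuous φ)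
    (hφs : Function.Surjective φ)
    (hMc : IsClosed (M : Set F)) (hM : ∀ x, x ∈ M ↔ φ x ∈ proPrimeKernel m G)
    (hNM : φ.ker ≤ M) : Function.Injective (restrictEqHom hNM τ) := by
  rw [injective_iff_map_eq_zero]
  intro f hf
  ext x
  exact hom_eq_zero_of_ker hℓ hφc hφs hMc hM f.2.1 f.2.2.1
    (fun x hx => congrFun (congrArg Subtype.val hf) (⟨x, hx⟩ : φ.ker)) x

/-- The obstruction to extending `f` from `φ.ker` to `M` is its transgression in `H²` of the
pro-`m'` kernel of `G` with trivial coefficients. Concretely, `f` extends to a cochain `c` on `F`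
whose coboundary on `M` descends to that kernel; a primitive `b` of the descended cocycle corrects
`c` to a homomorphism. -/
theorem restrictEqHom_surjective [Finite V] (hℓ : ℓ.Coprime m) (hφc : Continuous φ)
    (hφs : Function.Surjective φ)
    (hMn : IsClosedNormal Γ M) (hM : ∀ x, x ∈ M ↔ φ x ∈ proPrimeKernel m G)
    (hNM : φ.ker ≤ M) (hNn : IsClosedNormal Γ φ.ker)
    (hτM : ∀ x ∈ M, τ (SemidirectProduct.inl x) = 1)
    (hH2 : Subsingleton (H2 (Representation.trivial (ZMod ℓ) (proPrimeKernel m G) (ZMod ℓ)))) :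
    Function.Surjective (restrictEqHom hNM τ) := by
  intro f
  obtain ⟨c, hc, hcN⟩ := exists_extension_of_hom φ.ker f.1 f.2.1 f.2.2.1
  have hcNr : ∀ (n : φ.ker), ∀ x ∈ M, c (x * n) = f.1 n + c x := fun n x hx => by
    have hm : x * n * x⁻¹ ∈ φ.ker := (MonoidHom.normal_ker φ).conj_mem _ n.2 x
    have h1 := hcN ⟨_, hm⟩ x
    have h2 := f.2.2.2 (SemidirectProduct.inl x) n ⟨_, hm⟩ (by simp)
    rw [inv_mul_cancel_right] at h1
    rw [h1, h2, hτM x hx]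
    rfl
  let d : M × M → V := fun p => c p.2 - c (p.1 * p.2) + c p.1
  have hdl : ∀ (n : φ.ker) (x y x' : M), (x' : F) = n * x → d (x', y) = d (x, y) := by
    intro n x y x' hx'
    simp only [d, hx']
    rw [mul_assoc, hcN, hcN]
    abel
  have hdr : ∀ (n : φ.ker) (x y y' : M), (y' : F) = y * n → d (x, y') = d (x, y) := by
    intro n x y y' hy'
    simp only [d, hy']
    rw [← mul_assoc, hcNr n _ y.2, hcNr n _ (M.mul_mem x.2 y.2)]
    abel
  have hps := toProPrimeKernel_surjective hφs hM
  have hpc := continuous_toProPrimeKernel hφc hM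
  set p := toProPrimeKernel hM
  let s := Function.surjInv hps
  have hs : ∀ y, p (s y) = y := Function.surjInv_eq hps
  let z : proPrimeKernel m G × proPrimeKernel m G → V := fun q => d (s q.1, s q.2)
  have hpφ : ∀ x : M, ((p x : proPrimeKernel m G) : G) = φ x := fun x => rfl
  have hz : ∀ x y, d (x, y) = z (p x, p y) := by
    intro x y
    have h1 : (x : F) * (s (p x) : F)⁻¹ ∈ φ.ker := by
      rw [MonoidHom.mem_ker, map_mul, map_inv, ← hpφ, ← hpφ, hs, mul_inv_cancel]
    have h2 : (s (p y) : F)⁻¹ * (y : F) ∈ φ.ker := by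
      rw [MonoidHom.mem_ker, map_mul, map_inv, ← hpφ, ← hpφ, hs, inv_mul_cancel]
    rw [hdl ⟨_, h1⟩ (s (p x)) y x (by simp), hdr ⟨_, h2⟩ (s (p x)) (s (p y)) y (by simp)]
  have : CompactSpace M := isCompact_iff_compactSpace.1 hMn.1.isCompact
  have hcM : IsLocallyConstant (fun x : M => c x) := hc.comp_continuous continuous_subtype_val
  have hd : IsLocallyConstant d :=
    ((hcM.comp_continuous continuous_snd).sub
      (hcM.comp_continuous (continuous_fst.mul continuous_snd))).add
        (hcM.comp_continuous continuous_fst)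
  have hzZ : z ∈ Z2 (Representation.trivial (ZMod ℓ) (proPrimeKernel m G) V) := by
    refine ⟨?_, fun a b t => ?_⟩
    · refine IsLocallyConstant.of_comp_surjective (p := Prod.map p p) (hpc.prodMap hpc)
        (hps.prodMap hps) ?_
      have : z ∘ Prod.map p p = d := by
        ext ⟨x, y⟩
        exact (hz x y).symm
      rw [this]
      exact hd
    · obtain ⟨a, rfl⟩ := hps a
      obtain ⟨b, rfl⟩ := hps b
      obtain ⟨t, rfl⟩ := hps t
      rw [← map_mul, ← map_mul, ← hz, ← hz, ← hz, ← hz]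
      simp only [d, Subgroup.coe_mul, mul_assoc, Representation.trivial_apply]
      abel
  obtain ⟨b, hb, hbz⟩ := mem_B2_trivial_of_subsingleton hH2 hzZ
  let g : M → V := fun x => c x - b (p x)
  have hgl : IsLocallyConstant g := hcM.sub (hb.comp_continuous hpc)
  have hgadd : ∀ x y, g (x * y) = g x + g y := by
    intro x y
    have h := hz x y
    rw [hbz] at h
    simp only [d, ← map_mul] at h
    simp only [g, Subgroup.coe_mul]
    have h' : c (x * y) - b (p (x * y)) = c x + c y - b (p x) - b (p y) := by
      have e : c (x * y) = c y + c x - (b (p y) - b (p (x * y)) + b (p x)) := by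
        rw [← h]; abel
      rw [e]; abel
    rw [h']; abel
  have hg1 : g 1 = 0 := by
    have := hgadd 1 1
    rwa [mul_one, left_eq_add] at this
  have hgN : ∀ (x : M) (hx : φ x = 1), g x = f.1 ⟨x, hx⟩ := by
    intro x hx
    have hp1 : p x = 1 := Subtype.ext hx
    have h1 := hcN ⟨x, hx⟩ 1
    rw [mul_one] at h1
    have h2 : c 1 - b (p 1) = 0 := hg1
    rw [map_one] at h2
    change c x - b (p x) = _
    change c x = _ at h1
    rw [h1, hp1, add_sub_assoc, h2, add_zero]
  -- Equivariance of the extension costs nothing: the difference is a homomorphism on `M` that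
  -- vanishes on `φ.ker`, hence zero by `hom_eq_zero_of_ker`.
  have hequiv : ∀ (h : SemiProd F Γ) (y : M), τ h⁻¹ (g (hMn.opEnd h y)) - g y = 0 := by
    intro h
    refine hom_eq_zero_of_ker hℓ hφc hφs hMn.1 hM ?_ (fun x y => ?_) fun x hx => ?_
    · have hcont : Continuous (hMn.opEnd h) := by
        refine Continuous.subtype_mk ?_ _
        exact (continuous_const.mul
          ((continuous_const_smul h.right).comp continuous_subtype_val)).mul continuous_const
      exact ((hgl.comp_continuous hcont).comp (τ h⁻¹)).sub hgl
    · rw [map_mul, hgadd, hgadd, map_add]; abel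
    · have hx' : φ (hMn.opEnd h x : F) = 1 := hNn.opAct_mem h (y := x) hx
      rw [hgN x hx, hgN _ hx', f.2.2.2 h ⟨x, hx⟩ ⟨_, hx'⟩ rfl, ← Module.End.mul_apply, ← map_mul,
        inv_mul_cancel, map_one, Module.End.one_apply, sub_self]
  refine ⟨⟨g, hgl, hgadd, fun h y t ht => ?_⟩, ?_⟩
  · have h1 := hequiv h y
    have h2 : t = hMn.opEnd h y := Subtype.ext ht
    rw [h2, ← sub_eq_zero.1 h1, ← Module.End.mul_apply, ← map_mul, mul_inv_cancel, map_one,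
      Module.End.one_apply]
  · ext x
    exact hgN ⟨x, hNM x.2⟩ x.2

end Restriction

/-! ### Irreducible commutative groups with operators as simple modules -/

section Modules

variable {ℓ : ℕ} [Fact ℓ.Prime] {H : Type*} [Group H] {V : Type*} [AddCommGroup V]
  [Module (ZMod ℓ) V]

/-- A counting argument: there are vectors in `V ^ k` that are linearly independent over the
endomorphisms of a simple module `V`, as many as the dimensions allow. -/
theorem exists_independent_family [Finite V] (τ : Representation (ZMod ℓ) H V)
    [τ.IsIrreducible] (k : ℕ) : ∀ r : ℕ,
    r * Module.finrank (ZMod ℓ) (Representation.IntertwiningMap τ τ) ≤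
      k * Module.finrank (ZMod ℓ) V →
    ∃ b : Fin r → Fin k → V, ∀ ψ : Fin r → Representation.IntertwiningMap τ τ,
      (∀ j, ∑ i, ψ i (b i j) = 0) → ψ = 0
  | 0, _ => ⟨Fin.elim0, fun _ _ => Subsingleton.elim _ _⟩
  | r + 1, h => by
    have hV : Nontrivial V := (isIrreducibleGroup_moduleAut τ).1
    have hE : 0 < Module.finrank (ZMod ℓ) (Representation.IntertwiningMap τ τ) := by
      rw [Module.finrank_pos_iff]
      refine ⟨⟨1, 0, fun h01 => ?_⟩⟩
      obtain ⟨v, hv⟩ := exists_ne (0 : V)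
      exact hv (congrArg (fun f : Representation.IntertwiningMap τ τ => f v) h01)
    have hlt : r * Module.finrank (ZMod ℓ) (Representation.IntertwiningMap τ τ) <
        k * Module.finrank (ZMod ℓ) V := by
      refine lt_of_lt_of_le ?_ h
      rw [add_mul]
      omega
    obtain ⟨b, hb⟩ := exists_independent_family τ k r hlt.le
    let L : (Fin r → Representation.IntertwiningMap τ τ) →ₗ[ZMod ℓ] (Fin k → V) :=
      { toFun := fun ψ j => ∑ i, ψ i (b i j)
        map_add' := fun ψ ψ' => by
          ext j
          rw [Pi.add_apply, ← Finset.sum_add_distrib]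
          rfl
        map_smul' := fun c ψ => by
          ext j
          simp only [Pi.smul_apply, RingHom.id_apply, Finset.smul_sum]
          rfl }
    -- The source of `L` has dimension `r dim End V`, less than `k dim V`, so some vector `b₀` is
    -- not a combination of the previous ones.
    have hL : LinearMap.range L ≠ ⊤ := fun htop => by
      have h1 := LinearMap.finrank_range_le L
      rw [htop, finrank_top, Module.finrank_pi_fintype, Module.finrank_pi_fintype] at h1
      simp only [Finset.sum_const, Finset.card_univ, Fintype.card_fin, smul_eq_mul] at h1
      omega
    obtain ⟨b₀, hb₀⟩ : ∃ b₀, b₀ ∉ LinearMap.range L := by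
      by_contra hcon
      push Not at hcon
      exact hL (eq_top_iff.2 fun x _ => hcon x)
    refine ⟨Fin.cons b₀ b, fun ψ hψ => ?_⟩
    simp only [Fin.sum_univ_succ, Fin.cons_zero, Fin.cons_succ] at hψ
    -- By Schur's lemma a nonzero `ψ 0` would be invertible, and solving the relation for `b₀` would
    -- put it in the range of `L`.
    have h0 : ψ 0 = 0 := by
      refine (Representation.IsIrreducible.bijective_or_eq_zero (ψ 0)).resolve_left fun hbij => ?_
      let e := (ψ 0).ofBijective hbij
      have he : ∀ v, e.symm (ψ 0 v) = v := fun v => e.toLinearEquiv.symm_apply_apply v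
      refine hb₀ ⟨fun i => -(e.symm.toIntertwiningMap * ψ i.succ), ?_⟩
      ext j
      have h1 := congrArg e.symm (hψ j)
      rw [map_add, he, map_zero, map_sum] at h1
      rw [eq_neg_of_add_eq_zero_left h1, ← Finset.sum_neg_distrib]
      rfl
    have h1 := hb (fun i => ψ i.succ) fun j => by
      have := hψ j
      rw [h0] at this
      change 0 + _ = _ at this
      rwa [zero_add] at this
    ext i : 1
    refine Fin.cases h0 (fun i => congrFun h1 i) i

theorem isIrreducible_of_isIrreducibleGroup {ρ : Representation (ZMod ℓ) H V}
    (h : IsIrreducibleGroup (moduleAut ρ)) : ρ.IsIrreducible := by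
  have hV : Nontrivial V := h.1
  refine { exists_pair_ne := ⟨⊥, ⊤, fun hbt => ?_⟩, eq_bot_or_eq_top := fun W => ?_ }
  · exact bot_ne_top (α := Submodule (ZMod ℓ) V) (congrArg Subrepresentation.toSubmodule hbt)
  · rcases h.2 (AddSubgroup.toSubgroup W.toSubmodule.toAddSubgroup)
      (fun g a ha => W.apply_mem_toSubmodule g ha) with hW | hW
    · left
      apply Subrepresentation.toSubmodule_injective
      refine eq_bot_iff.2 fun a ha => ?_
      have : Multiplicative.ofAdd a ∈ AddSubgroup.toSubgroup W.toSubmodule.toAddSubgroup := ha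
      rw [hW] at this
      exact this
    · right
      apply Subrepresentation.toSubmodule_injective
      refine eq_top_iff.2 fun a _ => ?_
      have : Multiplicative.ofAdd a ∈ AddSubgroup.toSubgroup W.toSubmodule.toAddSubgroup := by
        rw [hW]; trivial
      exact this

theorem IsIrreducibleGroup.of_iso {B C : Type*} [Group B] [Group C] {α : H →* MulAut B}
    {β : H →* MulAut C} (hα : IsIrreducibleGroup α) (h : IsoGroups α β) : IsIrreducibleGroup β := by
  obtain ⟨e, he⟩ := h
  have := hα.1
  refine ⟨e.symm.toEquiv.nontrivial, fun S hS => ?_⟩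
  rcases hα.2 (S.comap e.toMonoidHom) (fun g b hb => by
    change e (α g b) ∈ S
    rw [he]
    exact hS g _ hb) with h | h
  · left
    refine eq_bot_iff.2 fun c hc => ?_
    have : e.symm c ∈ S.comap e.toMonoidHom := by
      change e (e.symm c) ∈ S
      rwa [MulEquiv.apply_symm_apply]
    rw [h, Subgroup.mem_bot] at this
    rw [Subgroup.mem_bot, ← e.apply_symm_apply c, this, map_one]
  · right
    refine eq_top_iff.2 fun c _ => ?_
    have : e.symm c ∈ S.comap e.toMonoidHom := by rw [h]; trivial
    change e (e.symm c) ∈ S at this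
    rwa [MulEquiv.apply_symm_apply] at this

/-- By Cauchy's theorem some `p`-torsion subgroup is nontrivial; it is stable, hence everything. -/
theorem exists_prime_pow_eq_one {B : Type*} [CommGroup B] [Finite B] {α : H →* MulAut B}
    (hα : IsIrreducibleGroup α) : ∃ p : ℕ, p.Prime ∧ p ∣ Nat.card B ∧ ∀ b : B, b ^ p = 1 := by
  have := hα.1
  obtain ⟨p, hp, hpB⟩ := Nat.exists_prime_and_dvd (Finite.one_lt_card (α := B)).ne'
  have : Fact p.Prime := ⟨hp⟩
  obtain ⟨b, hb⟩ := exists_prime_orderOf_dvd_card' p hpB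
  refine ⟨p, hp, hpB, fun c => ?_⟩
  rcases hα.2 (powMonoidHom p).ker (fun g b hb => by
    rw [MonoidHom.mem_ker, powMonoidHom_apply] at hb ⊢
    rw [← map_pow, hb, map_one]) with h | h
  · have h1 : b ∈ (powMonoidHom p : B →* B).ker := by
      rw [MonoidHom.mem_ker, powMonoidHom_apply, ← hb, pow_orderOf_eq_one]
    rw [h, Subgroup.mem_bot] at h1
    rw [h1, orderOf_one] at hb
    exact absurd hb.symm hp.one_lt.ne'
  · have h1 : c ∈ (powMonoidHom p : B →* B).ker := by rw [h]; trivial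
    exact h1

theorem exists_addEquiv_pi_zmod {p : ℕ} [Fact p.Prime] {A : Type*} [AddCommGroup A] [Finite A]
    (h : ∀ x : A, p • x = 0) : ∃ d : ℕ, Nonempty (A ≃+ (Fin d → ZMod p)) := by
  have hmod : Nonempty (Module (ZMod p) A) := ⟨AddCommGroup.zmodModule h⟩
  obtain ⟨hmod⟩ := hmod
  exact ⟨_, ⟨(Module.finBasis (ZMod p) A).equivFun.toAddEquiv⟩⟩

/-- Coordinates and `ULift` put the module in an arbitrary universe, as needed to match it with the
modules in the suprema. -/
theorem exists_module_of_commGroup {B : Type*} [CommGroup B] [Finite B] {α : H →* MulAut B}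
    (hα : IsIrreducibleGroup α) : ∃ (p : ℕ) (_ : Fact p.Prime) (V : Type w) (_ : AddCommGroup V)
      (_ : Module (ZMod p) V) (_ : Finite V) (ρ : Representation (ZMod p) H V),
      p ∣ Nat.card B ∧ ρ.IsIrreducible ∧ IsoGroups α (moduleAut ρ) := by
  obtain ⟨p, hp, hpB, hpow⟩ := exists_prime_pow_eq_one hα
  have : Fact p.Prime := ⟨hp⟩
  obtain ⟨d, ⟨e₀⟩⟩ := exists_addEquiv_pi_zmod (p := p) (A := Additive B) fun x => hpow x.toMul
  let e : Additive B ≃+ ULift.{w} (Fin d → ZMod p) := e₀.trans AddEquiv.ulift.symm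
  let a : H → Additive B →+ Additive B := fun h => MonoidHom.toAdditive (α h).toMonoidHom
  have ha1 : ∀ b, a 1 b = b := fun b => by
    change Additive.ofMul (α 1 b.toMul) = b
    rw [map_one]; rfl
  have hamul : ∀ g h b, a (g * h) b = a g (a h b) := fun g h b => by
    change Additive.ofMul (α (g * h) b.toMul) = _
    rw [map_mul]; rfl
  let ρ : Representation (ZMod p) H
      (ULift.{w} (Fin d → ZMod p)) :=
    { toFun := fun h => ((e.toAddMonoidHom.comp (a h)).comp e.symm.toAddMonoidHom).toZModLinearMap p
      map_one' := by
        apply LinearMap.ext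
        intro x
        change e (a 1 (e.symm x)) = x
        rw [ha1, AddEquiv.apply_symm_apply]
      map_mul' := fun g h => by
        apply LinearMap.ext
        intro x
        change e (a (g * h) (e.symm x)) = e (a g (e.symm (e (a h (e.symm x)))))
        rw [hamul, AddEquiv.symm_apply_apply] }
  have hiso : IsoGroups α (moduleAut ρ) := by
    refine ⟨AddEquiv.toMultiplicativeRight e, fun h b => ?_⟩
    change Multiplicative.ofAdd (e (Additive.ofMul (α h b))) =
      Multiplicative.ofAdd (e (a h (e.symm (e (Additive.ofMul b)))))
    rw [AddEquiv.symm_apply_apply]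
    rfl
  exact ⟨p, inferInstance, _, inferInstance, inferInstance, inferInstance, ρ, hpB,
    isIrreducible_of_isIrreducibleGroup (hα.of_iso hiso), hiso⟩

end Modules

/-! ### Generation of closed normal subgroups -/

section IsoGroups

variable {H : Type*} [Group H] {A B C : Type*} [Group A] [Group B] [Group C]
  {α : H →* MulAut A} {β : H →* MulAut B} {γ : H →* MulAut C}

theorem IsoGroups.refl (α : H →* MulAut A) : IsoGroups α α := ⟨MulEquiv.refl A, fun _ _ => rfl⟩

theorem IsoGroups.symm (h : IsoGroups α β) : IsoGroups β α := by
  obtain ⟨e, he⟩ := h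
  refine ⟨e.symm, fun h b => e.injective ?_⟩
  rw [he, MulEquiv.apply_symm_apply, MulEquiv.apply_symm_apply]

theorem IsoGroups.trans (h : IsoGroups α β) (h' : IsoGroups β γ) : IsoGroups α γ := by
  obtain ⟨e, he⟩ := h
  obtain ⟨e', he'⟩ := h'
  refine ⟨e.trans e', fun h b => ?_⟩
  rw [MulEquiv.trans_apply, MulEquiv.trans_apply, he, he']

theorem isoGroups_of_bijective {θ : A →* B} (hθ : Function.Bijective θ)
    (h : ∀ g a, θ (α g a) = β g (θ a)) : IsoGroups α β := ⟨MulEquiv.ofBijective θ hθ, h⟩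

theorem IsoGroups.mul_comm (h : IsoGroups α β) (hA : ∀ a b : A, a * b = b * a) (a b : B) :
    a * b = b * a := by
  obtain ⟨e, -⟩ := h
  obtain ⟨a, rfl⟩ := e.surjective a
  obtain ⟨b, rfl⟩ := e.surjective b
  rw [← map_mul, hA, map_mul]

end IsoGroups

section Closure

variable {F : Type v} [Group F] [TopologicalSpace F] {Γ : Type u} [Group Γ]
  [MulDistribMulAction Γ F]

theorem isClosedNormal_closedNormalClosure (S : Set F) :
    IsClosedNormal Γ (closedNormalClosure Γ S) := isClosedNormal_sInf fun _ hU => hU.1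

theorem subset_closedNormalClosure (S : Set F) : S ⊆ closedNormalClosure Γ S := fun _ hx =>
  Subgroup.mem_sInf.2 fun _ hU => hU.2 hx

theorem closedNormalClosure_le {S : Set F} {U : Subgroup F} (hU : IsClosedNormal Γ U)
    (h : S ⊆ U) : closedNormalClosure Γ S ≤ U := sInf_le ⟨hU, h⟩

/-- An equivariant homomorphism has closed normal kernel, so it is determined by its values on the
generators. -/
theorem dimN_eqHom_le_of_closedNormalClosure [IsTopologicalGroup F] [CompactSpace F] [T2Space F]
    {ℓ : ℕ} [Fact ℓ.Prime] {V : Type*} [AddCommGroup V] [Module (ZMod ℓ) V] [Finite V]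
    (τ : Representation (ZMod ℓ) (SemiProd F Γ) V) {N : Subgroup F} {S : Set F} {k : ℕ}
    (hk : S.encard ≤ k) (hS : closedNormalClosure Γ S = N) :
    dimN (ZMod ℓ) (eqHom N τ) ≤ k * dimN (ZMod ℓ) V := by
  subst hS
  have hfin : S.Finite := Set.finite_of_encard_le_coe hk
  have : Finite S := hfin
  have hle : Nat.card S ≤ k := by
    have := hfin.cast_ncard_eq
    rw [← this] at hk
    exact_mod_cast hk
  let e := (Finite.equivFin S).symm
  let ev : eqHom (closedNormalClosure Γ S) τ →ₗ[ZMod ℓ] (Fin (Nat.card S) → V) :=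
    { toFun := fun f i => f.1 ⟨e i, subset_closedNormalClosure S (e i).2⟩
      map_add' := fun _ _ => rfl
      map_smul' := fun _ _ => rfl }
  have hev : Function.Injective ev := by
    rw [injective_iff_map_eq_zero]
    intro f hf
    have hcl := isClosedNormal_map_ker (isClosedNormal_closedNormalClosure S)
      (isEquivariantHom_eqHomToHom τ f)
    ext x
    refine (mem_map_ker (ψ := eqHomToHom τ f) x).1 (closedNormalClosure_le hcl (fun s hs => ?_) x.2)
    refine (mem_map_ker (ψ := eqHomToHom τ f) ⟨s, subset_closedNormalClosure S hs⟩).2 ?_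
    have := congrFun hf (e.symm ⟨s, hs⟩)
    change f.1 ⟨e (e.symm ⟨s, hs⟩), _⟩ = 0 at this
    simp only [Equiv.apply_symm_apply] at this
    exact this
  refine (dimN_le_of_injective ev hev).trans ?_
  rw [dimN_pi]
  gcongr

end Closure

section Generation

variable {F : Type v} [Group F] [TopologicalSpace F] [IsTopologicalGroup F] [CompactSpace F]
  [T2Space F] {Γ : Type u} [Group Γ] [MulDistribMulAction Γ F]
  {N : Subgroup F} (hN : IsClosedNormal Γ N) (D : IrreducibleDecomposition Γ N)

/-- Tuples in the factors isomorphic to `D.B i₀` detecting all homomorphisms from a product of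
such factors to an irreducible commutative group. -/
def IsDetecting (i₀ : D.ι) {k : ℕ} (b : ∀ i, Fin k → D.B i) : Prop :=
  ∀ (C : Type v) [CommGroup C] (σ : SemiProd F Γ →* MulAut C), IsIrreducibleGroup σ →
    ∀ (J : Finset D.ι) (θ : ∀ i, D.B i →* C), (∀ i h a, θ i (D.act i h a) = σ h (θ i a)) →
      (∀ i ∈ J, IsoGroups (D.act i) (D.act i₀)) → (∀ j, ∏ i ∈ J, θ i (b i j) = 1) →
        ∀ i ∈ J, θ i = 1

include hN in
-- By `count_mul_dimN` the factors isomorphic to the module are finite in number, and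
-- `exists_independent_family` provides one vector of `V ^ k` for each of them, independent over
-- `End V`. These vectors are the coordinates of the tuples.
theorem exists_isDetecting {ℓ : ℕ} [Fact ℓ.Prime] {V : Type*} [AddCommGroup V]
    [Module (ZMod ℓ) V] [Finite V] (τ : Representation (ZMod ℓ) (SemiProd F Γ) V)
    [hτ : τ.IsIrreducible] {k : ℕ} (hk : dimN (ZMod ℓ) (eqHom N τ) ≤ k * dimN (ZMod ℓ) V)
    {i₀ : D.ι} (hi₀ : IsoGroups (D.act i₀) (moduleAut τ)) :
    ∃ b : ∀ i, Fin k → D.B i, IsDetecting D i₀ b := by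
  classical
  set I := {i : D.ι | IsoGroups (D.act i) (moduleAut τ)} with hI
  have hV : Nontrivial V := (isIrreducibleGroup_moduleAut τ).1
  have hE : Module.finrank (ZMod ℓ) (Representation.IntertwiningMap τ τ) ≠ 0 := by
    rw [← pos_iff_ne_zero, Module.finrank_pos_iff]
    refine ⟨⟨1, 0, fun h01 => ?_⟩⟩
    obtain ⟨v, hv⟩ := exists_ne (0 : V)
    exact hv (congrArg (fun f : Representation.IntertwiningMap τ τ => f v) h01)
  have hcount : I.encard * Module.finrank (ZMod ℓ) (Representation.IntertwiningMap τ τ) ≤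
      k * Module.finrank (ZMod ℓ) V := by
    rw [← dimN_eq_finrank, ← dimN_eq_finrank]
    exact (count_mul_dimN hN τ D).le.trans hk
  have hIfin : I.Finite := by
    rw [← Set.encard_ne_top_iff]
    intro htop
    rw [htop, ENat.top_mul (by exact_mod_cast hE)] at hcount
    exact absurd (top_le_iff.1 hcount) (by exact_mod_cast ENat.coe_ne_top _)
  have : Finite I := hIfin
  have hle : Nat.card I * Module.finrank (ZMod ℓ) (Representation.IntertwiningMap τ τ) ≤
      k * Module.finrank (ZMod ℓ) V := by
    rw [← hIfin.cast_ncard_eq] at hcount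
    exact_mod_cast hcount
  obtain ⟨b₀, hb₀⟩ := exists_independent_family τ k _ hle
  obtain ⟨en⟩ : Nonempty (I ≃ Fin (Nat.card I)) := ⟨Finite.equivFin I⟩
  choose e he using fun i : I => show IsoGroups (D.act i.1) (moduleAut τ) from i.2
  refine ⟨fun i j => if hi : i ∈ I then
    (e ⟨i, hi⟩).symm (Multiplicative.ofAdd (b₀ (en ⟨i, hi⟩) j)) else 1, ?_⟩
  intro C _ σ hσ J θ hθ hJ hprod i₁ hi₁
  refine (trivial_or_bijective (D.irreducible i₁) hσ _ (hθ i₁)).resolve_right fun hbij => ?_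
  have hJI : ∀ i ∈ J, i ∈ I := fun i hi => (hJ i hi).trans hi₀
  obtain ⟨g, hg⟩ := (isoGroups_of_bijective hbij (hθ i₁)).symm.trans (hJI i₁ hi₁)
  let a : I → V →+ V := fun i => MonoidHom.toAdditive
    ((g.toMonoidHom.comp (θ i)).comp (e i).symm.toMonoidHom)
  have ha : ∀ i v, a i v = (g (θ i ((e i).symm (Multiplicative.ofAdd v)))).toAdd :=
    fun i v => rfl
  let s : I → Representation.IntertwiningMap τ τ := fun i =>
    ((a i).toZModLinearMap ℓ).intertwiningMap_of_isIntertwiningMap τ τ (fun h v => by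
      change a i (τ h v) = τ h (a i v)
      have h2 : (e i).symm (Multiplicative.ofAdd (τ h v)) =
          D.act i h ((e i).symm (Multiplicative.ofAdd v)) := by
        apply (e i).injective
        rw [he, MulEquiv.apply_symm_apply, MulEquiv.apply_symm_apply]
        rfl
      rw [ha, h2, hθ, hg]
      rfl)
  have hs : ∀ i v, s i v = a i v := fun i v => rfl
  -- Transported through the isomorphisms `e i` and `g`, the relation between the `θ i` becomes a
  -- relation between endomorphisms of `V`, excluded by independence.
  have hzero := hb₀ (fun m => if (en.symm m).1 ∈ J then s (en.symm m) else 0) fun j => by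
    have h1 : ∏ i ∈ J, g (θ i (if hi : i ∈ I then
        (e ⟨i, hi⟩).symm (Multiplicative.ofAdd (b₀ (en ⟨i, hi⟩) j)) else 1)) = 1 := by
      rw [← map_prod, hprod, map_one]
    have h2 := congrArg Multiplicative.toAdd h1
    rw [toAdd_prod, toAdd_one] at h2
    rw [← h2]
    have h3 : ∀ m, (if (en.symm m).1 ∈ J then s (en.symm m) else 0) (b₀ m j) =
        if (en.symm m).1 ∈ J then s (en.symm m) (b₀ m j) else 0 := fun m => by
      split_ifs <;> rfl
    rw [Finset.sum_congr rfl fun m _ => h3 m, ← Finset.sum_filter]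
    refine Finset.sum_nbij (fun m => (en.symm m).1) (fun m hm => (Finset.mem_filter.1 hm).2)
      (fun m _ m' _ h => en.symm.injective (Subtype.ext h)) (fun i hi => ?_) fun m hm => ?_
    · have h4 : ((en.symm (en ⟨i, hJI i hi⟩) : I) : D.ι) = i := by rw [Equiv.symm_apply_apply]
      refine ⟨en ⟨i, hJI i hi⟩, ?_, h4⟩
      rw [Finset.mem_coe, Finset.mem_filter]
      exact ⟨Finset.mem_univ _, by rw [h4]; exact hi⟩
    · rw [dif_pos (en.symm m).2, hs, ha]
      change _ = (g (θ (en.symm m) ((e (en.symm m)).symm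
        (Multiplicative.ofAdd (b₀ (en (en.symm m)) j))))).toAdd
      rw [Equiv.apply_symm_apply]
  have h1 := congrFun hzero (en ⟨i₁, hJI i₁ hi₁⟩)
  simp only [Equiv.symm_apply_apply] at h1
  rw [if_pos hi₁] at h1
  obtain ⟨v, hv⟩ := exists_ne (0 : V)
  obtain ⟨c, hc⟩ := hbij.2 (g.symm (Multiplicative.ofAdd v))
  have h2 : s ⟨i₁, hJI i₁ hi₁⟩ (e ⟨i₁, hJI i₁ hi₁⟩ c).toAdd = 0 := by rw [h1]; rfl
  rw [hs, ha] at h2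
  change (g (θ i₁ ((e ⟨i₁, hJI i₁ hi₁⟩).symm (e ⟨i₁, hJI i₁ hi₁⟩ c)))).toAdd = 0 at h2
  rw [MulEquiv.symm_apply_apply, hc, MulEquiv.apply_symm_apply] at h2
  exact hv h2

/-- Factors of a decomposition are equivalent when they are isomorphic. -/
def factorSetoid : Setoid D.ι where
  r i j := IsoGroups (D.act i) (D.act j)
  iseqv := ⟨fun _ => IsoGroups.refl _, IsoGroups.symm, IsoGroups.trans⟩

include hN in
-- By Schur's lemma only factors isomorphic to `C` contribute nontrivial components, and at those
-- factors the coordinates of the `t j` are detecting.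
theorem eq_one_of_isDetecting {C : Type v} [CommGroup C] {σ : SemiProd F Γ →* MulAut C}
    (hσ : IsIrreducibleGroup σ) {ψ : N →* C} (hψ : IsEquivariantHom σ ψ) {k : ℕ}
    {t : Fin k → N}
    (hb : ∀ i₁, IsoGroups (D.act i₁) σ → ∃ b : ∀ i, Fin k → D.B i, IsDetecting D i₁ b ∧
      ∀ i, IsoGroups (D.act i) (D.act i₁) → ∀ j, D.proj (t j) i = b i j)
    (ht : ∀ j, ψ (t j) = 1) : ψ = 1 := by
  classical
  obtain ⟨J, hJ⟩ := map_eq_prod_component hN D hσ hψ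
  have hθ := component_equivariant hN D hσ hψ
  set θ := component hN D hσ hψ
  have hJ' : ∀ x, ψ x = ∏ i ∈ J.filter (fun i => θ i ≠ 1), θ i (D.proj x i) := fun x => by
    rw [hJ, Finset.prod_filter_of_ne]
    intro i _ hi h1
    exact hi (by rw [h1]; rfl)
  have hiso : ∀ i ∈ J.filter (fun i => θ i ≠ 1), IsoGroups (D.act i) σ := fun i hi =>
    isoGroups_of_bijective ((trivial_or_bijective (D.irreducible i) hσ _ (hθ i)).resolve_left
      (Finset.mem_filter.1 hi).2) (hθ i)
  rcases (J.filter (fun i => θ i ≠ 1)).eq_empty_or_nonempty with hempty | ⟨i₁, hi₁⟩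
  · ext x
    rw [hJ', hempty]
    rfl
  · obtain ⟨b, hbd, hbt⟩ := hb i₁ (hiso i₁ hi₁)
    refine absurd (hbd C σ hσ _ θ hθ (fun i hi => (hiso i hi).trans (hiso i₁ hi₁).symm)
      (fun j => ?_) i₁ hi₁) (Finset.mem_filter.1 hi₁).2
    rw [← ht j, hJ']
    exact Finset.prod_congr rfl fun i hi => by
      rw [hbt i ((hiso i hi).trans (hiso i₁ hi₁).symm)]

variable [TotallyDisconnectedSpace F] [Finite Γ] [ContinuousConstSMul Γ F]

include hN in
/-- A closed normal subgroup is generated by `k ≥ 1` elements if the multiplicities of its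
commutative factors allow it. -/
theorem exists_generators {k : ℕ} (hk : 1 ≤ k)
    (hcomm : ∀ i : D.ι, (∀ a b : D.B i, a * b = b * a) →
      ∃ b : ∀ i, Fin k → D.B i, IsDetecting D i b) :
    ∃ t : Fin k → F, closedNormalClosure Γ (Set.range t) = N := by
  classical
  have hex : ∀ i₀ : D.ι, ∃ b : ∀ i, Fin k → D.B i,
      ((∀ a b : D.B i₀, a * b = b * a) → IsDetecting D i₀ b) ∧
      ((¬ ∀ a b : D.B i₀, a * b = b * a) → ∀ i j, b i j ≠ 1) := fun i₀ => by
    by_cases h : ∀ a b : D.B i₀, a * b = b * a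
    · obtain ⟨b, hb⟩ := hcomm i₀ h
      exact ⟨b, fun _ => hb, fun h' => absurd h h'⟩
    · choose b hb using fun i => (haveI := (D.irreducible i).1; exists_ne (1 : D.B i))
      exact ⟨fun i _ => b i, fun h' => absurd h' h, fun _ i _ => hb i⟩
  choose b hbc hbn using hex
  -- All factors in one isomorphism class must use the same tuple `b (rep i)`.
  let rep : D.ι → D.ι := fun i => (Quotient.mk (factorSetoid D) i).out
  have hrep : ∀ i, IsoGroups (D.act (rep i)) (D.act i) := fun i =>
    Quotient.exact (s := factorSetoid D) (Quotient.out_eq _)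
  have hrep' : ∀ i i', IsoGroups (D.act i) (D.act i') → rep i = rep i' := fun i i' h =>
    congrArg Quotient.out (Quotient.sound (s := factorSetoid D) h)
  choose t ht using fun j => D.surjective_proj (fun i => b (rep i) i j)
  have hsub : Set.range (fun j => (t j : F)) ⊆ N := by
    rintro _ ⟨j, rfl⟩
    exact (t j).2
  refine ⟨fun j => t j, by_contra fun hne => ?_⟩
  -- If the `t j` did not generate, they would lie in a maximal `U`, and the quotient map `ψ` by `U`
  -- would be nontrivial and kill all of them.
  obtain ⟨U, hU, hle⟩ := exists_isMaximalProper hN (isClosedNormal_closedNormalClosure _)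
    (lt_of_le_of_ne (closedNormalClosure_le hN hsub) hne)
  have : (U.subgroupOf N).Normal := hU.1.1.2.1.subgroupOf N
  have hσ := hU.irreducible hN
  let ψ : N →* N ⧸ U.subgroupOf N := QuotientGroup.mk' _
  have hψ : IsEquivariantHom (quotientAct hN hU.1.1) ψ :=
    ⟨hU.isLocallyConstant_mk hN, fun h y z hz => by
      have : z = hN.opEnd h y := Subtype.ext hz
      rw [this]; rfl⟩
  have hψt : ∀ j, ψ (t j) = 1 := fun j =>
    (QuotientGroup.eq_one_iff _).2 (hle (subset_closedNormalClosure _ ⟨j, rfl⟩))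
  have hψ1 : ψ ≠ 1 := fun h => by
    obtain ⟨c, hc⟩ := (haveI := hσ.1; exists_ne (1 : N ⧸ U.subgroupOf N))
    obtain ⟨x, rfl⟩ := QuotientGroup.mk_surjective c
    exact hc (by change ψ x = 1; rw [h]; rfl)
  by_cases hC : ∀ a b : N ⧸ U.subgroupOf N, a * b = b * a
  · let _ : CommGroup (N ⧸ U.subgroupOf N) := { (inferInstance : Group _) with mul_comm := hC }
    refine hψ1 (eq_one_of_isDetecting hN D hσ hψ (t := t) (fun i₁ hi₁ => ?_) hψt)
    have h1 := hbc (rep i₁) (((hrep i₁).trans hi₁).symm.mul_comm hC)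
    refine ⟨b (rep i₁), fun C _ σ hσ J θ hθ hJ h => h1 C σ hσ J θ hθ
      (fun i hi => (hJ i hi).trans (hrep i₁).symm) h, fun i hi j => ?_⟩
    rw [ht, ← hrep' i i₁ hi]
  -- A noncommutative quotient is a single coordinate up to isomorphism, and the coordinates of the
  -- first generator were chosen nontrivial there. This case needs `k ≥ 1`.
  · have hcomp : ∃ i, component hN D hσ hψ i ≠ 1 := by
      by_contra h
      push Not at h
      exact hψ1 (eq_one_of_component_eq_one hN D hσ hψ h)
    obtain ⟨i, hi⟩ := hcomp
    have hbij := (trivial_or_bijective (D.irreducible i) hσ _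
      (component_equivariant hN D hσ hψ i)).resolve_left hi
    have hiso := isoGroups_of_bijective hbij (component_equivariant hN D hσ hψ i)
    have h1 := map_eq_component_of_noncomm hN D hσ hψ hC i hi (t ⟨0, hk⟩)
    rw [hψt, ht] at h1
    have h2 := hbn (rep i) (fun h => hC (((hrep i).trans hiso).mul_comm h)) i ⟨0, hk⟩
    exact h2 (hbij.1 (h1.symm.trans (map_one _).symm))

end Generation

/-! ### Commutative factors of the kernel of a presentation as modules -/

section KernelFactor

variable {F : Type*} [Group F] [TopologicalSpace F] [IsTopologicalGroup F] [CompactSpace F]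
  {Γ : Type*} [Group Γ] [TopologicalSpace Γ] [DiscreteTopology Γ] [MulDistribMulAction Γ F]
  {Q : Type*} [Group Q] [TopologicalSpace Q] [T2Space Q] [MulDistribMulAction Γ Q]
  {q : F →* Q}

theorem SemiProd.map_surjective {F : Type*} [Group F] [MulDistribMulAction Γ F]
    {q : F →* Q} (hqs : Function.Surjective q) (hq : ∀ (γ : Γ) (x : F), q (γ • x) = γ • q x) :
    Function.Surjective (SemiProd.map q hq) := fun h => by
  obtain ⟨x, hx⟩ := hqs h.left
  exact ⟨⟨x, h.right⟩, SemidirectProduct.ext hx rfl⟩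

theorem isLocallyConstant_of_inl {ℓ : ℕ} {V : Type*} [AddCommGroup V] [Module (ZMod ℓ) V]
    [Finite V] {ρ : Representation (ZMod ℓ) (SemiProd Q Γ) V}
    (h : ∀ a : V, IsLocallyConstant (fun g : Q => ρ (SemidirectProduct.inl g) a)) (a : V) :
    IsLocallyConstant (fun h => ρ h a) := by
  have h1 : IsLocallyConstant (fun (g : Q) (a : V) => ρ (SemidirectProduct.inl g) a) :=
    IsLocallyConstant.pi h
  have h2 : IsLocallyConstant (fun h : SemiProd Q Γ => h.right) :=
    (IsLocallyConstant.of_discrete id).comp_continuous SemiProd.continuous_right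
  have h3 := ((h1.comp_continuous SemiProd.continuous_left).prodMk h2).comp
    (fun p : (V → V) × Γ => p.1 (ρ (SemidirectProduct.inr p.2) a))
  convert h3 using 2 with h
  change _ = ρ (SemidirectProduct.inl h.left) (ρ (SemidirectProduct.inr h.right) a)
  rw [← Module.End.mul_apply, ← map_mul, SemidirectProduct.inl_left_mul_inr_right]

/-- A commutative irreducible quotient of the kernel of `F → Q` is a simple module over
`Q ⋊ Γ`. -/
theorem exists_finSimpleModule (hqc : Continuous q) (hqs : Function.Surjective q)
    (hq : ∀ (γ : Γ) (x : F), q (γ • x) = γ • q x) {B : Type*} [CommGroup B] [Finite B]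
    {σ : SemiProd F Γ →* MulAut B} (hσ : IsIrreducibleGroup σ) {ψ : q.ker →* B}
    (hψ : IsEquivariantHom σ ψ) (hψs : Function.Surjective ψ) :
    ∃ (p : ℕ) (_ : Fact p.Prime) (A : FinSimpleModule.{_, w} p (SemiProd Q Γ)),
      p ∣ Nat.card B ∧ IsoGroups σ (moduleAut (A.ρ.comp (SemiProd.map q hq))) := by
  have hs := SemiProd.map_surjective hqs hq
  -- The kernel acts by conjugation, hence trivially, on its own commutative quotient, so the action
  -- factors through `Q ⋊ Γ`.
  have htriv : ∀ x ∈ q.ker, σ (SemidirectProduct.inl x) = 1 := fun x hx => by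
    ext b
    obtain ⟨y, rfl⟩ := hψs b
    rw [← hψ.2 (SemidirectProduct.inl x) y (⟨x, hx⟩ * y * ⟨x, hx⟩⁻¹) (by rw [opAct_inl]; rfl),
      map_mul, map_mul, map_inv, mul_comm (ψ ⟨x, hx⟩), mul_inv_cancel_right]
    rfl
  have hker : (SemiProd.map q hq).ker ≤ σ.ker := fun h hh => by
    have h1 : q h.left = 1 := congrArg SemidirectProduct.left hh
    have h2 : h.right = 1 := congrArg SemidirectProduct.right hh
    have h3 : h = SemidirectProduct.inl h.left := SemidirectProduct.ext rfl h2
    rw [MonoidHom.mem_ker, h3]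
    exact htriv _ h1
  let α : SemiProd Q Γ →* MulAut B :=
    (SemiProd.map q hq).liftOfSurjective hs ⟨σ, hker⟩
  have hα : ∀ h, α (SemiProd.map q hq h) = σ h := fun h =>
    MonoidHom.liftOfRightInverse_comp_apply _ _ _ ⟨σ, hker⟩ h
  have hαirr : IsIrreducibleGroup α := by
    refine ⟨hσ.1, fun S hS => hσ.2 S fun h b hb => ?_⟩
    rw [← hα]
    exact hS _ b hb
  obtain ⟨p, hp, V, _, _, _, ρ, hpB, hρ, e, he⟩ := exists_module_of_commGroup.{w} hαirr
  have hloc : ∀ a : V, IsLocallyConstant (fun g : Q => ρ (SemidirectProduct.inl g) a) := by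
    intro a
    -- Continuity of the action comes from that of `ψ`, since `x` sends `ψ y` to `ψ (x y x⁻¹)`.
    refine IsLocallyConstant.of_comp_surjective hqc hqs ?_
    obtain ⟨y, hy⟩ := hψs (e.symm (Multiplicative.ofAdd a))
    have hcont : Continuous (fun x : F => (⟨x * y * x⁻¹,
        (MonoidHom.normal_ker q).conj_mem _ y.2 x⟩ : q.ker)) :=
      ((continuous_id.mul continuous_const).mul continuous_inv).subtype_mk _
    have h1 := (hψ.1.comp_continuous hcont).comp (fun b => (e b).toAdd)
    convert h1 using 1
    ext x
    have h2 := hψ.2 (SemidirectProduct.inl x) y ⟨x * y * x⁻¹,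
        (MonoidHom.normal_ker q).conj_mem _ y.2 x⟩ (by rw [opAct_inl])
    have h3 : SemiProd.map q hq (SemidirectProduct.inl x) = SemidirectProduct.inl (q x) := by
      simp [SemiProd.map]
    change ρ (SemidirectProduct.inl (q x)) a = (e (ψ _)).toAdd
    rw [h2, ← hα, he, hy, MulEquiv.apply_symm_apply, h3]
    rfl
  refine ⟨p, hp, ⟨V, ρ, isLocallyConstant_of_inl hloc, hρ⟩, hpB, e, fun h b => ?_⟩
  rw [← hα, he]
  rfl

end KernelFactor

/-! ### Least integers in the extended reals -/

section Ceil

theorem eCeil_coe (x : ℝ) : eCeil (x : EReal) = ((⌈x⌉ : ℝ) : EReal) := by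
  refine IsLeast.csInf_eq ⟨⟨⌈x⌉, rfl, EReal.coe_le_coe_iff.2 (Int.le_ceil x)⟩, ?_⟩
  rintro _ ⟨k, rfl, hk⟩
  rw [EReal.coe_le_coe_iff] at hk ⊢
  exact_mod_cast Int.ceil_le.2 hk

theorem eCeil_top : eCeil ⊤ = ⊤ := by
  rw [eCeil, sInf_eq_top]
  rintro _ ⟨k, rfl, hk⟩
  exact absurd (top_le_iff.1 hk) (EReal.coe_ne_top _)

/-- The least number of copies of a space of dimension `d` needed to reach dimension `X`. -/
noncomputable def ceilDiv (X d : ℕ∞) : ℕ∞ := sInf {k | X ≤ k * d}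

theorem ceilDiv_le_iff {X d k : ℕ∞} (hd : d ≠ 0) : ceilDiv X d ≤ k ↔ X ≤ k * d := by
  have hne : {k : ℕ∞ | X ≤ k * d}.Nonempty := ⟨⊤, by
    change X ≤ ⊤ * d
    rw [ENat.top_mul hd]; exact le_top⟩
  refine ⟨fun h => ?_, fun h => sInf_le h⟩
  have h1 : X ≤ ceilDiv X d * d := csInf_mem hne
  exact h1.trans (by gcongr)

theorem ceilDiv_natCast (X : ℕ) {d : ℕ} (hd : d ≠ 0) :
    ceilDiv X d = (⌈(X : ℝ) / d⌉₊ : ℕ) := by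
  have hd' : (0 : ℝ) < d := by positivity
  have key : ∀ k : ℕ, ceilDiv X d ≤ k ↔ ((⌈(X : ℝ) / d⌉₊ : ℕ) : ℕ∞) ≤ k := fun k => by
    rw [ceilDiv_le_iff (by exact_mod_cast hd), Nat.cast_le, Nat.ceil_le, div_le_iff₀ hd']
    norm_cast
  refine le_antisymm ((key _).2 le_rfl) ?_
  rcases eq_or_ne (ceilDiv X d) ⊤ with h | h
  · rw [h]; exact le_top
  · lift ceilDiv X d to ℕ using h with a ha
    exact (key a).1 le_rfl

/-- Solving `h` turns the quotient into `X / d - n`, and the integer `n` passes through the ceiling.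
-/
theorem eCeil_euler {X h1 h2 ξ d : ℕ∞} {n : ℕ} (h : X + (h1 + ξ) = n * d + h2)
    (hz : h1 + ξ ≠ ⊤) (hd0 : d ≠ 0) (hd : d ≠ ⊤) :
    eCeil ((toE h2 - toE h1 - toE ξ) / toE d) = toE (ceilDiv X d) - n := by
  obtain ⟨hh1, hξ⟩ : h1 ≠ ⊤ ∧ ξ ≠ ⊤ := by
    rwa [Ne, ENat.add_eq_top, not_or] at hz
  lift h1 to ℕ using hh1
  lift ξ to ℕ using hξ
  lift d to ℕ using hd
  have hd0' : d ≠ 0 := by exact_mod_cast hd0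
  have hdpos : (0 : ℝ) < d := by positivity
  rcases eq_or_ne h2 ⊤ with rfl | h2t
  · have hX : X = ⊤ := by
      by_contra hX
      lift X to ℕ using hX
      rw [add_top] at h
      exact absurd h (by exact_mod_cast ENat.natCast_ne_top _)
    subst hX
    have h1 : ceilDiv ⊤ (d : ℕ∞) = ⊤ := by
      by_contra hc
      have h2 := (ceilDiv_le_iff (X := ⊤) (k := ceilDiv ⊤ (d : ℕ∞)) hd0).1 le_rfl
      lift ceilDiv ⊤ (d : ℕ∞) to ℕ using hc with a
      rw [top_le_iff] at h2
      exact absurd h2 (by exact_mod_cast ENat.natCast_ne_top _)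
    rw [h1, toE_top, toE_natCast, toE_natCast, toE_natCast, ← EReal.coe_natCast,
      ← EReal.coe_natCast, ← EReal.coe_natCast, ← EReal.coe_natCast, EReal.top_sub_coe,
      EReal.top_sub_coe, EReal.top_sub_coe, EReal.top_div_of_pos_ne_top
        (by exact_mod_cast hdpos) (EReal.coe_ne_top _), eCeil_top]
  · lift h2 to ℕ using h2t
    have hX : X ≠ ⊤ := by
      rintro rfl
      rw [top_add] at h
      exact absurd h.symm (by exact_mod_cast ENat.natCast_ne_top _)
    lift X to ℕ using hX
    rw [ceilDiv_natCast X hd0']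
    simp only [toE_natCast]
    have h' : (X : ℝ) + (h1 + ξ) = n * d + h2 := by exact_mod_cast h
    have e1 : (((h2 : EReal) - h1 - ξ) / d) = (((X : ℝ) / d - n : ℝ) : EReal) := by
      have : (X : ℝ) / d - n = ((h2 : ℝ) - h1 - ξ) / d := by
        field_simp
        linarith
      rw [this, EReal.coe_div]
      push_cast
      rfl
    rw [e1, eCeil_coe, Int.ceil_sub_natCast]
    have h3 : (0 : ℝ) ≤ (X : ℝ) / d := by positivity
    rw [← Int.natCast_ceil_eq_ceil h3]
    push_cast
    rfl

theorem EReal.sub_natCast_add_natCast (a : EReal) (n : ℕ) : a - n + n = a := by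
  rw [← EReal.coe_natCast, EReal.sub_add_cancel]

theorem exists_le_toE_natCast {s : EReal} (hs : s ≠ ⊤) : ∃ k : ℕ, s ≤ toE k := by
  induction s using EReal.rec with
  | bot => exact ⟨0, bot_le⟩
  | top => exact absurd rfl hs
  | coe r =>
    obtain ⟨k, hk⟩ := exists_nat_ge r
    refine ⟨k, ?_⟩
    rw [toE_natCast, ← EReal.coe_natCast, EReal.coe_le_coe_iff]
    exact hk

/-- Nonemptiness matters: an empty supremum is `⊥` in `EReal` but `0` in `ℕ∞`. If the `c i` are
unbounded, a finite value on the left would give a natural bound for all of them. -/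
theorem iSup_sub_add {ι : Sort*} [Nonempty ι] (c : ι → ℕ∞) (n : ℕ) :
    (⨆ i, (toE (c i) - n)) + n = toE (⨆ i, c i) := by
  refine le_antisymm ?_ ?_
  · have h1 : (⨆ i, (toE (c i) - n)) ≤ toE (⨆ i, c i) - n :=
      iSup_le fun i => EReal.sub_le_sub (toE_mono (le_iSup c i)) le_rfl
    refine (add_le_add_left h1 _).trans ?_
    rw [EReal.sub_natCast_add_natCast]
  · have h1 : ∀ i, toE (c i) ≤ (⨆ i, (toE (c i) - n)) + n := fun i => by
      have := le_iSup (fun i => toE (c i) - (n : EReal)) i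
      refine le_trans ?_ (add_le_add_left this _)
      rw [EReal.sub_natCast_add_natCast]
    rcases eq_or_ne (⨆ i, c i) ⊤ with htop | htop
    · set s := (⨆ i, (toE (c i) - n)) + n
      rw [htop, toE_top, top_le_iff]
      by_contra hs
      obtain ⟨k, hk⟩ := exists_le_toE_natCast hs
      have : (⨆ i, c i) ≤ k := iSup_le fun i => toE_le_iff.1 ((h1 i).trans hk)
      rw [htop, top_le_iff] at this
      exact ENat.natCast_ne_top k this
    · obtain ⟨i, hi⟩ := ENat.exists_eq_iSup_of_lt_top (lt_top_iff_ne_top.2 htop)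
      rw [← hi]
      exact h1 i

end Ceil

/-! ### The minimal number of generators of the kernel of a presentation -/

section MinGenerators

variable {F : Type v} [Group F] [TopologicalSpace F] [IsTopologicalGroup F] [CompactSpace F]
  [T2Space F] [TotallyDisconnectedSpace F]
  {Γ : Type u} [Group Γ] [Finite Γ] [TopologicalSpace Γ] [DiscreteTopology Γ]
  [MulDistribMulAction Γ F] [ContinuousConstSMul Γ F]

theorem continuous_opAct (h : SemiProd F Γ) : Continuous (opAct h : F →* F) :=
  (continuous_const.mul (continuous_const_smul h.right)).mul continuous_const

theorem isClosedNormal_closure_commutator {N : Subgroup F} (hN : IsClosedNormal Γ N) :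
    IsClosedNormal Γ (⁅N, N⁆ : Subgroup F).topologicalClosure := by
  refine isClosedNormal_of_opAct (Subgroup.isClosed_topologicalClosure _) fun h y hy => ?_
  refine map_mem_closure (continuous_opAct h) hy fun x hx => ?_
  have h1 : (⁅N, N⁆ : Subgroup F).map (opAct h) ≤ ⁅N, N⁆ := by
    rw [Subgroup.map_commutator]
    have : N.map (opAct h) ≤ N := by
      rintro _ ⟨y, hy, rfl⟩
      exact hN.opAct_mem h hy
    exact Subgroup.commutator_mono this this
  exact h1 ⟨x, hx, rfl⟩

theorem isClosedNormal_bot : IsClosedNormal Γ (⊥ : Subgroup F) :=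
  isClosedNormal_of_opAct (by rw [Subgroup.coe_bot]; exact isClosed_singleton) fun h y hy => by
    rw [Subgroup.mem_bot] at hy ⊢
    rw [hy, map_one]

theorem closedNormalClosure_empty : closedNormalClosure Γ (∅ : Set F) = ⊥ :=
  le_bot_iff.1 (closedNormalClosure_le isClosedNormal_bot (Set.empty_subset _))

variable {Q : Type w} [Group Q] [TopologicalSpace Q] [T2Space Q] [MulDistribMulAction Γ Q]
  {q : F →* Q} {m : ℕ}

omit [TotallyDisconnectedSpace F] [Finite Γ] [TopologicalSpace Γ] [DiscreteTopology Γ]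
  [ContinuousConstSMul Γ F] [CompactSpace F] [T2Space F] [IsTopologicalGroup F] in
theorem isClosedNormal_ker (hqc : Continuous q) (hq : ∀ (γ : Γ) (x : F), q (γ • x) = γ • q x) :
    IsClosedNormal Γ q.ker :=
  ⟨isClosed_singleton.preimage hqc, MonoidHom.normal_ker q, fun γ x hx => by
    rw [MonoidHom.mem_ker] at hx ⊢
    rw [hq, hx, smul_one]⟩

universe t

/-- The kernel of a presentation of a pro-`m'` group can be generated by `k` elements if and only
if the multiplicities of its commutative factors allow it and `k ≠ 0` if it is not trivial. -/
theorem minGenerators_le_iff (hF : IsProPrime m F) (hqc : Continuous q)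
    (hqs : Function.Surjective q) (hq : ∀ (γ : Γ) (x : F), q (γ • x) = γ • q x) (k : ℕ) :
    minGenerators Γ q.ker ≤ k ↔ (∀ (ℓ : ℕ) [Fact ℓ.Prime], ¬ ℓ ∣ m →
      ∀ A : FinSimpleModule.{_, t} ℓ (SemiProd Q Γ),
        dimN (ZMod ℓ) (eqHom q.ker (A.ρ.comp (SemiProd.map q hq))) ≤ k * dimN (ZMod ℓ) A.V) ∧
      (1 ≤ k ∨ q.ker = ⊥) := by
  have hN := isClosedNormal_ker hqc hq
  constructor
  · intro h
    obtain ⟨S, hS, hSk⟩ : ∃ S : Set F, closedNormalClosure Γ S = q.ker ∧ S.encard ≤ k := by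
      have h1 : minGenerators Γ q.ker < (k : ℕ∞) + 1 :=
        (ENat.lt_add_one_iff (ENat.natCast_ne_top k)).2 h
      rw [minGenerators, iInf_lt_iff] at h1
      obtain ⟨S, h1⟩ := h1
      rw [iInf_lt_iff] at h1
      obtain ⟨hS, h1⟩ := h1
      exact ⟨S, hS, (ENat.lt_add_one_iff (ENat.natCast_ne_top k)).1 h1⟩
    refine ⟨fun ℓ _ _ A => dimN_eqHom_le_of_closedNormalClosure _ hSk hS, ?_⟩
    rcases Nat.eq_zero_or_pos k with rfl | hk
    · right
      have : S = ∅ := by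
        rw [← Set.encard_eq_zero]
        exact le_antisymm hSk (zero_le)
      rw [← hS, this, closedNormalClosure_empty]
    · exact Or.inl hk
  · rintro ⟨hA, hk⟩
    by_cases hbot : q.ker = ⊥
    · refine (iInf₂_le (∅ : Set F) (by rw [closedNormalClosure_empty, hbot])).trans ?_
      rw [Set.encard_empty]
      exact zero_le
    · obtain ⟨D⟩ := nonempty_irreducibleDecomposition hN
      -- Each commutative factor is a simple module over `Q ⋊ Γ`, of characteristic not dividing `m`
      -- because `F` is pro-`m'`; so the bounds in `hA` cover all commutative factors.
      obtain ⟨t, ht⟩ := exists_generators hN D (hk.resolve_right hbot) fun i hi => by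
        let _ : CommGroup (D.B i) := { D.group i with mul_comm := hi }
        have hψs : Function.Surjective ((Pi.evalMonoidHom D.B i).comp D.proj) :=
          (Function.surjective_eval i).comp D.surjective_proj
        have hψ : IsEquivariantHom (D.act i) ((Pi.evalMonoidHom D.B i).comp D.proj) :=
          ⟨D.continuous_proj i, fun h y z hz => D.equivariant h y z hz i⟩
        obtain ⟨p, hp, A, hpB, hiso⟩ :=
          exists_finSimpleModule.{t} hqc hqs hq (D.irreducible i) hψ hψs
        have hpm : ¬ p ∣ m := fun hpm => by
          have := Nat.dvd_gcd hpB hpm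
          rw [(hF.coprime_card hψ.1 hψs : Nat.gcd _ _ = 1)] at this
          exact hp.out.one_lt.ne' (Nat.dvd_one.1 this)
        have : Representation.IsIrreducible (A.ρ.comp (SemiProd.map q hq)) :=
          isIrreducible_of_isIrreducibleGroup ((D.irreducible i).of_iso hiso)
        exact exists_isDetecting hN D _ (hA p hpm A) hiso
      refine (iInf₂_le (Set.range t) ht).trans ?_
      rw [← Set.image_univ]
      refine (Set.encard_image_le _ _).trans ?_
      rw [Set.encard_univ, ENat.card_eq_coe_natCard, Nat.card_eq_fintype_card, Fintype.card_fin]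

/-- If the kernel of a presentation is not topologically perfect, then some multiplicity is
positive. -/
theorem exists_dimN_eqHom_ne_zero (hF : IsProPrime m F) (hqc : Continuous q)
    (hqs : Function.Surjective q) (hq : ∀ (γ : Γ) (x : F), q (γ • x) = γ • q x)
    (hperf : closure ((⁅q.ker, q.ker⁆ : Subgroup F) : Set F) ≠ q.ker) :
    ∃ (ℓ : ℕ) (_ : Fact ℓ.Prime) (_ : ¬ ℓ ∣ m) (A : FinSimpleModule.{_, t} ℓ (SemiProd Q Γ)),
      dimN (ZMod ℓ) (eqHom q.ker (A.ρ.comp (SemiProd.map q hq))) ≠ 0 := by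
  have hN := isClosedNormal_ker hqc hq
  have hlt : (⁅q.ker, q.ker⁆ : Subgroup F).topologicalClosure < q.ker := by
    refine lt_of_le_of_ne (Subgroup.topologicalClosure_minimal _ ?_ hN.1) fun h => hperf ?_
    · exact Subgroup.commutator_le_left _ _
    · rw [← Subgroup.topologicalClosure_coe, h]
  -- A maximal subgroup above the closed commutator subgroup has a commutative irreducible quotient,
  -- whose projection is a nonzero homomorphism to a simple module.
  obtain ⟨U, hU, hle⟩ := exists_isMaximalProper hN (isClosedNormal_closure_commutator hN) hlt
  have : (U.subgroupOf q.ker).Normal := hU.1.1.2.1.subgroupOf q.ker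
  have hσ := hU.irreducible hN
  let ψ : q.ker →* q.ker ⧸ U.subgroupOf q.ker := QuotientGroup.mk' _
  have hψs : Function.Surjective ψ := QuotientGroup.mk'_surjective _
  have hψ : IsEquivariantHom (quotientAct hN hU.1.1) ψ :=
    ⟨hU.isLocallyConstant_mk hN, fun h y z hz => by
      have : z = hN.opEnd h y := Subtype.ext hz
      rw [this]; rfl⟩
  have hC : ∀ a b : q.ker ⧸ U.subgroupOf q.ker, a * b = b * a := fun a b => by
    obtain ⟨x, rfl⟩ := hψs a
    obtain ⟨y, rfl⟩ := hψs b
    rw [← commutatorElement_eq_one_iff_mul_comm, ← map_commutatorElement]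
    refine (QuotientGroup.eq_one_iff _).2 (hle (Subgroup.le_topologicalClosure _ ?_))
    exact Subgroup.commutator_mem_commutator x.2 y.2
  have hfin := hU.finite_quotient hN
  let _ : CommGroup (q.ker ⧸ U.subgroupOf q.ker) :=
    { (inferInstance : Group _) with mul_comm := hC }
  obtain ⟨p, hp, A, hpB, e, he⟩ := exists_finSimpleModule.{t} hqc hqs hq hσ hψ hψs
  refine ⟨p, hp, fun hpm => ?_, A, fun h0 => ?_⟩
  · have := Nat.dvd_gcd hpB hpm
    rw [(hF.coprime_card hψ.1 hψs : Nat.gcd _ _ = 1)] at this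
    exact hp.out.one_lt.ne' (Nat.dvd_one.1 this)
  · have hψ' : IsEquivariantHom (moduleAut (A.ρ.comp (SemiProd.map q hq)))
        (e.toMonoidHom.comp ψ) :=
      ⟨hψ.1.comp e, fun h y z hz => by
        change e (ψ z) = moduleAut _ h (e (ψ y))
        rw [hψ.2 h y z hz, he]⟩
    have hzero : ∀ f : eqHom q.ker (A.ρ.comp (SemiProd.map q hq)), f = 0 := by
      rw [dimN, Cardinal.toENat_eq_zero, rank_zero_iff] at h0
      exact fun f => Subsingleton.elim _ _
    obtain ⟨b, hb⟩ := (haveI := hσ.1; exists_ne (1 : q.ker ⧸ U.subgroupOf q.ker))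
    obtain ⟨x, rfl⟩ := hψs b
    refine hb (e.injective ?_)
    rw [map_one]
    have := congrFun (congrArg Subtype.val (hzero (eqHomOfHom hψ'))) x
    exact this

end MinGenerators

/-! ### Multiplicities of modules -/

section Multiplicities

variable {ℓ : ℕ} [Fact ℓ.Prime]

theorem natCast_card_ne_zero {m : ℕ} (h : ¬ ℓ ∣ m) : (m : ZMod ℓ) ≠ 0 := by
  rwa [Ne, ZMod.natCast_eq_zero_iff]

section Endomorphisms

variable {H : Type*} [Group H] {H' : Type*} [Group H'] {V : Type*} [AddCommGroup V]
  [Module (ZMod ℓ) V]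

theorem dvd_card_of_irreducible [Finite V] (τ : Representation (ZMod ℓ) H V) [τ.IsIrreducible] :
    ℓ ∣ Nat.card V := by
  have hV : Nontrivial V := (isIrreducibleGroup_moduleAut τ).1
  rw [Module.natCard_eq_pow_finrank (K := ZMod ℓ), Nat.card_zmod]
  exact dvd_pow_self ℓ Module.finrank_pos.ne'

theorem dimN_ne_zero_of_irreducible (τ : Representation (ZMod ℓ) H V) [τ.IsIrreducible] :
    dimN (ZMod ℓ) V ≠ 0 := by
  have hV : Nontrivial V := (isIrreducibleGroup_moduleAut τ).1
  rw [dimN, Ne, Cardinal.toENat_eq_zero, rank_zero_iff]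
  exact not_subsingleton V

theorem dimN_ne_top [Finite V] : dimN (ZMod ℓ) V ≠ ⊤ := dimN_ne_top_iff.2 inferInstance

theorem dimN_end_ne_zero (τ : Representation (ZMod ℓ) H V) [τ.IsIrreducible] :
    dimN (ZMod ℓ) (Representation.IntertwiningMap τ τ) ≠ 0 := by
  have hV : Nontrivial V := (isIrreducibleGroup_moduleAut τ).1
  rw [dimN, Ne, Cardinal.toENat_eq_zero, rank_zero_iff]
  intro h
  obtain ⟨v, hv⟩ := exists_ne (0 : V)
  exact hv (congrArg (fun f : Representation.IntertwiningMap τ τ => f v)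
    (Subsingleton.elim 1 0))

theorem dimN_end_ne_top [Finite V] (τ : Representation (ZMod ℓ) H V) :
    dimN (ZMod ℓ) (Representation.IntertwiningMap τ τ) ≠ ⊤ := dimN_ne_top_iff.2 inferInstance

theorem dimN_end_comp (τ : Representation (ZMod ℓ) H' V) {p : H →* H'}
    (hp : Function.Surjective p) :
    dimN (ZMod ℓ) (Representation.IntertwiningMap (τ.comp p : Representation (ZMod ℓ) H V)
      (τ.comp p : Representation (ZMod ℓ) H V)) =
      dimN (ZMod ℓ) (Representation.IntertwiningMap τ τ) := by
  let f : Representation.IntertwiningMap τ τ →ₗ[ZMod ℓ]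
      Representation.IntertwiningMap (τ.comp p : Representation (ZMod ℓ) H V)
        (τ.comp p : Representation (ZMod ℓ) H V) :=
    { toFun := fun a => ⟨a.toLinearMap, fun h => a.isIntertwining' (p h)⟩
      map_add' := fun _ _ => rfl
      map_smul' := fun _ _ => rfl }
  refine (dimN_congr (LinearEquiv.ofBijective f ⟨fun a b h => ?_, fun a => ?_⟩)).symm
  · ext v
    exact congrArg (fun c : Representation.IntertwiningMap
      (τ.comp p : Representation (ZMod ℓ) H V) (τ.comp p : Representation (ZMod ℓ) H V) => c v) h
  · refine ⟨⟨a.toLinearMap, fun h => ?_⟩, rfl⟩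
    obtain ⟨h, rfl⟩ := hp h
    exact a.isIntertwining' h

theorem isIrreducible_comp (τ : Representation (ZMod ℓ) H' V) [hτ : τ.IsIrreducible] {p : H →* H'}
    (hp : Function.Surjective p) :
    Representation.IsIrreducible (τ.comp p : Representation (ZMod ℓ) H V) := by
  have h := isIrreducibleGroup_moduleAut τ
  refine isIrreducible_of_isIrreducibleGroup ⟨h.1, fun S hS => h.2 S fun g b hb => ?_⟩
  obtain ⟨g, rfl⟩ := hp g
  exact hS g b hb

/-- Guarantees that the suprema over simple modules are not empty. -/
theorem exists_finSimpleModule_trivial (ℓ : ℕ) [Fact ℓ.Prime] (H : Type v) [Group H]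
    [TopologicalSpace H] : Nonempty (FinSimpleModule.{v, w} ℓ H) := by
  refine ⟨⟨ULift.{w} (ZMod ℓ), 1, fun a => IsLocallyConstant.const a,
    isIrreducible_of_isIrreducibleGroup ⟨?_, fun S _ => ?_⟩⟩⟩
  · exact (inferInstance : Nontrivial (ULift.{w} (ZMod ℓ)))
  · have hcard : Nat.card (Multiplicative (ULift.{w} (ZMod ℓ))) = ℓ := by
      rw [Nat.card_congr Multiplicative.toAdd, Nat.card_congr Equiv.ulift, Nat.card_zmod]
    have : Fact (Nat.card (Multiplicative (ULift.{w} (ZMod ℓ)))).Prime := by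
      rw [hcard]; infer_instance
    exact S.eq_bot_or_eq_top_of_prime_card

end Endomorphisms

section Count

variable {F : Type v} [Group F] [TopologicalSpace F] [IsTopologicalGroup F] [CompactSpace F]
  [T2Space F] [TotallyDisconnectedSpace F] {Γ : Type u} [Group Γ] [Finite Γ]
  [MulDistribMulAction Γ F] [ContinuousConstSMul Γ F]
  {V : Type w} [AddCommGroup V] [Module (ZMod ℓ) V] [Finite V]
  {N : Subgroup F} (hN : IsClosedNormal Γ N)
  (τ : Representation (ZMod ℓ) (SemiProd F Γ) V) [hτ : τ.IsIrreducible]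

omit [TotallyDisconnectedSpace F] [Finite Γ] [ContinuousConstSMul Γ F] in
include hN in
-- For every decomposition the count times `dim End V` is `dim Hom(N, V)`, and the finite nonzero
-- factor `dim End V` cancels.
theorem count_eq_groupMultiplicity (D : IrreducibleDecomposition Γ N) :
    D.count (moduleAut τ) = groupMultiplicity N (moduleAut τ) := by
  refine le_antisymm (le_iSup (fun D : IrreducibleDecomposition Γ N => D.count (moduleAut τ)) D)
    (iSup_le fun D' => ?_)
  rw [← ENat.mul_le_mul_right_iff (dimN_end_ne_zero τ) (dimN_end_ne_top τ),
    count_mul_dimN hN τ D, count_mul_dimN hN τ D']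

include hN in
theorem groupMultiplicity_mul :
    groupMultiplicity N (moduleAut τ) * dimN (ZMod ℓ) (Representation.IntertwiningMap τ τ) =
      dimN (ZMod ℓ) (eqHom N τ) := by
  obtain ⟨D⟩ := nonempty_irreducibleDecomposition hN
  rw [← count_eq_groupMultiplicity hN τ D, count_mul_dimN hN τ D]

/-- Factors are finite quotients of a subgroup of a pro-`m'` group, so their orders are prime to
`m`, while `ℓ` divides the order of `V`. -/
theorem groupMultiplicity_eq_zero {m : ℕ} (hF : IsProPrime m F) (hℓ : ℓ ∣ m) :
    groupMultiplicity N (moduleAut τ) = 0 := by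
  rw [← nonpos_iff_eq_zero]
  refine iSup_le fun D => ?_
  have hempty : {i : D.ι | IsoGroups (D.act i) (moduleAut τ)} = ∅ := by
    rw [Set.eq_empty_iff_forall_notMem]
    rintro i ⟨e, -⟩
    have hψs : Function.Surjective ((Pi.evalMonoidHom D.B i).comp D.proj) :=
      (Function.surjective_eval i).comp D.surjective_proj
    have hcop := hF.coprime_card (ψ := (Pi.evalMonoidHom D.B i).comp D.proj)
      (D.continuous_proj i) hψs
    have hdvd : ℓ ∣ Nat.card (D.B i) := by
      rw [Nat.card_congr e.toEquiv, Nat.card_congr Multiplicative.toAdd]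
      exact dvd_card_of_irreducible τ
    have := Nat.dvd_gcd hdvd hℓ
    rw [(hcop : Nat.gcd _ _ = 1)] at this
    exact (Fact.out : ℓ.Prime).one_lt.ne' (Nat.dvd_one.1 this)
  rw [IrreducibleDecomposition.count, hempty, Set.encard_empty]

end Count

/-! ### Dimension formulas for the kernel of a presentation -/

section Euler

variable {n : ℕ} {Γ : Type u} [Group Γ] [Finite Γ] [TopologicalSpace Γ] [DiscreteTopology Γ]
  {G : Type v} [Group G] [TopologicalSpace G] [IsTopologicalGroup G] [T2Space G]
  [MulDistribMulAction Γ G] [ContinuousConstSMul Γ G] {V : Type w} [AddCommGroup V]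
  [Module (ZMod ℓ) V] [Finite V] {φ : FreeProfinite n Γ →* G} (hφc : Continuous φ)
  (hφ : Function.Surjective φ) (hΓ : ∀ (γ : Γ) (x : FreeProfinite n Γ), φ (γ • x) = γ • φ x)
  {ρ : Representation (ZMod ℓ) (SemiProd G Γ) V} (hρ : ∀ a : V, IsLocallyConstant (fun h => ρ h a))
  (hcard : ¬ ℓ ∣ Nat.card Γ)

include hφc hφ hΓ hρ in
omit [IsTopologicalGroup G] [Finite Γ] [T2Space G] [ContinuousConstSMul Γ G]
  [DiscreteTopology Γ] in
-- Inflation embeds the equivariant cocycles on `G` into those on `F_n`, a space of dimension `n dim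
-- V`.
theorem dimN_equivZ1_ne_top : dimN (ZMod ℓ) (equivZ1 ρ) ≠ ⊤ := by
  have hinj : Function.Injective (inflateZ1 φ hφc hΓ ρ) := by
    rw [injective_iff_map_eq_zero]
    intro f hf
    ext g
    obtain ⟨x, rfl⟩ := hφ g
    exact congrFun (congrArg Subtype.val hf) x
  refine ne_top_of_le_ne_top ?_ (dimN_le_of_injective _ hinj)
  rw [dimN_equivZ1_free _ fun a => ?_]
  · rw [← dimN_pi]
    exact dimN_ne_top
  · simp only [resG_comp_map]
    exact ((hρ a).comp_continuous SemiProd.continuous_inl).comp_continuous hφc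

include hφc hφ hΓ hρ hcard

theorem dimN_H1_add_xiN_ne_top : dimN (ZMod ℓ) (H1 ρ) + xiN ρ ≠ ⊤ := by
  rw [dimN_H1_add_xiN ρ hρ (natCast_card_ne_zero hcard)]
  exact dimN_equivZ1_ne_top hφc hφ hΓ hρ

theorem dimN_H1inv_add_xiN_ne_top : dimN (ZMod ℓ) (H1inv ρ) + xiN ρ ≠ ⊤ := by
  rw [dimN_H1inv_add_xiN ρ (natCast_card_ne_zero hcard) fun a =>
    (hρ a).comp_continuous SemiProd.continuous_inl]
  exact dimN_equivZ1_ne_top hφc hφ hΓ hρ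

theorem dimN_eqHom_add_semi :
    dimN (ZMod ℓ) (eqHom φ.ker (ρ.comp (SemiProd.map φ hΓ))) +
      (dimN (ZMod ℓ) (H1 ρ) + xiN ρ) = n * dimN (ZMod ℓ) V + dimN (ZMod ℓ) (H2 ρ) := by
  rw [dimN_H1_add_xiN ρ hρ (natCast_card_ne_zero hcard)]
  exact dimN_eqHom_add φ hφc hφ hΓ ρ (natCast_card_ne_zero hcard)
    (fun a => (hρ a).comp_continuous SemiProd.continuous_inl) _
    (isEquivH2_toH2semi ρ hρ (natCast_card_ne_zero hcard))

theorem dimN_eqHom_add_inv :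
    dimN (ZMod ℓ) (eqHom φ.ker (ρ.comp (SemiProd.map φ hΓ))) +
      (dimN (ZMod ℓ) (H1inv ρ) + xiN ρ) = n * dimN (ZMod ℓ) V + dimN (ZMod ℓ) (H2inv ρ) := by
  rw [dimN_H1inv_add_xiN ρ (natCast_card_ne_zero hcard) fun a =>
    (hρ a).comp_continuous SemiProd.continuous_inl]
  exact dimN_eqHom_add φ hφc hφ hΓ ρ (natCast_card_ne_zero hcard)
    (fun a => (hρ a).comp_continuous SemiProd.continuous_inl) _
    (isEquivH2_toH2inv ρ (natCast_card_ne_zero hcard))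

end Euler

end Multiplicities

/-! ### Comparison of a presentation with its pro-`|Γ|'` completion -/

section Completion

variable {n : ℕ} {Γ : Type u} [Group Γ] [Finite Γ] [TopologicalSpace Γ] [DiscreteTopology Γ]
  {G : Type v} [Group G] [TopologicalSpace G] [IsTopologicalGroup G] [CompactSpace G]
  [T2Space G] [TotallyDisconnectedSpace G] [MulDistribMulAction Γ G] [ContinuousConstSMul Γ G]
  (φ : FreeProfinite n Γ →ₜ* G) (m : ℕ)

/-- The composite of a presentation with the projection to the completion. -/
noncomputable def toCompletion : FreeProfinite n Γ →* ProPrimeCompletion m G :=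
  (QuotientGroup.mk' (proPrimeKernel m G)).comp φ.toMonoidHom

omit [Finite Γ] [TopologicalSpace Γ] [DiscreteTopology Γ] [IsTopologicalGroup G] [CompactSpace G]
  [T2Space G] [TotallyDisconnectedSpace G] [MulDistribMulAction Γ G] [ContinuousConstSMul Γ G] in
theorem mem_ker_toCompletion (x : FreeProfinite n Γ) :
    x ∈ (toCompletion φ m).ker ↔ φ.toMonoidHom x ∈ proPrimeKernel m G :=
  QuotientGroup.eq_one_iff _

omit [Finite Γ] [TopologicalSpace Γ] [DiscreteTopology Γ] [CompactSpace G]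
  [T2Space G] [TotallyDisconnectedSpace G] [MulDistribMulAction Γ G] [ContinuousConstSMul Γ G] in
theorem continuous_toCompletion : Continuous (toCompletion φ m) :=
  (ProPrimeCompletion.continuous_mk m).comp φ.continuous_toFun

variable {φ} (hφ : Function.Surjective φ) (hΓ : ∀ (γ : Γ) (x : FreeProfinite n Γ), φ (γ • x) = γ • φ x)

include hφ in
omit [Finite Γ] [TopologicalSpace Γ] [DiscreteTopology Γ] [IsTopologicalGroup G] [CompactSpace G]
  [T2Space G] [TotallyDisconnectedSpace G] [MulDistribMulAction Γ G] [ContinuousConstSMul Γ G] in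
theorem toCompletion_surjective : Function.Surjective (toCompletion φ m) :=
  (QuotientGroup.mk'_surjective _).comp hφ

include hΓ in
omit [Finite Γ] [TopologicalSpace Γ] [DiscreteTopology Γ] [IsTopologicalGroup G] [CompactSpace G]
  [T2Space G] [TotallyDisconnectedSpace G] in
theorem toCompletion_smul (γ : Γ) (x : FreeProfinite n Γ) :
    toCompletion φ m (γ • x) = γ • toCompletion φ m x := by
  change QuotientGroup.mk' (proPrimeKernel m G) (φ (γ • x)) = _
  rw [hΓ]
  rfl

include hφ in
omit [Finite Γ] [TopologicalSpace Γ] [DiscreteTopology Γ] [IsTopologicalGroup G] [CompactSpace G]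
  [T2Space G] [TotallyDisconnectedSpace G] [MulDistribMulAction Γ G] [ContinuousConstSMul Γ G] in
theorem ProPrimeCompletion.map_surjective :
    Function.Surjective (ProPrimeCompletion.map m φ) := fun y => by
  obtain ⟨x, hx⟩ := toCompletion_surjective m hφ y
  exact ⟨QuotientGroup.mk x, hx⟩

variable {ℓ : ℕ} [Fact ℓ.Prime] {V : Type w} [AddCommGroup V] [Module (ZMod ℓ) V] {m}
  (ρ : Representation (ZMod ℓ) (SemiProd (ProPrimeCompletion m G) Γ) V)

theorem comp_map_toCompletion :
    (inflate ρ).comp (SemiProd.map φ.toMonoidHom hΓ) =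
      ρ.comp (SemiProd.map (toCompletion φ m) (toCompletion_smul m hΓ)) := rfl

/-- The kernel of `F_n → G'` is the preimage of `N'`, and its homomorphisms to `V` kill the pro-`m'`
kernel of `F_n`. This replaces `F_n' → G'` by the presentation `F_n → G'`, to which the dimension
formulas apply. -/
theorem dimN_eqHom_map (hℓ : ℓ.Coprime m)
    (hΓ' : ∀ (γ : Γ) (x : ProPrimeCompletion m (FreeProfinite n Γ)),
      ProPrimeCompletion.map m φ (γ • x) = γ • ProPrimeCompletion.map m φ x) :
    dimN (ZMod ℓ) (eqHom (ProPrimeCompletion.map m φ).ker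
        (ρ.comp (SemiProd.map (ProPrimeCompletion.map m φ) hΓ'))) =
      dimN (ZMod ℓ) (eqHom (toCompletion φ m).ker
        (ρ.comp (SemiProd.map (toCompletion φ m) (toCompletion_smul m hΓ)))) := by
  have hN := isClosedNormal_ker (continuous_toCompletion φ m) (toCompletion_smul m hΓ)
  refine dimN_eqHom_comap (q := QuotientGroup.mk' (proPrimeKernel m (FreeProfinite n Γ)))
    (ProPrimeCompletion.continuous_mk m) (QuotientGroup.mk'_surjective _)
    ProPrimeCompletion.mk_smul hN.1 (fun x => Iff.rfl) (fun h => rfl) fun f hf x hx => ?_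
  refine eqHom_eq_zero_of_mem_proPrimeKernel hℓ hN (fun y hy => ?_) hf x
    ((QuotientGroup.eq_one_iff _).1 hx)
  rw [mem_ker_toCompletion]
  exact proPrimeKernel_map m φ.toMonoidHom φ.continuous_toFun hy

include hφ

theorem dimN_eqHom_map_le (hℓ : ℓ.Coprime m)
    (hΓ' : ∀ (γ : Γ) (x : ProPrimeCompletion m (FreeProfinite n Γ)),
      ProPrimeCompletion.map m φ (γ • x) = γ • ProPrimeCompletion.map m φ x) :
    dimN (ZMod ℓ) (eqHom (ProPrimeCompletion.map m φ).ker
        (ρ.comp (SemiProd.map (ProPrimeCompletion.map m φ) hΓ'))) ≤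
      dimN (ZMod ℓ) (eqHom φ.toMonoidHom.ker
        ((inflate ρ).comp (SemiProd.map φ.toMonoidHom hΓ))) := by
  rw [dimN_eqHom_map hΓ ρ hℓ hΓ', comp_map_toCompletion hΓ ρ]
  have hN := isClosedNormal_ker (continuous_toCompletion φ m) (toCompletion_smul m hΓ)
  exact dimN_le_of_injective _ (restrictEqHom_injective hℓ φ.continuous_toFun hφ hN.1
    (mem_ker_toCompletion φ m) fun x hx => by
      rw [mem_ker_toCompletion, show φ.toMonoidHom x = 1 from hx]
      exact Subgroup.one_mem _)

theorem dimN_eqHom_map_eq [Finite V] (hℓ : ℓ.Coprime m)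
    (hΓ' : ∀ (γ : Γ) (x : ProPrimeCompletion m (FreeProfinite n Γ)),
      ProPrimeCompletion.map m φ (γ • x) = γ • ProPrimeCompletion.map m φ x)
    (hH2 : Subsingleton (H2 (Representation.trivial (ZMod ℓ) (proPrimeKernel m G) (ZMod ℓ)))) :
    dimN (ZMod ℓ) (eqHom (ProPrimeCompletion.map m φ).ker
        (ρ.comp (SemiProd.map (ProPrimeCompletion.map m φ) hΓ'))) =
      dimN (ZMod ℓ) (eqHom φ.toMonoidHom.ker
        ((inflate ρ).comp (SemiProd.map φ.toMonoidHom hΓ))) := by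
  rw [dimN_eqHom_map hΓ ρ hℓ hΓ', comp_map_toCompletion hΓ ρ]
  have hN := isClosedNormal_ker (continuous_toCompletion φ m) (toCompletion_smul m hΓ)
  have hle : φ.toMonoidHom.ker ≤ (toCompletion φ m).ker := fun x hx => by
    rw [mem_ker_toCompletion, show φ.toMonoidHom x = 1 from hx]
    exact Subgroup.one_mem _
  refine dimN_congr (LinearEquiv.ofBijective (restrictEqHom hle _)
    ⟨restrictEqHom_injective hℓ φ.continuous_toFun hφ hN.1 (mem_ker_toCompletion φ m) hle,
      restrictEqHom_surjective hℓ φ.continuous_toFun hφ hN (mem_ker_toCompletion φ m) hle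
        (isClosedNormal_ker φ.continuous_toFun hΓ) (fun x hx => ?_) hH2⟩)
  have h1 : SemiProd.map (toCompletion φ m) (toCompletion_smul m hΓ)
      (SemidirectProduct.inl x) = 1 := by
    have : toCompletion φ m x = 1 := hx
    simp [SemiProd.map, this]
  rw [MonoidHom.comp_apply, h1, map_one]

end Completion

/-! ### Numerical consequences -/

section Numerical

theorem toE_multiplicity {m X H h1 h2 ξ d : ℕ∞} {n : ℕ} (hm : m * H = X)
    (h : X + (h1 + ξ) = n * d + h2) (hz : h1 + ξ ≠ ⊤) (hd : d ≠ ⊤) (h0 : H ≠ 0) (ht : H ≠ ⊤) :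
    toE m = (n * toE d - toE ξ + toE h2 - toE h1) / toE H := by
  rw [toE_div hm h0 ht, toE_euler h rfl hz hd]

theorem toE_div_mono {a b H : ℕ∞} (hab : a ≤ b) : toE a / toE H ≤ toE b / toE H :=
  EReal.div_le_div_right_of_nonneg (EReal.coe_ennreal_nonneg _)
    (toE_mono hab)

theorem ENat.eq_of_forall_le_natCast_iff {a b : ℕ∞} (h : ∀ k : ℕ, a ≤ k ↔ b ≤ k) : a = b := by
  have key : ∀ {a b : ℕ∞}, (∀ k : ℕ, a ≤ k ↔ b ≤ k) → a ≤ b := fun {a b} h => by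
    rcases eq_or_ne b ⊤ with rfl | hb
    · exact le_top
    · lift b to ℕ using hb
      exact (h b).2 le_rfl
  exact le_antisymm (key h) (key fun k => (h k).symm)

theorem toE_max_one (a : ℕ∞) : toE (max a 1) = max (toE a) 1 := by
  have h : Monotone toE := fun _ _ => toE_mono
  rw [h.map_max]
  congr 1
  have := toE_natCast 1
  simpa using this

theorem ceilDiv_mono {X Y : ℕ∞} (h : X ≤ Y) {d : ℕ∞} (hd : d ≠ 0) : ceilDiv X d ≤ ceilDiv Y d :=
  (ceilDiv_le_iff hd).2 (h.trans ((ceilDiv_le_iff hd).1 le_rfl))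

end Numerical

/-! ### The suprema over simple modules of characteristic prime to `|Γ|` -/

section Suprema

variable (Γ : Type u) [Group Γ] [TopologicalSpace Γ] (G : Type v) [Group G] [TopologicalSpace G]
  [MulDistribMulAction Γ G] [ContinuousConstSMul Γ G]

/-- The finite simple modules of characteristic prime to `|Γ|` over `G' ⋊ Γ`. -/
def CoprimeModule : Type _ :=
  Σ' (ℓ : ℕ) (_ : Fact ℓ.Prime) (_ : ¬ ℓ ∣ Nat.card Γ),
    FinSimpleModule.{max u v, w} ℓ (SemiProd (ProPrimeCompletion (Nat.card Γ) G) Γ)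

namespace CoprimeModule

variable {Γ G} (a : CoprimeModule.{u, v, w} Γ G)

instance : Fact a.1.Prime := a.2.1

/-- The underlying module. -/
def mod : FinSimpleModule.{max u v, w} a.1 (SemiProd (ProPrimeCompletion (Nat.card Γ) G) Γ) :=
  a.2.2.2

theorem not_dvd : ¬ a.1 ∣ Nat.card Γ := a.2.2.1

instance : a.mod.ρ.IsIrreducible := a.mod.irreducible

theorem dim_ne_zero : dimN (ZMod a.1) a.mod.V ≠ 0 := dimN_ne_zero_of_irreducible a.mod.ρ

end CoprimeModule

instance [Finite Γ] : Nonempty (CoprimeModule.{u, v, w} Γ G) := by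
  obtain ⟨ℓ, hle, hℓ⟩ := Nat.exists_infinite_primes (Nat.card Γ + 1)
  have : Fact ℓ.Prime := ⟨hℓ⟩
  obtain ⟨A⟩ := exists_finSimpleModule_trivial.{max u v, w} ℓ
    (SemiProd (ProPrimeCompletion (Nat.card Γ) G) Γ)
  exact ⟨⟨ℓ, this, fun h => absurd (Nat.le_of_dvd Nat.card_pos h) (by omega), A⟩⟩

variable {Γ G} [Finite Γ] {n : ℕ} (X : CoprimeModule.{u, v, w} Γ G → ℕ∞)

theorem relatorSup_add
    (hX : ∀ a, X a + (dimN (ZMod a.1) (H1 a.mod.ρ) + xiN a.mod.ρ) =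
      n * dimN (ZMod a.1) a.mod.V + dimN (ZMod a.1) (H2 a.mod.ρ))
    (hz : ∀ a : CoprimeModule.{u, v, w} Γ G,
      dimN (ZMod a.1) (H1 a.mod.ρ) + xiN a.mod.ρ ≠ ⊤) :
    relatorSup.{u, v, w} Γ G + n = toE (⨆ a, ceilDiv (X a) (dimN (ZMod a.1) a.mod.V)) := by
  rw [← iSup_sub_add]
  congr 1
  simp only [← fun a => eCeil_euler (hX a) (hz a) a.dim_ne_zero dimN_ne_top]
  refine le_antisymm ?_ ?_
  · exact iSup_le fun ℓ => iSup_le fun hp => iSup_le fun hℓ => iSup_le fun A =>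
      le_iSup (fun a : CoprimeModule.{u, v, w} Γ G => eCeil ((toE (dimN (ZMod a.1) (H2 a.mod.ρ)) -
        toE (dimN (ZMod a.1) (H1 a.mod.ρ)) - toE (xiN a.mod.ρ)) /
          toE (dimN (ZMod a.1) a.mod.V))) ⟨ℓ, hp, hℓ, A⟩
  · exact iSup_le fun a => le_iSup_of_le a.1 (le_iSup_of_le a.2.1 (le_iSup_of_le a.2.2.1
      (le_iSup_of_le a.2.2.2 le_rfl)))

theorem relatorSupInv_add
    (hX : ∀ a, X a + (dimN (ZMod a.1) (H1inv (inflate a.mod.ρ)) + xiN (inflate a.mod.ρ)) =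
      n * dimN (ZMod a.1) a.mod.V + dimN (ZMod a.1) (H2inv (inflate a.mod.ρ)))
    (hz : ∀ a : CoprimeModule.{u, v, w} Γ G,
      dimN (ZMod a.1) (H1inv (inflate a.mod.ρ)) + xiN (inflate a.mod.ρ) ≠ ⊤) :
    relatorSupInv.{u, v, w} Γ G + n = toE (⨆ a, ceilDiv (X a) (dimN (ZMod a.1) a.mod.V)) := by
  rw [← iSup_sub_add]
  congr 1
  simp only [← fun a => eCeil_euler (hX a) (hz a) a.dim_ne_zero dimN_ne_top]
  refine le_antisymm ?_ ?_
  · exact iSup_le fun ℓ => iSup_le fun hp => iSup_le fun hℓ => iSup_le fun A =>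
      le_iSup (fun a : CoprimeModule.{u, v, w} Γ G =>
        eCeil ((toE (dimN (ZMod a.1) (H2inv (inflate a.mod.ρ))) -
          toE (dimN (ZMod a.1) (H1inv (inflate a.mod.ρ))) - toE (xiN (inflate a.mod.ρ))) /
            toE (dimN (ZMod a.1) a.mod.V))) ⟨ℓ, hp, hℓ, A⟩
  · exact iSup_le fun a => le_iSup_of_le a.1 (le_iSup_of_le a.2.1 (le_iSup_of_le a.2.2.1
      (le_iSup_of_le a.2.2.2 le_rfl)))

end Suprema

/-! ### Multiplicities and the number of relators of a `Γ`-presentation -/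

section Relators

variable {n : ℕ} {Γ : Type u} [Group Γ] [Finite Γ] [TopologicalSpace Γ] [DiscreteTopology Γ]
  {G : Type v} [Group G] [TopologicalSpace G] [IsTopologicalGroup G] [CompactSpace G]
  [T2Space G] [TotallyDisconnectedSpace G] [MulDistribMulAction Γ G] [ContinuousConstSMul Γ G]

theorem isLocallyConstant_inflate {ℓ m : ℕ} {V : Type w} [AddCommGroup V] [Module (ZMod ℓ) V]
    {ρ : Representation (ZMod ℓ) (SemiProd (ProPrimeCompletion m G) Γ) V}
    (hρ : ∀ a : V, IsLocallyConstant (fun h => ρ h a)) (a : V) :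
    IsLocallyConstant (fun h => inflate ρ h a) :=
  (hρ a).comp_continuous (SemiProd.continuous_iff.2
    ⟨(ProPrimeCompletion.continuous_mk m).comp SemiProd.continuous_left,
      SemiProd.continuous_right⟩)

section Multiplicity

variable {ℓ : ℕ} [Fact ℓ.Prime] {Q : Type v} [Group Q] [TopologicalSpace Q] [T2Space Q]
  [MulDistribMulAction Γ Q] {F : Type w} [Group F] [TopologicalSpace F] [IsTopologicalGroup F]
  [CompactSpace F] [T2Space F] [TotallyDisconnectedSpace F] [MulDistribMulAction Γ F]
  [ContinuousConstSMul Γ F] {q : F →* Q} {V : Type*} [AddCommGroup V] [Module (ZMod ℓ) V]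
  [Finite V]

theorem presMultiplicity_mul (hqc : Continuous q) (hqs : Function.Surjective q)
    (hq : ∀ (γ : Γ) (x : F), q (γ • x) = γ • q x)
    (ρ : Representation (ZMod ℓ) (SemiProd Q Γ) V) [ρ.IsIrreducible] :
    presMultiplicity q hq ρ * dimN (ZMod ℓ) (Representation.IntertwiningMap ρ ρ) =
      dimN (ZMod ℓ) (eqHom q.ker (ρ.comp (SemiProd.map q hq))) := by
  have := isIrreducible_comp ρ (SemiProd.map_surjective hqs hq)
  rw [← dimN_end_comp ρ (SemiProd.map_surjective hqs hq)]
  exact groupMultiplicity_mul (isClosedNormal_ker hqc hq) _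

theorem count_eq_presMultiplicity (hqc : Continuous q) (hqs : Function.Surjective q)
    (hq : ∀ (γ : Γ) (x : F), q (γ • x) = γ • q x)
    (ρ : Representation (ZMod ℓ) (SemiProd Q Γ) V) [ρ.IsIrreducible]
    (D : IrreducibleDecomposition Γ q.ker) :
    D.count (pullbackAut q hq ρ) = presMultiplicity q hq ρ := by
  have := isIrreducible_comp ρ (SemiProd.map_surjective hqs hq)
  exact count_eq_groupMultiplicity (isClosedNormal_ker hqc hq) _ D

end Multiplicity

variable {φ : FreeProfinite n Γ →ₜ* G} (hφ : Function.Surjective φ)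
  (hΓ : ∀ (γ : Γ) (x : FreeProfinite n Γ), φ (γ • x) = γ • φ x)
  (hΓ' : ∀ (γ : Γ) (x : ProPrimeCompletion (Nat.card Γ) (FreeProfinite n Γ)),
    ProPrimeCompletion.map (Nat.card Γ) φ (γ • x) = γ • ProPrimeCompletion.map (Nat.card Γ) φ x)

section Dimensions

variable {ℓ : ℕ} [Fact ℓ.Prime]
  (A : FinSimpleModule.{max u v, w} ℓ (SemiProd (ProPrimeCompletion (Nat.card Γ) G) Γ))
  (hℓ : ¬ ℓ ∣ Nat.card Γ)

include hφ hΓ hℓ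

theorem dimN_eqHom_map_add_semi :
    dimN (ZMod ℓ) (eqHom (ProPrimeCompletion.map (Nat.card Γ) φ).ker
      (A.ρ.comp (SemiProd.map (ProPrimeCompletion.map (Nat.card Γ) φ) hΓ'))) +
      (dimN (ZMod ℓ) (H1 A.ρ) + xiN A.ρ) =
        n * dimN (ZMod ℓ) A.V + dimN (ZMod ℓ) (H2 A.ρ) := by
  rw [dimN_eqHom_map hΓ A.ρ ((Nat.Prime.coprime_iff_not_dvd Fact.out).2 hℓ)]
  exact dimN_eqHom_add_semi (continuous_toCompletion φ _) (toCompletion_surjective _ hφ)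
    (toCompletion_smul _ hΓ) A.continuous hℓ

theorem dimN_H1_completion_ne_top : dimN (ZMod ℓ) (H1 A.ρ) + xiN A.ρ ≠ ⊤ :=
  dimN_H1_add_xiN_ne_top (continuous_toCompletion φ _) (toCompletion_surjective _ hφ)
    (toCompletion_smul _ hΓ) A.continuous hℓ

theorem dimN_eqHom_inflate_add_inv :
    dimN (ZMod ℓ) (eqHom φ.toMonoidHom.ker
      ((inflate A.ρ).comp (SemiProd.map φ.toMonoidHom hΓ))) +
      (dimN (ZMod ℓ) (H1inv (inflate A.ρ)) + xiN (inflate A.ρ)) =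
        n * dimN (ZMod ℓ) A.V + dimN (ZMod ℓ) (H2inv (inflate A.ρ)) :=
  dimN_eqHom_add_inv φ.continuous_toFun hφ hΓ (isLocallyConstant_inflate A.continuous) hℓ

theorem dimN_H1inv_inflate_ne_top :
    dimN (ZMod ℓ) (H1inv (inflate A.ρ)) + xiN (inflate A.ρ) ≠ ⊤ :=
  dimN_H1inv_add_xiN_ne_top φ.continuous_toFun hφ hΓ (isLocallyConstant_inflate A.continuous) hℓ

end Dimensions

section Generators

include hφ hΓ

theorem minGenerators_map_le_iff (k : ℕ) :
    minGenerators Γ (ProPrimeCompletion.map (Nat.card Γ) φ).ker ≤ k ↔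
      (⨆ a : CoprimeModule.{u, v, w} Γ G,
        ceilDiv (dimN (ZMod a.1) (eqHom (ProPrimeCompletion.map (Nat.card Γ) φ).ker
          (a.mod.ρ.comp (SemiProd.map (ProPrimeCompletion.map (Nat.card Γ) φ) hΓ'))))
          (dimN (ZMod a.1) a.mod.V)) ≤ k ∧
      (1 ≤ k ∨ (ProPrimeCompletion.map (Nat.card Γ) φ).ker = ⊥) := by
  rw [minGenerators_le_iff (isProPrime_proPrimeCompletion _)
    (ProPrimeCompletion.continuous_map _ φ) (ProPrimeCompletion.map_surjective _ hφ) hΓ' k,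
    iSup_le_iff]
  refine and_congr_left' ⟨fun h a => (ceilDiv_le_iff a.dim_ne_zero).2 (h a.1 a.not_dvd a.mod),
    fun h ℓ hℓ hd A => ?_⟩
  exact (ceilDiv_le_iff (CoprimeModule.dim_ne_zero ⟨ℓ, hℓ, hd, A⟩)).1 (h ⟨ℓ, hℓ, hd, A⟩)

theorem minGenerators_map_eq_max (h : (ProPrimeCompletion.map (Nat.card Γ) φ).ker ≠ ⊥) :
    minGenerators Γ (ProPrimeCompletion.map (Nat.card Γ) φ).ker =
      max (⨆ a : CoprimeModule.{u, v, w} Γ G,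
        ceilDiv (dimN (ZMod a.1) (eqHom (ProPrimeCompletion.map (Nat.card Γ) φ).ker
          (a.mod.ρ.comp (SemiProd.map (ProPrimeCompletion.map (Nat.card Γ) φ) hΓ'))))
          (dimN (ZMod a.1) a.mod.V)) 1 :=
  ENat.eq_of_forall_le_natCast_iff fun k => by
    rw [minGenerators_map_le_iff.{u, v, w} hφ hΓ hΓ' k, max_le_iff, or_iff_left h,
      Nat.one_le_cast]

/-- If `N'` is not topologically perfect, some `Hom(N', A)` is nonzero, so the supremum is at least
`1` and the condition `k ≥ 1` is automatic. -/
theorem minGenerators_map_eq (h : (ProPrimeCompletion.map (Nat.card Γ) φ).ker = ⊥ ∨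
    closure ((⁅(ProPrimeCompletion.map (Nat.card Γ) φ).ker,
        (ProPrimeCompletion.map (Nat.card Γ) φ).ker⁆ :
        Subgroup (ProPrimeCompletion (Nat.card Γ) (FreeProfinite n Γ))) :
        Set (ProPrimeCompletion (Nat.card Γ) (FreeProfinite n Γ))) ≠
      (ProPrimeCompletion.map (Nat.card Γ) φ).ker) :
    minGenerators Γ (ProPrimeCompletion.map (Nat.card Γ) φ).ker =
      ⨆ a : CoprimeModule.{u, v, w} Γ G,
        ceilDiv (dimN (ZMod a.1) (eqHom (ProPrimeCompletion.map (Nat.card Γ) φ).ker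
          (a.mod.ρ.comp (SemiProd.map (ProPrimeCompletion.map (Nat.card Γ) φ) hΓ'))))
          (dimN (ZMod a.1) a.mod.V) := by
  refine ENat.eq_of_forall_le_natCast_iff fun k => ?_
  rw [minGenerators_map_le_iff.{u, v, w} hφ hΓ hΓ' k, and_iff_left_iff_imp]
  intro hk
  refine h.symm.imp_left fun h => ?_
  obtain ⟨ℓ, hℓ, hd, A, hA⟩ := exists_dimN_eqHom_ne_zero (isProPrime_proPrimeCompletion _)
    (ProPrimeCompletion.continuous_map _ φ) (ProPrimeCompletion.map_surjective _ hφ) hΓ' h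
  by_contra! hk0
  obtain rfl : k = 0 := by omega
  let a : CoprimeModule.{u, v, w} Γ G := ⟨ℓ, hℓ, hd, A⟩
  have h0 := (ceilDiv_le_iff a.dim_ne_zero).1 ((le_iSup _ a).trans hk)
  rw [Nat.cast_zero, zero_mul, nonpos_iff_eq_zero] at h0
  exact hA h0

end Generators

end Relators

theorem lemma3p2 (n : ℕ)
    {Γ : Type u} [Group Γ] [Finite Γ] [TopologicalSpace Γ] [DiscreteTopology Γ]
    {G : Type v} [Group G] [TopologicalSpace G] [IsTopologicalGroup G] [CompactSpace G]
    [T2Space G] [TotallyDisconnectedSpace G]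
    [MulDistribMulAction Γ G] [ContinuousConstSMul Γ G]
    (φ : FreeProfinite n Γ →ₜ* G) (hφ : Function.Surjective φ)
    (hΓ : ∀ (γ : Γ) (x : FreeProfinite n Γ), φ (γ • x) = γ • φ x) :
    -- the multiplicities in the presentation `F_n ⋊ Γ → G ⋊ Γ`, with kernel `N = ker φ`
    (Nonempty (IrreducibleDecomposition Γ φ.toMonoidHom.ker) ∧
      ∀ (ℓ : ℕ) [Fact ℓ.Prime] (A : FinSimpleModule.{max u v, w} ℓ (SemiProd G Γ)),
        (Nat.card A.V).Coprime (Nat.card Γ) →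
        (∀ D : IrreducibleDecomposition Γ φ.toMonoidHom.ker,
          D.count (pullbackAut φ.toMonoidHom hΓ A.ρ) =
            presMultiplicity φ.toMonoidHom hΓ A.ρ) ∧
        Module.Finite (ZMod ℓ) (H1 A.ρ) ∧
        toE (presMultiplicity φ.toMonoidHom hΓ A.ρ) =
          (n * eDim ℓ A.V - xi A.ρ + eDim ℓ (H2 A.ρ) - eDim ℓ (H1 A.ρ)) / homDim A.ρ) ∧
    -- the induced homomorphism `φ' : F_n' → G'` with kernel `N'`
    ∀ (φ' : ProPrimeCompletion (Nat.card Γ) (FreeProfinite n Γ) →*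
          ProPrimeCompletion (Nat.card Γ) G)
      (hΓ' : ∀ (γ : Γ) (x : ProPrimeCompletion (Nat.card Γ) (FreeProfinite n Γ)),
          φ' (γ • x) = γ • φ' x),
    φ' = ProPrimeCompletion.map (Nat.card Γ) φ →
    -- the multiplicities in the presentation `F_n' ⋊ Γ → G' ⋊ Γ`
    (Nonempty (IrreducibleDecomposition Γ φ'.ker) ∧
      ∀ (ℓ : ℕ) [Fact ℓ.Prime]
        (A : FinSimpleModule.{max u v, w} ℓ
          (SemiProd (ProPrimeCompletion (Nat.card Γ) G) Γ)),
        (∀ D : IrreducibleDecomposition Γ φ'.ker,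
          D.count (pullbackAut φ' hΓ' A.ρ) = presMultiplicity φ' hΓ' A.ρ) ∧
        (ℓ ∣ Nat.card Γ → presMultiplicity φ' hΓ' A.ρ = 0) ∧
        (¬ ℓ ∣ Nat.card Γ →
          Module.Finite (ZMod ℓ) (H1 A.ρ) ∧
          Module.Finite (ZMod ℓ) (H1inv (inflate A.ρ)) ∧
          toE (presMultiplicity φ' hΓ' A.ρ) =
            (n * eDim ℓ A.V - xi A.ρ + eDim ℓ (H2 A.ρ) - eDim ℓ (H1 A.ρ)) / homDim A.ρ ∧
          toE (presMultiplicity φ' hΓ' A.ρ) ≤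
            (n * eDim ℓ A.V - xi (inflate A.ρ) + eDim ℓ (H2inv (inflate A.ρ)) -
              eDim ℓ (H1inv (inflate A.ρ))) / homDim (inflate A.ρ) ∧
          (Subsingleton (H2 (Representation.trivial (ZMod ℓ)
              (proPrimeKernel (Nat.card Γ) G) (ZMod ℓ))) →
            toE (presMultiplicity φ' hΓ' A.ρ) =
              (n * eDim ℓ A.V - xi (inflate A.ρ) + eDim ℓ (H2inv (inflate A.ρ)) -
                eDim ℓ (H1inv (inflate A.ρ))) / homDim (inflate A.ρ)))) ∧
    -- the minimal number of generators of `N'` as a closed normal `Γ`-subgroup of `F_n'`,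
    -- when `N'` is trivial or not topologically perfect
    (φ'.ker = ⊥ ∨
        closure ((⁅φ'.ker, φ'.ker⁆ :
            Subgroup (ProPrimeCompletion (Nat.card Γ) (FreeProfinite n Γ))) :
            Set (ProPrimeCompletion (Nat.card Γ) (FreeProfinite n Γ))) ≠ φ'.ker →
      toE (minGenerators Γ φ'.ker) = relatorSup.{u, v, w} Γ G + n ∧
      toE (minGenerators Γ φ'.ker) ≤ relatorSupInv.{u, v, w} Γ G + n ∧
      ((∀ ℓ : ℕ, ℓ.Prime → ¬ ℓ ∣ Nat.card Γ →
          Subsingleton (H2 (Representation.trivial (ZMod ℓ)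
            (proPrimeKernel (Nat.card Γ) G) (ZMod ℓ)))) →
        toE (minGenerators Γ φ'.ker) = relatorSupInv.{u, v, w} Γ G + n)) ∧
    -- the same for every nontrivial `N'`
    (φ'.ker ≠ ⊥ →
      toE (minGenerators Γ φ'.ker) = max (relatorSup.{u, v, w} Γ G + n) 1 ∧
      toE (minGenerators Γ φ'.ker) ≤ max (relatorSupInv.{u, v, w} Γ G + n) 1 ∧
      ((∀ ℓ : ℕ, ℓ.Prime → ¬ ℓ ∣ Nat.card Γ →
          Subsingleton (H2 (Representation.trivial (ZMod ℓ)
            (proPrimeKernel (Nat.card Γ) G) (ZMod ℓ)))) →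
        toE (minGenerators Γ φ'.ker) = max (relatorSupInv.{u, v, w} Γ G + n) 1)) := by
  have hdim {ℓ : ℕ} [Fact ℓ.Prime]
      (A : FinSimpleModule.{max u v, w} ℓ (SemiProd (ProPrimeCompletion (Nat.card Γ) G) Γ)) :
      dimN (ZMod ℓ) (Representation.IntertwiningMap (inflate A.ρ) (inflate A.ρ)) =
        dimN (ZMod ℓ) (Representation.IntertwiningMap A.ρ A.ρ) :=
    dimN_end_comp A.ρ (SemiProd.map_surjective (QuotientGroup.mk'_surjective _)
      ProPrimeCompletion.mk_smul)
  refine ⟨⟨nonempty_irreducibleDecomposition (isClosedNormal_ker φ.continuous_toFun hΓ),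
    fun ℓ _ A hcop => ?_⟩, ?_⟩
  · have := A.irreducible
    have hℓ : ¬ ℓ ∣ Nat.card Γ := fun h => (Fact.out : ℓ.Prime).one_lt.ne'
      (Nat.eq_one_of_dvd_coprimes hcop (dvd_card_of_irreducible A.ρ) h)
    have hz := dimN_H1_add_xiN_ne_top φ.continuous_toFun hφ hΓ A.continuous hℓ
    exact ⟨count_eq_presMultiplicity φ.continuous_toFun hφ hΓ A.ρ,
      dimN_ne_top_iff.1 (WithTop.add_ne_top.1 hz).1,
      toE_multiplicity (presMultiplicity_mul φ.continuous_toFun hφ hΓ A.ρ)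
        (dimN_eqHom_add_semi φ.continuous_toFun hφ hΓ A.continuous hℓ) hz dimN_ne_top
        (dimN_end_ne_zero A.ρ) (dimN_end_ne_top A.ρ)⟩
  rintro φ' hΓ' rfl
  have hc := ProPrimeCompletion.continuous_map (Nat.card Γ) φ
  have hs := ProPrimeCompletion.map_surjective (Nat.card Γ) hφ
  refine ⟨⟨nonempty_irreducibleDecomposition (isClosedNormal_ker hc hΓ'), fun ℓ _ A => ?_⟩, ?_⟩
  · have := A.irreducible
    refine ⟨count_eq_presMultiplicity hc hs hΓ' A.ρ, fun h => ?_, fun hℓ => ?_⟩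
    · have := isIrreducible_comp A.ρ (SemiProd.map_surjective hs hΓ')
      exact groupMultiplicity_eq_zero _ (isProPrime_proPrimeCompletion _) h
    have hcop := (Nat.Prime.coprime_iff_not_dvd Fact.out).2 hℓ
    have hz := dimN_H1_completion_ne_top hφ hΓ A hℓ
    have hz' := dimN_H1inv_inflate_ne_top hφ hΓ A hℓ
    have hm := toE_div (presMultiplicity_mul hc hs hΓ' A.ρ) (dimN_end_ne_zero A.ρ)
      (dimN_end_ne_top A.ρ)
    -- The right-hand side of the inequality is `dim Hom(N, A)` for the original presentation `F_n →
    -- G`, divided by the same `dim End A`, since `G ⋊ Γ → G' ⋊ Γ` is surjective.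
    have hY := toE_euler (dimN_eqHom_inflate_add_inv hφ hΓ A hℓ) rfl hz' dimN_ne_top
    have hE : homDim (inflate A.ρ) =
      toE (dimN (ZMod ℓ) (Representation.IntertwiningMap A.ρ A.ρ)) := congrArg toE (hdim A)
    refine ⟨dimN_ne_top_iff.1 (WithTop.add_ne_top.1 hz).1,
      dimN_ne_top_iff.1 (WithTop.add_ne_top.1 hz').1,
      toE_multiplicity (presMultiplicity_mul hc hs hΓ' A.ρ)
        (dimN_eqHom_map_add_semi hφ hΓ hΓ' A hℓ) hz dimN_ne_top
        (dimN_end_ne_zero A.ρ) (dimN_end_ne_top A.ρ), ?_, fun hH2 => ?_⟩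
    · rw [hm, hE]
      exact (toE_div_mono (dimN_eqHom_map_le hφ hΓ A.ρ hcop hΓ')).trans_eq
        (congrArg (· / _) hY)
    · rw [hm, hE, dimN_eqHom_map_eq hφ hΓ A.ρ hcop hΓ' hH2]
      exact congrArg (· / _) hY
  have hr := relatorSup_add _ (fun a => dimN_eqHom_map_add_semi hφ hΓ hΓ' a.mod a.not_dvd)
    fun a : CoprimeModule.{u, v, w} Γ G => dimN_H1_completion_ne_top hφ hΓ a.mod a.not_dvd
  have hr' := relatorSupInv_add _ (fun a => dimN_eqHom_inflate_add_inv hφ hΓ a.mod a.not_dvd)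
    fun a : CoprimeModule.{u, v, w} Γ G => dimN_H1inv_inflate_ne_top hφ hΓ a.mod a.not_dvd
  -- Both `r` and `r*` are suprema of `ceilDiv` over the same modules, so they are compared term by
  -- term through `Hom(N', A)` and `Hom(N, A)`.
  have hle : relatorSup.{u, v, w} Γ G + n ≤ relatorSupInv.{u, v, w} Γ G + n := by
    rw [hr, hr']
    exact toE_mono (iSup_mono fun a => ceilDiv_mono (dimN_eqHom_map_le hφ hΓ a.mod.ρ
      ((Nat.Prime.coprime_iff_not_dvd a.2.1.out).2 a.not_dvd) hΓ') a.dim_ne_zero)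
  have heq : (∀ ℓ : ℕ, ℓ.Prime → ¬ ℓ ∣ Nat.card Γ →
      Subsingleton (H2 (Representation.trivial (ZMod ℓ)
        (proPrimeKernel (Nat.card Γ) G) (ZMod ℓ)))) →
      relatorSup.{u, v, w} Γ G + n = relatorSupInv.{u, v, w} Γ G + n := fun hH2 => by
    rw [hr, hr']
    exact congrArg toE (iSup_congr fun a => congrArg (ceilDiv · _) (dimN_eqHom_map_eq hφ hΓ
      a.mod.ρ ((Nat.Prime.coprime_iff_not_dvd a.2.1.out).2 a.not_dvd) hΓ'
      (hH2 a.1 a.2.1.out a.not_dvd)))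
  refine ⟨fun h => ?_, fun h => ?_⟩
  · have hd := (congrArg toE (minGenerators_map_eq.{u, v, w} hφ hΓ hΓ' h)).trans hr.symm
    exact ⟨hd, hd.trans_le hle, fun hH2 => hd.trans (heq hH2)⟩
  · have hd := congrArg toE (minGenerators_map_eq_max.{u, v, w} hφ hΓ hΓ' h)
    rw [toE_max_one, ← hr] at hd
    exact ⟨hd, hd.trans_le (max_le_max_right 1 hle), fun hH2 => hd.trans (by rw [heq hH2])⟩
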